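/- There is a deterministic multi-tape (multi-stack) Turing machine that decides the following problem in polynomial time. Input: two nondeterministic finite automata $\mathcal{A}=(Q^{\mathcal A},\Sigma,\delta^{\mathcal A},q_0^{\mathcal A},F^{\mathcal A})$ and $\mathcal{B}=(Q^{\mathcal B},\Sigma,\delta^{\mathcal B},q_0^{\mathcal B},F^{\mathcal B})$ over a common finite alphabet $\Sigma$ (given as part of the input), each with one initial state and without $\varepsilon$-transitions, written as a bit string that lists the number of symbols and, for each automaton, its number of states, its initial state, its accepting states and its transitions. Question: is there a piecewise testable language $S\subseteq\Sigma^*$ that separates $L(\mathcal{A})$ and $L(\mathcal{B})$, that is, with $L(\mathcal{A})\subseteq S$ and $S\cap L(\mathcal{B})=\emptyset$, or with $L(\mathcal{B})\subseteq S$ and $S\cap L(\mathcal{A})=\emptyset$? The running time is bounded by a polynomial in the length of the input, and by a polynomial in $|Q^{\mathcal A}|+|Q^{\mathcal B}|+|\Sigma|$; in particular it is polynomial in the size of the alphabet as well. Here a language over $\Sigma$ is piecewise testable if it is a finite boolean combination of languages of the form $\Sigma^*a_1\Sigma^*\cdots\Sigma^*a_n\Sigma^*$ with $n\ge 0$ and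 $a_1,\dots,a_n\in\Sigma$. -/

import Mathlib

/-- A nondeterministic finite automaton `(Q, Σ, δ, q₀, F)` over the alphabet `Σ = Fin k`, with the
states numbered `0, …, numStates - 1`: one initial state, no silent transitions. -/
structure FinNFA (k : ℕ) where
  /-- the number of states -/
  numStates : ℕ
  /-- the transition function `Q × Σ → 2^Q` -/
  delta : Fin numStates → Fin k → Finset (Fin numStates)
  /-- the initial state -/
  init : Fin numStates
  /-- the accepting states -/
  final : Finset (Fin numStates)

namespace FinNFA

/-- The automaton as an `NFA` of Mathlib. -/
def toNFA {k : ℕ} (A : FinNFA k) : NFA (Fin k) (Fin A.numStates) where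
  step p a := {q | q ∈ A.delta p a}
  start := {A.init}
  accept := {q | q ∈ A.final}

/-- The set of words accepted by the automaton. -/
def language {k : ℕ} (A : FinNFA k) : Language (Fin k) := A.toNFA.accepts

end FinNFA

/-- The language `Σ* a₁ Σ* ⋯ Σ* aₙ Σ*` of the words that have `v = a₁ ⋯ aₙ` as a (scattered)
subsequence. -/
def subsequenceLanguage {α : Type*} (v : List α) : Language α := {w | List.Sublist v w}

/-- The piecewise testable languages: the finite boolean combinations of the languages
`Σ* a₁ Σ* ⋯ Σ* aₙ Σ*`. -/
inductive IsPiecewiseTestable {α : Type*} : Language α → Prop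
  | piece (v : List α) : IsPiecewiseTestable (subsequenceLanguage v)
  | union {S T : Language α} :
      IsPiecewiseTestable S → IsPiecewiseTestable T → IsPiecewiseTestable (S ⊔ T)
  | compl {S : Language α} : IsPiecewiseTestable S → IsPiecewiseTestable Sᶜ

/-- `S` separates `K` from `L`: it contains `K` and does not intersect `L`. -/
def SeparatesFrom {α : Type*} (S K L : Language α) : Prop := K ≤ S ∧ Disjoint S L

/-- `K` and `L` are separable by a piecewise testable language. -/
def PTSeparable {α : Type*} (K L : Language α) : Prop :=
  ∃ S : Language α, IsPiecewiseTestable S ∧ (SeparatesFrom S K L ∨ SeparatesFrom S L K)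

/-- An instance of the separability problem: two automata over a common finite alphabet. -/
structure SepInstance where
  /-- the number of symbols of the alphabet -/
  alphabetSize : ℕ
  /-- the first automaton -/
  A : FinNFA alphabetSize
  /-- the second automaton -/
  B : FinNFA alphabetSize

/-- The number `m` in self-delimiting unary, `1^m 0`. -/
def unaryCode (m : ℕ) : List Bool := List.replicate m true ++ [false]

namespace FinNFA

/-- The list of the accepting states: every entry is announced by a `1`, and a `0` closes the
list. -/
def finalCode {k : ℕ} (A : FinNFA k) : List Bool :=
  ((List.finRange A.numStates).flatMap fun q =>
    if q ∈ A.final then true :: unaryCode q else []) ++ [false]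

/-- The list of the transitions `(p, a, q)`, `q ∈ δ(p, a)`: every entry is announced by a `1`, and a
`0` closes the list. -/
def deltaCode {k : ℕ} (A : FinNFA k) : List Bool :=
  ((List.finRange A.numStates).flatMap fun p =>
    (List.finRange k).flatMap fun a =>
      (List.finRange A.numStates).flatMap fun q =>
        if q ∈ A.delta p a then true :: (unaryCode p ++ unaryCode a ++ unaryCode q) else [])
    ++ [false]

/-- The bit string that describes the automaton: number of states, initial state, accepting states,
transitions. -/
def code {k : ℕ} (A : FinNFA k) : List Bool :=
  unaryCode A.numStates ++ unaryCode A.init ++ A.finalCode ++ A.deltaCode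

end FinNFA

namespace SepInstance

/-- The bit string that describes the instance: number of symbols, first automaton, second
automaton. -/
def code (I : SepInstance) : List Bool := unaryCode I.alphabetSize ++ I.A.code ++ I.B.code

/-- The total number of states and of symbols of the instance. -/
def size (I : SepInstance) : ℕ := I.A.numStates + I.B.numStates + I.alphabetSize

/-- The correct answer to the instance: `true` exactly if the languages of the two automata are
separable by a piecewise testable language. -/
noncomputable def answer (I : SepInstance) : Bool :=
  @decide (PTSeparable I.A.language I.B.language) (Classical.propDecidable _)

end SepInstance

/-! A piecewise testable language cannot distinguish words with the same subsequences of length at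
most `m`, for some `m`. Over a finite alphabet the converse construction also works: saturating one
of the two languages under this congruence gives a piecewise testable language. Hence
non-separability means that for every `m` the two languages contain `SimonEquiv m` words
(`not_ptSeparable_iff`).

This infinite family of conditions is replaced by one finite certificate, a synchronized pattern: a
path in the product of the state sets whose steps either read a common letter or pass, in both
automata, through closed paths with the same label set `C`, entered and left inside `C`. Pumping the
closed paths turns a pattern into equivalent words for every `m` (`exists_simonEquiv_of_pattern`).
For the converse, Higman's lemma turns the equivalent pairs into one chain of words, increasing for
the subsequence order, that meets both languages infinitely often (`exists_chain_of_simonEquiv`).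
Induction on the alphabet cuts such a chain into simpler chains: either all words over the alphabet
embed in the chain, and long powers force closed paths with full label set, or some word is avoided,
and the chain is factored along that word, with Kőnig's lemma making the factorizations coherent
(`exists_pattern_of_chain`).

Patterns can be searched for in polynomial time. For given states `r`, `r'` there is a largest set
of letters that is saturated at both, obtained by repeatedly deleting letters that lie on no
admissible closed path. It can serve in place of every other such set, because a larger set only
allows more paths. The rest is reachability among pairs of states.

To obtain a genuine Turing machine, the search is written as a first-order program over the
positions of the input, whose only control structure is iteration over all positions. Such programs
are compiled to stack programs and these to `TM2` machines, with a polynomial time bound derived by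
induction on the syntax (`Prog.nonempty_computableInPolyTime`). Unary coding makes every state and
every letter a position of the input. The bound in terms of the number of states and symbols follows
because the code has polynomial length in that number. -/

/-! ### Piecewise testable separability and Simon's congruence -/

/-- Two words have the same subsequences of length at most `m`. -/
def SimonEquiv {α : Type*} (m : ℕ) (u v : List α) : Prop :=
  ∀ x : List α, x.length ≤ m → (x.Sublist u ↔ x.Sublist v)

namespace SimonEquiv

variable {α : Type*} {m m' : ℕ} {u v u' v' : List α}

theorem refl (m : ℕ) (u : List α) : SimonEquiv m u u := fun _ _ => Iff.rfl

theorem mono (h : SimonEquiv m u v) (hm : m' ≤ m) : SimonEquiv m' u v :=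
  fun x hx => h x (hx.trans hm)

theorem append (h : SimonEquiv m u v) (h' : SimonEquiv m u' v') :
    SimonEquiv m (u ++ u') (v ++ v') := by
  intro x hx
  simp only [List.sublist_append_iff]
  constructor
  · rintro ⟨x₁, x₂, rfl, h₁, h₂⟩
    simp only [List.length_append] at hx
    exact ⟨x₁, x₂, rfl, (h x₁ (by omega)).1 h₁, (h' x₂ (by omega)).1 h₂⟩
  · rintro ⟨x₁, x₂, rfl, h₁, h₂⟩
    simp only [List.length_append] at hx
    exact ⟨x₁, x₂, rfl, (h x₁ (by omega)).2 h₁, (h' x₂ (by omega)).2 h₂⟩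

end SimonEquiv

/-- A boolean combination mentions finitely many pieces, so their maximal length serves as `m`. -/
theorem IsPiecewiseTestable.exists_saturated {α : Type*} {S : Language α}
    (hS : IsPiecewiseTestable S) :
    ∃ m, ∀ u v : List α, SimonEquiv m u v → (u ∈ S ↔ v ∈ S) := by
  induction hS with
  | piece v => exact ⟨v.length, fun u w h => h v le_rfl⟩
  | union _ _ ih₁ ih₂ =>
    obtain ⟨m₁, h₁⟩ := ih₁
    obtain ⟨m₂, h₂⟩ := ih₂
    refine ⟨max m₁ m₂, fun u v h => ?_⟩
    exact or_congr (h₁ u v (h.mono (le_max_left _ _))) (h₂ u v (h.mono (le_max_right _ _)))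
  | compl _ ih =>
    obtain ⟨m, h⟩ := ih
    exact ⟨m, fun u v huv => not_congr (h u v huv)⟩

theorem IsPiecewiseTestable.univ {α : Type*} :
    IsPiecewiseTestable (Set.univ : Set (List α)) := by
  have h := IsPiecewiseTestable.piece ([] : List α)
  have h' : (subsequenceLanguage [] : Set (List α)) = Set.univ :=
    Set.eq_univ_of_forall fun w => List.nil_sublist w
  exact h' ▸ h

theorem IsPiecewiseTestable.inter {α : Type*} {S T : Language α}
    (hS : IsPiecewiseTestable S) (hT : IsPiecewiseTestable T) : IsPiecewiseTestable (S ⊓ T) := by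
  have h := (hS.compl.union hT.compl).compl
  have h' : (Sᶜ ⊔ Tᶜ)ᶜ = S ⊓ T := by simp
  exact h' ▸ h

/-- Allowing an arbitrary predicate `P` on the set of occurring pieces makes the induction work: one
splits on whether the head `v` embeds and absorbs the outcome into `P`. -/
theorem isPiecewiseTestable_of_pieces {α : Type*} (V : List (List α)) :
    ∀ P : Set (List α) → Prop,
      IsPiecewiseTestable ({w | P {v | v ∈ V ∧ v.Sublist w}} : Set (List α)) := by
  induction V with
  | nil =>
    intro P
    by_cases h : P ∅
    · have : ({w | P {v | v ∈ ([] : List (List α)) ∧ v.Sublist w}} : Set (List α)) = Set.univ := by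
        ext w; simpa using h
      rw [this]; exact .univ
    · have : ({w | P {v | v ∈ ([] : List (List α)) ∧ v.Sublist w}} : Set (List α)) =
          (Set.univ : Set (List α))ᶜ := by
        ext w; simpa using h
      rw [this]; exact IsPiecewiseTestable.univ.compl
  | cons v V ih =>
    intro P
    have h₁ := (IsPiecewiseTestable.piece v).inter (ih fun X => P (insert v X))
    have h₂ := (IsPiecewiseTestable.piece v).compl.inter (ih P)
    have h := h₁.union h₂
    refine Eq.subst (motive := IsPiecewiseTestable) (Set.ext fun w => Iff.symm ?_) h
    have key : ∀ w : List α, v.Sublist w →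
        {x | x ∈ v :: V ∧ x.Sublist w} = insert v {x | x ∈ V ∧ x.Sublist w} := by
      intro w hw; ext x
      simp only [List.mem_cons, Set.mem_ofPred_eq, Set.mem_insert_iff]
      constructor
      · rintro ⟨rfl | h, h'⟩ <;> tauto
      · rintro (rfl | h) <;> tauto
    have key' : ∀ w : List α, ¬ v.Sublist w →
        {x | x ∈ v :: V ∧ x.Sublist w} = {x | x ∈ V ∧ x.Sublist w} := by
      intro w hw; ext x
      simp only [List.mem_cons, Set.mem_ofPred_eq]
      constructor
      · rintro ⟨rfl | h, h'⟩ <;> tauto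
      · tauto
    show P _ ↔ (v.Sublist w ∧ P _) ∨ (¬ v.Sublist w ∧ P _)
    by_cases hw : v.Sublist w
    · rw [key w hw]; simp [hw]
    · rw [key' w hw]; simp [hw]

/-- If `K` and `L` contain no `SimonEquiv m` pair, the union of the classes meeting `K` separates
them; it is piecewise testable since a finite alphabet has finitely many words of length at most
`m`. As the congruence is symmetric, the direction of separation does not matter. -/
theorem not_ptSeparable_iff {α : Type*} [Finite α] {K L : Language α} :
    ¬ PTSeparable K L ↔ ∀ m, ∃ u ∈ K, ∃ v ∈ L, SimonEquiv m u v := by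
  constructor
  · intro h m
    by_contra! hm
    apply h
    let V := (List.finite_length_le α m).toFinset.toList
    have hV : ∀ v : List α, v ∈ V ↔ v.length ≤ m := by intro v; simp [V]
    refine ⟨_, isPiecewiseTestable_of_pieces V
      (fun X => ∃ u ∈ K, X = {v | v ∈ V ∧ v.Sublist u}), Or.inl ⟨?_, ?_⟩⟩
    · exact fun w hw => ⟨w, hw, rfl⟩
    · refine Set.disjoint_left.2 ?_
      rintro w ⟨u, hu, he⟩ hw
      refine hm u hu w hw fun x hx => ?_
      have := congrArg (x ∈ ·) he
      simp only [Set.mem_ofPred_eq, hV, hx, true_and, eq_iff_iff] at this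
      exact this.symm
  · rintro h ⟨S, hS, hs⟩
    obtain ⟨m, hm⟩ := hS.exists_saturated
    obtain ⟨u, hu, v, hv, huv⟩ := h m
    rcases hs with ⟨h₁, h₂⟩ | ⟨h₁, h₂⟩
    · exact Set.disjoint_left.1 h₂ ((hm u v huv).1 (h₁ hu)) hv
    · exact Set.disjoint_left.1 h₂ ((hm u v huv).2 (h₁ hv)) hu

/-! ### Runs of transition relations -/

section Run

variable {Q α : Type*}

/-- The word `w` labels a path from `p` to `q`. -/
def Run (D : Q → α → Q → Prop) : Q → List α → Q → Prop
  | p, [], q => p = q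
  | p, a :: w, q => ∃ r, D p a r ∧ Run D r w q

theorem run_append {D : Q → α → Q → Prop} {p q : Q} {u v : List α} :
    Run D p (u ++ v) q ↔ ∃ r, Run D p u r ∧ Run D r v q := by
  induction u generalizing p with
  | nil => simp [Run]
  | cons a u ih => simp only [List.cons_append, Run, ih]; grind

/-- `t` is reachable from `s` by a path with all labels in `C`. -/
def Within (D : Q → α → Q → Prop) (C : Set α) : Q → Q → Prop :=
  Relation.ReflTransGen fun s t => ∃ a ∈ C, D s a t

theorem within_iff {D : Q → α → Q → Prop} {C : Set α} {s t : Q} :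
    Within D C s t ↔ ∃ w : List α, (∀ a ∈ w, a ∈ C) ∧ Run D s w t := by
  constructor
  · intro h
    induction h using Relation.ReflTransGen.head_induction_on with
    | refl => exact ⟨[], by simp, rfl⟩
    | head h _ ih =>
      obtain ⟨a, ha, hD⟩ := h
      obtain ⟨w, hw, hr⟩ := ih
      exact ⟨a :: w, by simpa using ⟨ha, hw⟩, _, hD, hr⟩
  · rintro ⟨w, hw, hr⟩
    induction w generalizing s with
    | nil => obtain rfl := hr; exact .refl
    | cons a w ih =>
      obtain ⟨r, hD, hr⟩ := hr
      exact .head ⟨a, hw a (by simp), hD⟩ (ih (fun b hb => hw b (by simp [hb])) hr)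

/-- Every letter of `C` occurs on a closed path at `r` with all labels in `C`. -/
def Saturated (D : Q → α → Q → Prop) (C : Set α) (r : Q) : Prop :=
  ∀ a ∈ C, ∃ s t, Within D C r s ∧ D s a t ∧ Within D C t r

/-- The closed paths at `r` for the individual letters are concatenated; finiteness of `C` keeps the
result a word. -/
theorem Saturated.exists_loop {D : Q → α → Q → Prop} {C : Set α} {r : Q} (h : Saturated D C r)
    (hC : C.Finite) : ∃ u : List α, (∀ a, a ∈ u ↔ a ∈ C) ∧ Run D r u r := by
  classical
  have key : ∀ F : Finset α, (↑F ⊆ C) →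
      ∃ u : List α, (∀ a ∈ F, a ∈ u) ∧ (∀ a ∈ u, a ∈ C) ∧ Run D r u r := by
    intro F
    induction F using Finset.induction_on with
    | empty => exact fun _ => ⟨[], by simp, by simp, rfl⟩
    | insert a F _ ih =>
      intro hF
      obtain ⟨u, h₁, h₂, h₃⟩ := ih fun x hx => hF (by simp_all)
      obtain ⟨s, t, hs, hD, ht⟩ := h a (hF (by simp))
      obtain ⟨x, hx, hrx⟩ := within_iff.1 hs
      obtain ⟨y, hy, hry⟩ := within_iff.1 ht
      have ha : a ∈ C := hF (by simp)
      refine ⟨x ++ (a :: y) ++ u, ?_, ?_, ?_⟩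
      · intro b hb
        rcases Finset.mem_insert.1 hb with rfl | hb
        · simp
        · simp [h₁ b hb]
      · intro b hb
        simp only [List.append_assoc, List.cons_append, List.mem_append, List.mem_cons] at hb
        rcases hb with hb | rfl | hb | hb
        exacts [hx b hb, ha, hy b hb, h₂ b hb]
      · exact run_append.2 ⟨r, run_append.2 ⟨s, hrx, t, hD, hry⟩, h₃⟩
  obtain ⟨u, h₁, h₂, h₃⟩ := key hC.toFinset (by simp)
  exact ⟨u, fun a => ⟨h₂ a, fun ha => h₁ a (by simpa using ha)⟩, h₃⟩

end Run

theorem FinNFA.mem_language_iff {k : ℕ} (A : FinNFA k) (w : List (Fin k)) :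
    w ∈ A.language ↔ ∃ q ∈ A.final, Run (fun p a q => q ∈ A.delta p a) A.init w q := by
  have key : ∀ (w : List (Fin k)) (S : Set (Fin A.numStates)) (q : Fin A.numStates),
      q ∈ A.toNFA.evalFrom S w ↔ ∃ p ∈ S, Run (fun p a q => q ∈ A.delta p a) p w q := by
    intro w
    induction w with
    | nil => intro S q; simp [Run]
    | cons a w ih =>
      intro S q
      rw [NFA.evalFrom_cons, ih]
      simp only [NFA.mem_stepSet, Run]
      constructor
      · rintro ⟨r, ⟨p, hp, hr⟩, h⟩
        exact ⟨p, hp, r, hr, h⟩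
      · rintro ⟨p, hp, r, hr, h⟩
        exact ⟨r, ⟨p, hp, hr⟩, h⟩
  show w ∈ A.toNFA.accepts ↔ _
  rw [NFA.mem_accepts]
  simp only [key]
  simp [FinNFA.toNFA]

/-! ### Synchronized patterns of two transition relations -/

/-- One step of a synchronized pattern: both automata read the same letter, or both run through a
closed path with the same set of labels `C`, entered and left by paths with labels in `C`. -/
inductive PatternStep {Q Q' α : Type*} (D : Q → α → Q → Prop) (D' : Q' → α → Q' → Prop) :
    Q × Q' → Q × Q' → Prop
  | letter {p q p' q'} (a : α) : D p a q → D' p' a q' → PatternStep D D' (p, p') (q, q')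
  | block {p q p' q'} (C : Set α) (r : Q) (r' : Q') : Saturated D C r → Saturated D' C r' →
      Within D C p r → Within D C r q → Within D' C p' r' → Within D' C r' q' →
      PatternStep D D' (p, p') (q, q')

section Pattern

variable {Q Q' α : Type*} {D : Q → α → Q → Prop} {D' : Q' → α → Q' → Prop}

theorem sublist_flatten_replicate {u : List α} (m : ℕ) (x : List α) (hx : ∀ a ∈ x, a ∈ u)
    (hm : x.length ≤ m) : x.Sublist (List.replicate m u).flatten := by
  induction m generalizing x with
  | zero => simp_all
  | succ m ih =>
    cases x with
    | nil => simp
    | cons a x =>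
      rw [List.replicate_succ, List.flatten_cons, ← List.singleton_append]
      refine List.Sublist.append ?_ (ih x (fun b hb => hx b (by simp [hb])) (by simpa using hm))
      simpa using hx a (by simp)

/-- The word is `y u^m z` with `u` a closed path using all of `C`. A piece of length at most `m`
takes one letter from each copy of `u`. The short pieces thus depend on `C` alone, which makes words
from two different automata equivalent. -/
theorem Saturated.exists_word {C : Set α} {p q r : Q} (h : Saturated D C r) (hC : C.Finite)
    (hp : Within D C p r) (hq : Within D C r q) (m : ℕ) :
    ∃ w, Run D p w q ∧ ∀ x : List α, x.length ≤ m → (x.Sublist w ↔ ∀ a ∈ x, a ∈ C) := by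
  obtain ⟨u, hu, hr⟩ := h.exists_loop hC
  obtain ⟨y, hy, hry⟩ := within_iff.1 hp
  obtain ⟨z, hz, hrz⟩ := within_iff.1 hq
  have hpow : ∀ m, Run D r (List.replicate m u).flatten r := by
    intro m
    induction m with
    | zero => rfl
    | succ m ih => exact run_append.2 ⟨r, hr, ih⟩
  refine ⟨y ++ (List.replicate m u).flatten ++ z,
    run_append.2 ⟨r, run_append.2 ⟨r, hry, hpow m⟩, hrz⟩, fun x hx =>
      ⟨fun hs a ha => ?_, fun hs => ?_⟩⟩
  · have := hs.subset ha
    simp only [List.mem_append, List.mem_flatten, List.mem_replicate] at this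
    rcases this with (h | ⟨l, ⟨_, rfl⟩, h⟩) | h
    exacts [hy a h, (hu a).1 h, hz a h]
  · refine (sublist_flatten_replicate m x (fun a ha => (hu a).2 (hs a ha)) hx).trans ?_
    exact (List.sublist_append_right _ _).trans (List.sublist_append_left _ _)

theorem exists_simonEquiv_of_pattern [Finite α] {x y : Q × Q'}
    (h : Relation.ReflTransGen (PatternStep D D') x y) (m : ℕ) :
    ∃ u v, SimonEquiv m u v ∧ Run D x.1 u y.1 ∧ Run D' x.2 v y.2 := by
  induction h with
  | refl => exact ⟨[], [], .refl _ _, rfl, rfl⟩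
  | @tail y z _ h ih =>
    obtain ⟨u, v, huv, hu, hv⟩ := ih
    have : ∃ u' v', SimonEquiv m u' v' ∧ Run D y.1 u' z.1 ∧ Run D' y.2 v' z.2 := by
      cases h with
      | letter a h h' => exact ⟨[a], [a], .refl _ _, ⟨_, h, rfl⟩, ⟨_, h', rfl⟩⟩
      | block C r r' hs hs' h₁ h₂ h₁' h₂' =>
        obtain ⟨w, hw, he⟩ := hs.exists_word (Set.toFinite C) h₁ h₂ m
        obtain ⟨w', hw', he'⟩ := hs'.exists_word (Set.toFinite C) h₁' h₂' m
        exact ⟨w, w', fun x hx => (he x hx).trans (he' x hx).symm, hw, hw'⟩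
    obtain ⟨u', v', huv', hu', hv'⟩ := this
    exact ⟨u ++ u', v ++ v', huv.append huv', run_append.2 ⟨_, hu, hu'⟩, run_append.2 ⟨_, hv, hv'⟩⟩

end Pattern

/-! ### Chains of words -/

section Chain

/-- Kőnig's lemma for a relation between finite levels. -/
theorem exists_seq_of_finite_levels {β : Type*} (lvl : ℕ → Set β) (rel : β → β → Prop)
    (hfin : ∀ i, (lvl i).Finite) (hne : ∀ i, (lvl i).Nonempty)
    (hdown : ∀ i, ∀ y ∈ lvl (i + 1), ∃ x ∈ lvl i, rel x y) :
    ∃ f : ℕ → β, ∀ i, f i ∈ lvl i ∧ rel (f i) (f (i + 1)) := by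
  -- `Ext k i c`: some chain starts with `c` at level `i` and continues through `k` further levels.
  let Ext : ℕ → ℕ → β → Prop := fun k => Nat.rec (fun i c => c ∈ lvl i)
    (fun _ E i c => c ∈ lvl i ∧ ∃ d, rel c d ∧ E (i + 1) d) k
  have hmem : ∀ k i c, Ext k i c → c ∈ lvl i := by
    rintro (_ | k) i c h
    exacts [h, h.1]
  have hsucc : ∀ k i c, Ext (k + 1) i c → Ext k i c := by
    intro k
    induction k with
    | zero => exact fun i c h => h.1
    | succ k ih => rintro i c ⟨h₁, d, h₂, h₃⟩; exact ⟨h₁, d, h₂, ih _ _ h₃⟩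
  have hanti : ∀ k k' i c, k ≤ k' → Ext k' i c → Ext k i c := by
    intro k k' i c hk
    induction hk with
    | refl => exact id
    | step _ ih => exact fun h => ih (hsucc _ _ _ h)
  have hex : ∀ k i, ∃ c, Ext k i c := by
    intro k
    induction k with
    | zero => exact fun i => hne i
    | succ k ih =>
      intro i
      obtain ⟨d, hd⟩ := ih (i + 1)
      obtain ⟨c, hc, hr⟩ := hdown i d (hmem _ _ _ hd)
      exact ⟨c, hc, d, hr, hd⟩
  -- Level `i` is finite, so one `c` serves infinitely many `k`, hence all `k` because `Ext` is
  -- antitone in `k`.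
  have hpigeon : ∀ i (P : β → Prop), (∀ k, ∃ c, P c ∧ Ext k i c) → ∃ c, P c ∧ ∀ k, Ext k i c := by
    intro i P h
    have : ∃ᶠ k in Filter.atTop, ∃ c ∈ lvl i, P c ∧ Ext k i c :=
      Filter.Frequently.of_forall fun k => by
        obtain ⟨c, h₁, h₂⟩ := h k
        exact ⟨c, hmem _ _ _ h₂, h₁, h₂⟩
    rw [Filter.frequently_exists_finite (hfin i)] at this
    obtain ⟨c, _, hc⟩ := this
    refine ⟨c, hc.exists.choose_spec.1, fun k => ?_⟩
    obtain ⟨k', hk, hc'⟩ := Filter.frequently_atTop.1 hc k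
    exact hanti _ _ _ _ hk hc'.2
  obtain ⟨c₀, _, h₀⟩ := hpigeon 0 (fun _ => True) fun k => by simpa using hex k 0
  have hstep : ∀ i c, (∀ k, Ext k i c) → ∃ d, rel c d ∧ ∀ k, Ext k (i + 1) d :=
    fun i c h => hpigeon (i + 1) (rel c) fun k => (h (k + 1)).2
  choose! g hg using hstep
  let f : ℕ → β := fun n => Nat.rec c₀ (fun i c => g i c) n
  have hf : ∀ i k, Ext k i (f i) := by
    intro i
    induction i with
    | zero => exact h₀
    | succ i ih => exact (hg i (f i) ih).2
  exact ⟨f, fun i => ⟨hmem 0 _ _ (hf i 0), (hg i (f i) (hf i)).1⟩⟩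

variable {α : Type*}

/-- A word has finitely many factorizations, and a factorization of `x (i + 1)` restricts to one of
its subsequence `x i`. Kőnig's lemma then picks factorizations that are increasing in both factors;
closure of `P₁` and `P₂` under subsequences preserves them under restriction. -/
theorem exists_chain_split (x : ℕ → List α) (hx : ∀ i, (x i).Sublist (x (i + 1)))
    (P₁ P₂ : List α → Prop) (h₁ : ∀ u v, u.Sublist v → P₁ v → P₁ u)
    (h₂ : ∀ u v, u.Sublist v → P₂ v → P₂ u)
    (h : ∀ i, ∃ y z, x i = y ++ z ∧ P₁ y ∧ P₂ z) :
    ∃ y z : ℕ → List α, (∀ i, x i = y i ++ z i) ∧ (∀ i, P₁ (y i)) ∧ (∀ i, P₂ (z i)) ∧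
      (∀ i, (y i).Sublist (y (i + 1))) ∧ (∀ i, (z i).Sublist (z (i + 1))) := by
  have hfin : ∀ i, {c : List α × List α | x i = c.1 ++ c.2 ∧ P₁ c.1 ∧ P₂ c.2}.Finite := fun i => by
    refine ((Set.finite_Iic (x i).length).image fun n => ((x i).take n, (x i).drop n)).subset ?_
    rintro ⟨y, z⟩ ⟨h, -, -⟩
    exact ⟨y.length, by simp_all, by simp_all⟩
  obtain ⟨f, hf⟩ := exists_seq_of_finite_levels _
    (fun c d : List α × List α => c.1.Sublist d.1 ∧ c.2.Sublist d.2) hfin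
    (fun i => by
      obtain ⟨y, z, h, hy, hz⟩ := h i
      exact ⟨(y, z), h, hy, hz⟩)
    (fun i => by
      rintro ⟨y, z⟩ ⟨h, hy, hz⟩
      have hs := hx i
      simp only at h hy hz
      rw [h, List.sublist_append_iff] at hs
      obtain ⟨y', z', he, hy', hz'⟩ := hs
      exact ⟨(y', z'), ⟨he, h₁ _ _ hy' hy, h₂ _ _ hz' hz⟩, hy', hz'⟩)
  exact ⟨fun i => (f i).1, fun i => (f i).2, fun i => (hf i).1.1, fun i => (hf i).1.2.1,
    fun i => (hf i).1.2.2, fun i => (hf i).2.1, fun i => (hf i).2.2⟩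

theorem chain_mono {x : ℕ → List α} (hx : ∀ i, (x i).Sublist (x (i + 1))) {i j : ℕ} (h : i ≤ j) :
    (x i).Sublist (x j) := by
  induction h with
  | refl => exact List.Sublist.refl _
  | step _ ih => exact ih.trans (hx _)

open Filter

variable {Q Q' : Type*} {D : Q → α → Q → Prop} {D' : Q' → α → Q' → Prop}

/-- Some intermediate state occurs infinitely often. Infinitely many indices are kept for each half,
but the two sets of indices need not remain linked: the later arguments use only the chain and
frequency. -/
theorem frequently_run_append [Finite Q] {y z : ℕ → List α} {p q : Q}
    (h : ∃ᶠ i in atTop, Run D p (y i ++ z i) q) :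
    ∃ r, (∃ᶠ i in atTop, Run D p (y i) r) ∧ ∃ᶠ i in atTop, Run D r (z i) q := by
  simp only [run_append, frequently_exists] at h
  obtain ⟨r, h⟩ := h
  exact ⟨r, h.mono fun i h => h.1, h.mono fun i h => h.2⟩

/-- A long power of a full word of `C` in a word over `C` forces a closed path with label set `C`. -/
theorem exists_saturated_of_power [Finite Q] {C : Finset α} {t w : List α} {p q : Q}
    (ht : ∀ a, a ∈ t ↔ a ∈ C) (hw : ∀ a ∈ w, a ∈ C)
    (hs : (List.replicate (Nat.card Q + 1) t).flatten.Sublist w) (hr : Run D p w q) :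
    ∃ r, Saturated D (C : Set α) r ∧ Within D C p r ∧ Within D C r q := by
  have key : ∀ (n : ℕ) (w : List α) (p : Q), (∀ a ∈ w, a ∈ C) →
      (List.replicate n t).flatten.Sublist w → Run D p w q →
      ∃ f : ℕ → Q, Within D C p (f 0) ∧ Within D C (f n) q ∧
        ∀ i < n, ∃ v, (∀ a, a ∈ v ↔ a ∈ C) ∧ Run D (f i) v (f (i + 1)) := by
    intro n
    induction n with
    | zero =>
      intro w p hw _ hr
      exact ⟨fun _ => p, .refl, within_iff.2 ⟨w, hw, hr⟩, by simp⟩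
    | succ n ih =>
      intro w p hw hs hr
      rw [List.replicate_succ, List.flatten_cons, List.append_sublist_iff] at hs
      obtain ⟨v, w', rfl, hv, hw'⟩ := hs
      obtain ⟨r, hr₁, hr₂⟩ := run_append.1 hr
      obtain ⟨f, hf₁, hf₂, hf₃⟩ := ih w' r (fun a ha => hw a (by simp [ha])) hw' hr₂
      obtain ⟨u, hu, hru⟩ := within_iff.1 hf₁
      -- The new sequence starts at `p`. The connecting path `u` to the old start is added to the
      -- first segment, whose label set remains exactly `C`.
      refine ⟨fun i => Nat.casesOn i p f, show Within D C p p from .refl, hf₂, ?_⟩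
      rintro (_ | i) hi
      · refine ⟨v ++ u, fun a => ⟨fun ha => ?_, fun ha => ?_⟩, run_append.2 ⟨r, hr₁, hru⟩⟩
        · rcases List.mem_append.1 ha with ha | ha
          exacts [hw a (by simp [ha]), hu a ha]
        · exact List.mem_append_left _ (hv.subset ((ht a).2 ha))
      · exact hf₃ i (by omega)
  obtain ⟨f, hf₁, hf₂, hf₃⟩ := key _ w p hw hs hr
  have hpath : ∀ i j, i ≤ j → j ≤ Nat.card Q + 1 → Within D C (f i) (f j) := by
    intro i j hij
    induction hij with
    | refl => exact fun _ => .refl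
    | step _ ih =>
      intro hj
      obtain ⟨v, hv, hr⟩ := hf₃ _ hj
      exact (ih (by omega)).trans (within_iff.2 ⟨v, fun a => by simp [hv], hr⟩)
  have := Fintype.ofFinite Q
  -- Among the states `f 0`, …, `f (Nat.card Q)` two coincide. The segment from `f i` to `f (i + 1)`
  -- uses every letter of `C`, and continuing to `f j = f i` closes the path; the extra segment in
  -- `Nat.card Q + 1` keeps all indices in range.
  obtain ⟨i, hi, j, hj, hij, he⟩ := Finset.exists_ne_map_eq_of_card_lt_of_maps_to
    (s := Finset.range (Nat.card Q + 1)) (t := (Finset.univ : Finset Q)) (f := f)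
    (by simp [Nat.card_eq_fintype_card]) (by simp)
  wlog hlt : i < j generalizing i j
  · exact this j hj i hi hij.symm he.symm (by omega)
  simp only [Finset.mem_range] at hi hj
  refine ⟨f i, fun a ha => ?_, (hf₁.trans (hpath 0 i (by omega) (by omega))),
    (hpath i _ (by omega) le_rfl).trans hf₂⟩
  obtain ⟨v, hv, hr⟩ := hf₃ i (by omega)
  obtain ⟨v₁, v₂, rfl⟩ := List.append_of_mem ((hv a).2 ha)
  obtain ⟨s, hs₁, r, hs₂, hs₃⟩ := run_append.1 hr
  refine ⟨s, r, within_iff.2 ⟨v₁, fun b hb => (hv b).1 (by simp [hb]), hs₁⟩, hs₂, ?_⟩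
  have h₁ : Within D C r (f (i + 1)) :=
    within_iff.2 ⟨v₂, fun b hb => (hv b).1 (by simp [hb]), hs₃⟩
  have h₂ := hpath (i + 1) j (by omega) (by omega)
  rw [← he] at h₂
  exact h₁.trans h₂

/-- The cut is at the first `b`. The alternative of being empty is needed because a word without `b`
leaves an empty remainder, while `t` may itself be empty and then embeds everywhere. -/
theorem exists_append_of_not_sublist {b : α} {t w : List α}
    (h : w = [] ∨ ¬ (b :: t).Sublist w) :
    ∃ y z, w = y ++ z ∧ b ∉ y ∧ ∃ z₁ z₂, z = z₁ ++ z₂ ∧ z₁.Sublist [b] ∧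
      (z₂ = [] ∨ ¬ t.Sublist z₂) := by
  by_cases hb : b ∈ w
  · obtain ⟨y, z, rfl, hy⟩ := List.eq_append_cons_of_mem hb
    refine ⟨y, b :: z, rfl, hy, [b], z, rfl, List.Sublist.refl _, Or.inr fun ht => ?_⟩
    refine h.elim (by simp) fun h => h ?_
    exact (List.cons_sublist_cons.2 ht).trans (List.sublist_append_right _ _)
  · exact ⟨w, [], by simp, hb, [], [], rfl, by simp, Or.inl rfl⟩

/-- Such a chain is either constantly empty or eventually `[b]`, so both automata make the same move
at some late index. -/
theorem exists_pattern_of_chain_singleton (b : α) (x : ℕ → List α)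
    (hx : ∀ i, (x i).Sublist (x (i + 1))) (hb : ∀ i, (x i).Sublist [b]) {p q : Q} {p' q' : Q'}
    (h : ∃ᶠ i in atTop, Run D p (x i) q) (h' : ∃ᶠ i in atTop, Run D' p' (x i) q') :
    Relation.ReflTransGen (PatternStep D D') (p, p') (q, q') := by
  have hcases : ∀ i, x i = [] ∨ x i = [b] := fun i => by
    simpa [List.sublist_singleton] using hb i
  by_cases hne : ∃ i, x i = [b]
  · obtain ⟨i, hi⟩ := hne
    have hall : ∀ j, i ≤ j → x j = [b] := fun j hj => by
      have := chain_mono hx hj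
      rw [hi] at this
      exact ((hcases j).resolve_left fun h => by simp [h] at this)
    obtain ⟨j, hj, h⟩ := frequently_atTop.1 h i
    obtain ⟨j', hj', h'⟩ := frequently_atTop.1 h' i
    rw [hall j hj] at h
    rw [hall j' hj'] at h'
    obtain ⟨r, hr, rfl⟩ := h
    obtain ⟨r', hr', rfl⟩ := h'
    exact .single (.letter b hr hr')
  · have hall : ∀ i, x i = [] := fun i => (hcases i).resolve_right fun h => hne ⟨i, h⟩
    simp only [hall] at h h'
    obtain rfl : p = q := h.exists.choose_spec
    obtain rfl : p' = q' := h'.exists.choose_spec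
    exact .refl

/-- Strong induction on the alphabet `B`. If every word over `B` embeds in the chain, high powers of
an enumeration of `B` embed in all late terms and one block with label set `B` suffices. Otherwise a
word `t` over `B` is avoided, and the inner induction `avoid` peels off its first letter `b`: a
chain over `B` without `b`, then at most one `b`, then a chain avoiding the tail of `t`. -/
theorem exists_pattern_of_chain [Finite Q] [Finite Q'] (B : Finset α) :
    ∀ x : ℕ → List α, (∀ i, (x i).Sublist (x (i + 1))) → (∀ i, ∀ a ∈ x i, a ∈ B) →
    ∀ (p q : Q) (p' q' : Q'), (∃ᶠ i in atTop, Run D p (x i) q) →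
      (∃ᶠ i in atTop, Run D' p' (x i) q') →
      Relation.ReflTransGen (PatternStep D D') (p, p') (q, q') := by
  classical
  induction B using Finset.strongInduction with
  | H B ih =>
  have avoid : ∀ (t : List α), (∀ b ∈ t, b ∈ B) →
      ∀ x : ℕ → List α, (∀ i, (x i).Sublist (x (i + 1))) → (∀ i, ∀ a ∈ x i, a ∈ B) →
      (∀ i, x i = [] ∨ ¬ t.Sublist (x i)) →
      ∀ (p q : Q) (p' q' : Q'), (∃ᶠ i in atTop, Run D p (x i) q) →
        (∃ᶠ i in atTop, Run D' p' (x i) q') →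
        Relation.ReflTransGen (PatternStep D D') (p, p') (q, q') := by
    intro t
    induction t with
    | nil =>
      intro _ x hx _ hav p q p' q' h h'
      have hall : ∀ i, x i = [] := fun i => (hav i).resolve_right (by simp)
      simp only [hall] at h h'
      obtain rfl : p = q := h.exists.choose_spec
      obtain rfl : p' = q' := h'.exists.choose_spec
      exact .refl
    | cons b t iht =>
      intro ht x hx hB hav p q p' q' h h'
      obtain ⟨y, z, hyz, hy, hz, hcy, hcz⟩ := exists_chain_split x hx (fun y => b ∉ y)
        (fun z => ∃ z₁ z₂, z = z₁ ++ z₂ ∧ z₁.Sublist [b] ∧ (z₂ = [] ∨ ¬ t.Sublist z₂))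
        (fun u v huv hv hu => hv (huv.subset hu))
        (fun u v huv ⟨z₁, z₂, hv, h₁, h₂⟩ => by
          rw [hv, List.sublist_append_iff] at huv
          obtain ⟨w₁, w₂, rfl, hw₁, hw₂⟩ := huv
          refine ⟨w₁, w₂, rfl, hw₁.trans h₁, h₂.imp (fun h => ?_) fun h h' => h (h'.trans hw₂)⟩
          simpa [h] using hw₂)
        (fun i => exists_append_of_not_sublist (hav i))
      obtain ⟨z₁, z₂, hz₁₂, hz₁, hz₂, hcz₁, hcz₂⟩ := exists_chain_split z hcz
        (fun z => z.Sublist [b]) (fun z => z = [] ∨ ¬ t.Sublist z)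
        (fun u v huv hv => huv.trans hv)
        (fun u v huv hv => hv.imp (fun h => by simpa [h] using huv) fun h h' => h (h'.trans huv))
        hz
      simp only [hyz] at h h'
      obtain ⟨r, h₁, h₂⟩ := frequently_run_append h
      obtain ⟨r', h₁', h₂'⟩ := frequently_run_append h'
      simp only [hz₁₂] at h₂ h₂'
      obtain ⟨s, h₂, h₃⟩ := frequently_run_append h₂
      obtain ⟨s', h₂', h₃'⟩ := frequently_run_append h₂'
      have s₁ := ih (B.erase b) (Finset.erase_ssubset (ht b (by simp))) y hcy
        (fun i a ha => Finset.mem_erase.2 ⟨fun e => hy i (e ▸ ha), hB i a (by simp [hyz, ha])⟩)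
        p r p' r' h₁ h₁'
      have s₂ := exists_pattern_of_chain_singleton b z₁ hcz₁ hz₁ h₂ h₂'
      have s₃ := iht (fun c hc => ht c (by simp [hc])) z₂ hcz₂
        (fun i a ha => hB i a (by simp [hyz, hz₁₂, ha])) hz₂ s q s' q' h₃ h₃'
      exact (s₁.trans s₂).trans s₃
  intro x hx hB p q p' q' h h'
  by_cases hall : ∀ t : List α, (∀ b ∈ t, b ∈ B) → ∃ i, t.Sublist (x i)
  · have hsat : ∀ n, ∃ i, ∀ j, i ≤ j → (List.replicate n B.toList).flatten.Sublist (x j) := by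
      intro n
      obtain ⟨i, hi⟩ := hall (List.replicate n B.toList).flatten (by
        intro b hb
        simp only [List.mem_flatten, List.mem_replicate] at hb
        obtain ⟨l, ⟨_, rfl⟩, hb⟩ := hb
        simpa using hb)
      exact ⟨i, fun j hj => hi.trans (chain_mono hx hj)⟩
    obtain ⟨i, hi⟩ := hsat (Nat.card Q + 1)
    obtain ⟨i', hi'⟩ := hsat (Nat.card Q' + 1)
    obtain ⟨j, hj, h⟩ := frequently_atTop.1 h i
    obtain ⟨j', hj', h'⟩ := frequently_atTop.1 h' i'
    obtain ⟨r, h₁, h₂, h₃⟩ := exists_saturated_of_power (C := B) (by simp) (hB j) (hi j hj) h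
    obtain ⟨r', h₁', h₂', h₃'⟩ :=
      exists_saturated_of_power (C := B) (by simp) (hB j') (hi' j' hj') h'
    exact .single (.block B r r' h₁ h₁' h₂ h₃ h₂' h₃')
  · push Not at hall
    obtain ⟨t, ht, hav⟩ := hall
    exact avoid t ht x hx hB (fun i => Or.inr (hav i)) p q p' q' h h'

theorem sublistForall₂_eq_iff {u v : List α} : List.SublistForall₂ (· = ·) u v ↔ u.Sublist v := by
  rw [List.sublistForall₂_iff]
  simp

/-- Pairs of equivalent words for all `m` contain an increasing chain that alternates infinitely
often between the two languages. -/
theorem exists_chain_of_simonEquiv [Finite α] {K L : Set (List α)}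
    (h : ∀ m, ∃ u ∈ K, ∃ v ∈ L, SimonEquiv m u v) :
    ∃ x : ℕ → List α, (∀ i, (x i).Sublist (x (i + 1))) ∧ (∃ᶠ i in atTop, x i ∈ K) ∧
      ∃ᶠ i in atTop, x i ∈ L := by
  choose u hu v hv huv using h
  have : IsPreorder (List α) (List.SublistForall₂ (· = ·)) :=
    { refl := fun u => sublistForall₂_eq_iff.2 (List.Sublist.refl u)
      trans := fun u v w h h' => sublistForall₂_eq_iff.2
        ((sublistForall₂_eq_iff.1 h).trans (sublistForall₂_eq_iff.1 h')) }
  have hwqo : (Set.univ : Set (List α)).PartiallyWellOrderedOn (List.SublistForall₂ (· = ·)) := by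
    have := Set.PartiallyWellOrderedOn.partiallyWellOrderedOn_sublistForall₂
      (fun a b : α => a = b) (s := Set.univ) (Set.toFinite _).partiallyWellOrderedOn
    simpa using this
  -- Higman's lemma is applied twice, so that along `k` both the words `u` and the words `v`
  -- increase.
  obtain ⟨g, hg⟩ := hwqo.exists_monotone_subseq (f := u) (by simp)
  obtain ⟨g', hg'⟩ := hwqo.exists_monotone_subseq (f := v ∘ g) (by simp)
  simp only [sublistForall₂_eq_iff] at hg hg'
  let k : ℕ → ℕ := fun i => g (g' i)
  have hk : StrictMono k := g.strictMono.comp g'.strictMono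
  have mu : ∀ i j, i ≤ j → (u (k i)).Sublist (u (k j)) := fun i j hij => hg _ _ (g'.monotone hij)
  have mv : ∀ i j, i ≤ j → (v (k i)).Sublist (v (k j)) := fun i j hij => hg' _ _ hij
  have uv : ∀ i, ∃ j, i < j ∧ (u (k i)).Sublist (v (k j)) := fun i => by
    -- With `k j` at least the length of `u (k i)`, this word is among the pieces on which `u (k j)`
    -- and `v (k j)` agree; it embeds in the former by monotonicity, hence in the latter.
    let j := max (i + 1) (u (k i)).length
    exact ⟨j, by omega, (huv (k j) _ ((le_max_right _ _).trans hk.le_apply)).1 (mu _ _ (by omega))⟩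
  have vu : ∀ i, ∃ j, i < j ∧ (v (k i)).Sublist (u (k j)) := fun i => by
    let j := max (i + 1) (v (k i)).length
    exact ⟨j, by omega, (huv (k j) _ ((le_max_right _ _).trans hk.le_apply)).2 (mv _ _ (by omega))⟩
  choose f hf₁ hf₂ using uv
  choose f' hf₁' hf₂' using vu
  -- The state of the zigzag: the current index, and `true` while the current word is taken from
  -- `u`.
  let c : ℕ → ℕ × Bool := fun n => Nat.rec (0, true)
    (fun _ s => if s.2 then (f s.1, false) else (f' s.1, true)) n
  let x : ℕ → List α := fun n => if (c n).2 then u (k (c n).1) else v (k (c n).1)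
  have hc : ∀ n, c (n + 1) = if (c n).2 then (f (c n).1, false) else (f' (c n).1, true) :=
    fun n => rfl
  have hpar : ∀ n, (c (2 * n)).2 = true ∧ (c (2 * n + 1)).2 = false := by
    intro n
    induction n with
    | zero => exact ⟨rfl, rfl⟩
    | succ n ih =>
      have h₁ : (c (2 * (n + 1))).2 = true := by
        have := hc (2 * n + 1)
        rw [ih.2] at this
        exact congrArg Prod.snd this
      exact ⟨h₁, by rw [hc, h₁]; rfl⟩
  refine ⟨x, fun i => ?_, ?_, ?_⟩
  · simp only [x, hc]
    by_cases h : (c i).2 <;> simp [h, hf₂, hf₂']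
  · refine frequently_atTop.2 fun n => ⟨2 * n, by omega, ?_⟩
    simp [x, (hpar n).1, hu]
  · refine frequently_atTop.2 fun n => ⟨2 * n + 1, by omega, ?_⟩
    simp [x, (hpar n).2, hv]

end Chain

/-- Two automata are not separable by a piecewise testable language iff they admit a synchronized
pattern from the initial to accepting states. -/
theorem FinNFA.not_ptSeparable_iff_pattern {k : ℕ} (A B : FinNFA k) :
    ¬ PTSeparable A.language B.language ↔ ∃ q ∈ A.final, ∃ q' ∈ B.final,
      Relation.ReflTransGen (PatternStep (fun p a q => q ∈ A.delta p a)
        (fun p a q => q ∈ B.delta p a)) (A.init, B.init) (q, q') := by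
  rw [not_ptSeparable_iff]
  constructor
  · intro h
    obtain ⟨x, hx, hA, hB⟩ := exists_chain_of_simonEquiv h
    have hA' : ∃ᶠ i in Filter.atTop, ∃ q ∈ A.final,
        Run (fun p a q => q ∈ A.delta p a) A.init (x i) q :=
      hA.mono fun i hi => (A.mem_language_iff _).1 hi
    have hB' : ∃ᶠ i in Filter.atTop, ∃ q ∈ B.final,
        Run (fun p a q => q ∈ B.delta p a) B.init (x i) q :=
      hB.mono fun i hi => (B.mem_language_iff _).1 hi
    rw [Filter.frequently_exists_finset] at hA' hB'
    obtain ⟨q, hq, hA'⟩ := hA'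
    obtain ⟨q', hq', hB'⟩ := hB'
    exact ⟨q, hq, q', hq', exists_pattern_of_chain Finset.univ x hx (by simp) _ _ _ _ hA' hB'⟩
  · rintro ⟨q, hq, q', hq', h⟩ m
    obtain ⟨u, v, huv, hu, hv⟩ := exists_simonEquiv_of_pattern h m
    exact ⟨u, (A.mem_language_iff u).2 ⟨q, hq, hu⟩, v, (B.mem_language_iff v).2 ⟨q', hq', hv⟩, huv⟩

/-! ### A structured language for stack machines -/

/-- Programs that work on stacks of bits, indexed by `K`. -/
inductive Cmd (K : Type)
  | push (k : K) (b : Bool)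
  | pop (k : K)
  /-- move the top of the first stack to the second one; do nothing if the first one is empty -/
  | move (a b : K)
  | seq (c d : Cmd K)
  /-- run `c` if the top of the stack is `true` and `d` otherwise -/
  | ifTop (k : K) (c d : Cmd K)
  | whileNonempty (k : K) (c : Cmd K)

namespace Cmd

open Function Turing

variable {K : Type} [DecidableEq K]

/-- `Runs c s s' t`: started with the stacks `s`, the program `c` ends with the stacks `s'` after
exactly `t` steps. -/
inductive Runs : Cmd K → (K → List Bool) → (K → List Bool) → ℕ → Prop
  | push (k : K) (b : Bool) (s) : Runs (push k b) s (update s k (b :: s k)) 1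
  | pop (k : K) (s) : Runs (pop k) s (update s k (s k).tail) 1
  | moveNil {a b : K} {s} (h : s a = []) : Runs (move a b) s s 1
  | moveCons {a b : K} {s x l} (h : s a = x :: l) (hab : a ≠ b) :
      Runs (move a b) s (update (update s a l) b (x :: s b)) 1
  | seq {c d : Cmd K} {s s' s'' t t'} : Runs c s s' t → Runs d s' s'' t' →
      Runs (seq c d) s s'' (t + t')
  | ifTrue {k : K} {c d : Cmd K} {s s' t} (h : (s k).head? = some true) : Runs c s s' t →
      Runs (ifTop k c d) s s' (1 + t)
  | ifFalse {k : K} {c d : Cmd K} {s s' t} (h : (s k).head? ≠ some true) : Runs d s s' t →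
      Runs (ifTop k c d) s s' (1 + t)
  | whileNil {k : K} {c : Cmd K} {s} (h : s k = []) : Runs (whileNonempty k c) s s 1
  | whileCons {k : K} {c : Cmd K} {s s' s'' t t'} (h : s k ≠ []) : Runs c s s' t →
      Runs (whileNonempty k c) s' s'' t' → Runs (whileNonempty k c) s s'' (1 + t + t')

/-! #### Compilation to Turing machines -/

/-- The labels of the compiled program. -/
def Lab : Cmd K → Type
  | push _ _ => Unit
  | pop _ => Unit
  | move _ _ => Unit
  | seq c d => c.Lab ⊕ d.Lab
  | ifTop _ c d => Option (c.Lab ⊕ d.Lab)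
  | whileNonempty _ c => Option c.Lab

/-- There are finitely many labels. -/
@[reducible]
def labFintype : (c : Cmd K) → Fintype c.Lab
  | push _ _ => inferInstanceAs (Fintype Unit)
  | pop _ => inferInstanceAs (Fintype Unit)
  | move _ _ => inferInstanceAs (Fintype Unit)
  | seq c d =>
    have := c.labFintype
    have := d.labFintype
    inferInstanceAs (Fintype (c.Lab ⊕ d.Lab))
  | ifTop _ c d =>
    have := c.labFintype
    have := d.labFintype
    inferInstanceAs (Fintype (Option (c.Lab ⊕ d.Lab)))
  | whileNonempty _ c =>
    have := c.labFintype
    inferInstanceAs (Fintype (Option c.Lab))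

/-- The label at which the compiled program starts. -/
def entry : (c : Cmd K) → c.Lab
  | push _ _ => ()
  | pop _ => ()
  | move _ _ => ()
  | seq c _ => Sum.inl c.entry
  | ifTop _ _ _ => none
  | whileNonempty _ _ => none

/-- The compiled program, with its labels embedded into `Λ`, that jumps to `exit` at the end. -/
def code {Λ : Type} : (c : Cmd K) → (c.Lab → Λ) → Λ → c.Lab →
    TM2.Stmt (fun _ : K => Bool) Λ (Option Bool)
  | push k b, _, exit, _ => .push k (fun _ => b) (.goto fun _ => exit)
  | pop k, _, exit, _ => .pop k (fun v _ => v) (.goto fun _ => exit)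
  | move a b, _, exit, _ => .pop a (fun _ x => x)
      (.branch Option.isSome (.push b (fun v => v.getD false) (.goto fun _ => exit))
        (.goto fun _ => exit))
  | seq c d, emb, exit, l => Sum.casesOn l
      (fun l => c.code (fun l => emb (Sum.inl l)) (emb (Sum.inr d.entry)) l)
      (fun l => d.code (fun l => emb (Sum.inr l)) exit l)
  | ifTop k c d, emb, exit, l => Option.casesOn l
      (.peek k (fun _ x => x) (.branch (fun v => v == some true)
        (.goto fun _ => emb (some (Sum.inl c.entry)))
        (.goto fun _ => emb (some (Sum.inr d.entry)))))
      (fun l => Sum.casesOn l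
        (fun l => c.code (fun l => emb (some (Sum.inl l))) exit l)
        (fun l => d.code (fun l => emb (some (Sum.inr l))) exit l))
  | whileNonempty k c, emb, exit, l => Option.casesOn l
      (.peek k (fun _ x => x) (.branch Option.isSome
        (.goto fun _ => emb (some c.entry)) (.goto fun _ => exit)))
      (fun l => c.code (fun l => emb (some l)) (emb none) l)

/-- Exactly `n` steps of a machine. -/
def Steps {Λ : Type} (M : Λ → TM2.Stmt (fun _ : K => Bool) Λ (Option Bool)) (n : ℕ)
    (x y : TM2.Cfg (fun _ : K => Bool) Λ (Option Bool)) : Prop :=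
  (flip bind (TM2.step M))^[n] (some x) = some y

theorem Steps.trans {Λ : Type} {M : Λ → TM2.Stmt (fun _ : K => Bool) Λ (Option Bool)} {n n' : ℕ}
    {x y z} (h : Steps M n x y) (h' : Steps M n' y z) : Steps M (n + n') x z := by
  unfold Steps at *
  rw [Nat.add_comm, iterate_add_apply, h, h']

theorem steps_one {Λ : Type} {M : Λ → TM2.Stmt (fun _ : K => Bool) Λ (Option Bool)} {l : Λ}
    {v : Option Bool} {s : K → List Bool} {y} (h : TM2.stepAux (M l) v s = y) :
    Steps M 1 ⟨some l, v, s⟩ y := by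
  simp [Steps, flip, h]

/-- `M` is any machine that contains the code of `c` along `emb`; this generality lets the induction
descend to subprograms. The register may hold anything at the start, because each command that tests
it loads it first. -/
theorem Runs.steps {c : Cmd K} {s s' : K → List Bool} {t : ℕ} (h : Runs c s s' t) {Λ : Type}
    (M : Λ → TM2.Stmt (fun _ : K => Bool) Λ (Option Bool)) (emb : c.Lab → Λ) (exit : Λ)
    (hM : ∀ l, M (emb l) = c.code emb exit l) (v : Option Bool) :
    ∃ v', Steps M t ⟨some (emb c.entry), v, s⟩ ⟨some exit, v', s'⟩ := by
  induction h generalizing v exit with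
  | push k b s => exact ⟨v, steps_one (by rw [hM]; simp [code])⟩
  | pop k s => exact ⟨v, steps_one (by rw [hM]; simp [code])⟩
  | @moveNil a b s h =>
    have hs : update s a [] = s := by rw [← h, update_eq_self]
    exact ⟨none, steps_one (by rw [hM]; simp [code, h, hs])⟩
  | @moveCons a b s x l h hab =>
    exact ⟨some x, steps_one (by rw [hM]; simp [code, h, update_of_ne hab.symm])⟩
  | @seq c d s s' s'' t t' _ _ ih₁ ih₂ =>
    obtain ⟨v₁, h₁⟩ := ih₁ (fun l => emb (Sum.inl l)) (emb (Sum.inr d.entry))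
      (fun l => hM (Sum.inl l)) v
    obtain ⟨v₂, h₂⟩ := ih₂ (fun l => emb (Sum.inr l)) exit (fun l => hM (Sum.inr l)) v₁
    exact ⟨v₂, h₁.trans h₂⟩
  | @ifTrue k c d s s' t h _ ih =>
    obtain ⟨v₁, h₁⟩ := ih (fun l => emb (some (Sum.inl l))) exit
      (fun l => hM (some (Sum.inl l))) (some true)
    exact ⟨v₁, (steps_one (by rw [hM]; simp [code, entry, h])).trans h₁⟩
  | @ifFalse k c d s s' t h _ ih =>
    obtain ⟨v₁, h₁⟩ := ih (fun l => emb (some (Sum.inr l))) exit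
      (fun l => hM (some (Sum.inr l))) (s k).head?
    have h' : ((s k).head? == some true) = false := by simpa using h
    exact ⟨v₁, (steps_one (by rw [hM]; simp [code, entry, h'])).trans h₁⟩
  | @whileNil k c s h =>
    exact ⟨none, steps_one (by rw [hM]; simp [code, entry, h])⟩
  | @whileCons k c s s' s'' t t' h _ _ ih₁ ih₂ =>
    obtain ⟨v₁, h₁⟩ := ih₁ (fun l => emb (some l)) (emb none) (fun l => hM (some l)) (s k).head?
    obtain ⟨v₂, h₂⟩ := ih₂ emb exit hM v₁
    have h' : (s k).head?.isSome = true := by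
      cases hk : s k with
      | nil => exact absurd hk h
      | cons => rfl
    exact ⟨v₂, ((steps_one
      (by rw [hM]; simp [code, entry, h'])).trans h₁).trans h₂⟩

/-- The Turing machine that runs the program `c`. -/
def toTM [Fintype K] (c : Cmd K) (k₀ k₁ : K) : FinTM2 where
  K := K
  k₀ := k₀
  k₁ := k₁
  Γ := fun _ => Bool
  Λ := Option c.Lab
  main := some c.entry
  ΛFin := have := c.labFintype; inferInstance
  σ := Option Bool
  initialState := none
  Γk₀Fin := inferInstanceAs (Fintype Bool)
  -- The additional label `none` restores the register to its initial value before halting, as the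
  -- prescribed final configuration requires.
  m := fun l => Option.casesOn l (.load (fun _ => none) .halt) (fun l => c.code some none l)

/-- `RunsIn c s s' T`: started with the stacks `s`, the program `c` ends with the stacks `s'` after
at most `T` steps. -/
def RunsIn (c : Cmd K) (s s' : K → List Bool) (T : ℕ) : Prop := ∃ t ≤ T, Runs c s s' t

/-- The stores with a single possibly nonempty stack are exactly those of `initList` and `haltList`;
the extra step is the one that resets the register and halts. -/
theorem RunsIn.outputsInTime [Fintype K] {c : Cmd K} {k₀ k₁ : K} {w w' : List Bool} {T : ℕ}
    (h : RunsIn c (update (fun _ => []) k₀ w) (update (fun _ => []) k₁ w') T) :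
    Nonempty (TM2OutputsInTime (c.toTM k₀ k₁) w (some w') (T + 1)) := by
  obtain ⟨t, ht, h⟩ := h
  obtain ⟨v, hv⟩ := h.steps (c.toTM k₀ k₁).m some none (fun _ => rfl) none
  have hlast : Steps (c.toTM k₀ k₁).m 1 ⟨some none, v, update (fun _ => []) k₁ w'⟩
      ⟨none, none, update (fun _ => []) k₁ w'⟩ := steps_one rfl
  have hinit : initList (c.toTM k₀ k₁) w =
      ⟨some (some c.entry), none, update (fun _ => []) k₀ w⟩ := by
    unfold initList
    congr 1
    funext (k : K)
    by_cases hk : k = k₀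
    · subst hk
      exact (dif_pos rfl).trans (update_self k w fun _ => []).symm
    · exact (dif_neg hk).trans (update_of_ne hk w fun _ => []).symm
  have hhalt : haltList (c.toTM k₀ k₁) w' = ⟨none, none, update (fun _ => []) k₁ w'⟩ := by
    unfold haltList
    congr 1
    funext (k : K)
    by_cases hk : k = k₁
    · subst hk
      exact (dif_pos rfl).trans (update_self k w' fun _ => []).symm
    · exact (dif_neg hk).trans (update_of_ne hk w' fun _ => []).symm
  refine ⟨⟨⟨t + 1, ?_⟩, Nat.add_le_add_right ht 1⟩⟩
  have hrun := hv.trans hlast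
  unfold Steps at hrun
  exact (congrArg _ (congrArg some hinit)).trans (hrun.trans (congrArg some hhalt.symm))

/-! #### Derived rules -/

namespace RunsIn

variable {c d : Cmd K} {s s' s'' : K → List Bool} {t t' T : ℕ} {a b k : K}

theorem congr (h : RunsIn c s s' t) (e : s' = s'') : RunsIn c s s'' t := e ▸ h

theorem mono (h : RunsIn c s s' t) (hT : t ≤ T) : RunsIn c s s' T :=
  let ⟨n, hn, h⟩ := h
  ⟨n, hn.trans hT, h⟩

theorem push (k : K) (b : Bool) (s) : RunsIn (push k b) s (update s k (b :: s k)) 1 :=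
  ⟨1, le_rfl, .push k b s⟩

theorem pop (k : K) (s) : RunsIn (pop k) s (update s k (s k).tail) 1 := ⟨1, le_rfl, .pop k s⟩

theorem moveNil (h : s a = []) : RunsIn (move a b) s s 1 := ⟨1, le_rfl, .moveNil h⟩

theorem moveCons {x l} (h : s a = x :: l) (hab : a ≠ b) :
    RunsIn (move a b) s (update (update s a l) b (x :: s b)) 1 := ⟨1, le_rfl, .moveCons h hab⟩

theorem seq (h : RunsIn c s s' t) (h' : RunsIn d s' s'' t') : RunsIn (seq c d) s s'' (t + t') :=
  let ⟨n, hn, h⟩ := h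
  let ⟨n', hn', h'⟩ := h'
  ⟨n + n', by omega, h.seq h'⟩

theorem ifTrue (hk : (s k).head? = some true) (h : RunsIn c s s' t) :
    RunsIn (ifTop k c d) s s' (1 + t) :=
  let ⟨n, hn, h⟩ := h
  ⟨1 + n, by omega, h.ifTrue hk⟩

theorem ifFalse (hk : (s k).head? ≠ some true) (h : RunsIn d s s' t) :
    RunsIn (ifTop k c d) s s' (1 + t) :=
  let ⟨n, hn, h⟩ := h
  ⟨1 + n, by omega, h.ifFalse hk⟩

theorem whileNil (h : s k = []) : RunsIn (whileNonempty k c) s s 1 := ⟨1, le_rfl, .whileNil h⟩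

theorem whileCons (hk : s k ≠ []) (h : RunsIn c s s' t)
    (h' : RunsIn (whileNonempty k c) s' s'' t') :
    RunsIn (whileNonempty k c) s s'' (1 + t + t') :=
  let ⟨n, hn, h⟩ := h
  let ⟨n', hn', h'⟩ := h'
  ⟨1 + n + n', by omega, h.whileCons hk h'⟩

/-- Moving a whole stack reverses it onto the other one. -/
theorem moveAll (hab : a ≠ b) :
    RunsIn (whileNonempty a (move a b)) s (update (update s a []) b ((s a).reverse ++ s b))
      (2 * (s a).length + 1) := by
  generalize hl : s a = l
  induction l generalizing s with
  | nil =>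
    have : update (update s a []) b ([].reverse ++ s b) = s := by
      funext k; grind [update_apply]
    rw [this]
    exact whileNil hl
  | cons x l ih =>
    have h := ih (s := update (update s a l) b (x :: s b)) (by simp [update_of_ne hab])
    refine ((whileCons (by simp [hl]) (moveCons hl hab) h).mono (by simp; omega)).congr ?_
    funext k; grind [update_apply]

end RunsIn

theorem update_pair_idem (s : K → List Bool) (a b : K) (x y x' y' : List Bool) :
    update (update (update (update s a x') b y') a x) b y = update (update s a x) b y := by
  funext k
  simp only [update_apply]
  split_ifs <;> rfl

/-- Run `c` once for each element of the stack `a`, using `b` as a scratch stack. -/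
def iter (a b : K) (c : Cmd K) : Cmd K :=
  seq (whileNonempty a (seq c (move a b))) (whileNonempty b (move b a))

namespace RunsIn

variable {c : Cmd K} {a b : K} {t m : ℕ}

/-- The rule for bounded iteration with an invariant that does not mention the counter stacks. -/
theorem iter (hab : a ≠ b) (Inv : ℕ → (K → List Bool) → Prop)
    (hI : ∀ i s x y, Inv i s → Inv i (update (update s a x) b y))
    (hc : ∀ i < m, ∀ s, Inv i s → s a = List.replicate (m - i) true →
      s b = List.replicate i true →
      ∃ s', RunsIn c s s' t ∧ Inv (i + 1) s' ∧ s' a = s a ∧ s' b = s b)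
    {s : K → List Bool} (h₀ : Inv 0 s) (ha : s a = List.replicate m true) (hb : s b = []) :
    ∃ s', RunsIn (iter a b c) s s' (m * (t + 4) + 2) ∧ Inv m s' ∧
      s' a = List.replicate m true ∧ s' b = [] := by
  have main : ∀ j ≤ m, ∀ s, Inv (m - j) s → s a = List.replicate j true →
      s b = List.replicate (m - j) true →
      ∃ s', RunsIn (whileNonempty a (Cmd.seq c (move a b))) s s' (j * (t + 2) + 1) ∧ Inv m s' ∧
        s' a = [] ∧ s' b = List.replicate m true := by
    intro j
    induction j with
    | zero => exact fun _ s hs ha hb => ⟨s, (whileNil ha).mono (by omega), hs, ha, hb⟩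
    | succ j ih =>
      intro hj s hs ha hb
      obtain ⟨s', hr, hs', ha', hb'⟩ := hc (m - (j + 1)) (by omega) s hs
        (by rw [ha]; congr 1; omega) hb
      rw [ha, List.replicate_succ] at ha'
      have hm := moveCons (s := s') ha' hab
      obtain ⟨s'', hr'', hs'', ha'', hb''⟩ := ih (by omega)
        (update (update s' a (List.replicate j true)) b (true :: s' b))
        (hI _ _ _ _ (by rwa [show m - (j + 1) + 1 = m - j by omega] at hs'))
        (by simp [update_of_ne hab])
        (by rw [update_self, hb', hb, ← List.replicate_succ]; congr 1; omega)
      refine ⟨s'', (whileCons (by simp [ha, List.replicate_succ]) (hr.seq hm) hr'').mono ?_,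
        hs'', ha'', hb''⟩
      ring_nf; omega
  obtain ⟨s', hr, hs', ha', hb'⟩ := main m le_rfl s (by simpa using h₀) ha (by simpa using hb)
  -- The main loop costs `m * (t + 2) + 1`, and restoring the counter from the scratch stack costs
  -- `2 * m + 1`.
  refine ⟨_, (hr.seq (moveAll hab.symm)).mono ?_, ?_, ?_, ?_⟩
  · rw [hb', List.length_replicate]; ring_nf; omega
  · have := hI m s' (List.replicate m true) [] hs'
    convert this using 1
    rw [update_comm hab, hb', ha']
    simp
  · simp [hb', ha']
  · simp [update_of_ne hab.symm]

/-- Bounded iteration along an explicit sequence of stores. -/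
theorem iter_exact (hab : a ≠ b) (st : ℕ → K → List Bool)
    (hc : ∀ i < m, ∀ x y, x = List.replicate (m - i) true → y = List.replicate i true →
      RunsIn c (update (update (st i) a x) b y) (update (update (st (i + 1)) a x) b y) t)
    (ha : ∀ i ≤ m, st i a = List.replicate m true) (hb : ∀ i ≤ m, st i b = []) :
    RunsIn (Cmd.iter a b c) (st 0) (st m) (m * (t + 4) + 2) := by
  obtain ⟨s', hr, ⟨x, y, hs'⟩, ha', hb'⟩ := iter (m := m) (t := t) (c := c) hab
    (fun i s => ∃ x y, s = update (update (st i) a x) b y)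
    (fun i s x y ⟨x', y', h⟩ => ⟨x, y, h ▸ update_pair_idem _ _ _ _ _ _ _⟩)
    (fun i hi s ⟨x, y, h⟩ hsa hsb => by
      have hx : s a = x := by subst h; simp [update_of_ne hab]
      have hy : s b = y := by subst h; simp
      refine ⟨_, h ▸ hc i hi x y (hx ▸ hsa) (hy ▸ hsb), ⟨x, y, rfl⟩, ?_, ?_⟩
      · rw [hx]; simp [update_of_ne hab]
      · rw [hy]; simp)
    (s := st 0) ⟨st 0 a, st 0 b, by simp⟩ (ha 0 (by omega)) (hb 0 (by omega))
  refine hr.congr ?_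
  have hx : s' a = x := by subst hs'; simp [update_of_ne hab]
  have hy : s' b = y := by subst hs'; simp
  rw [hs', ← hx, ← hy, ha', hb', ← ha m le_rfl, ← hb m le_rfl]
  simp

end RunsIn
end Cmd

/-! ### First-order programs on words -/

open Function Cmd

/-- The variables of first-order programs. -/
abbrev Var : Type := Fin 16

/-- First-order formulas over the positions of a bit string, with ternary relation symbols `R`. -/
inductive Fm (R : Type)
  | bit (v : Var)
  | lt (v w : Var)
  | rel (r : R) (u v w : Var)
  | neg (φ : Fm R)
  | and (φ ψ : Fm R)
  | or (φ ψ : Fm R)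
  | ex (v : Var) (φ : Fm R)

/-- First-order programs: simultaneous redefinition of a relation (the tuple is formed by the
variables `0, 1, 2`), sequential composition, and iteration over all positions. -/
inductive Prog (R : Type)
  | assign (r : R) (φ : Fm R)
  | seq (P Q : Prog R)
  | loop (v : Var) (P : Prog R)

/-- The values of the relation symbols. -/
abbrev RelStore (R : Type) : Type := R → ℕ → ℕ → ℕ → Prop

namespace Fm

variable {R : Type}

/-- Truth of a formula for the word `w`, the relations `S` and the values `e` of the variables. -/
def Holds (w : List Bool) (S : RelStore R) : Fm R → (Var → ℕ) → Prop
  | bit v, e => w[e v]? = some true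
  | lt v v', e => e v < e v'
  | rel r u v v', e => S r (e u) (e v) (e v')
  | neg φ, e => ¬ φ.Holds w S e
  | and φ ψ, e => φ.Holds w S e ∧ ψ.Holds w S e
  | or φ ψ, e => φ.Holds w S e ∨ ψ.Holds w S e
  | ex v φ, e => ∃ i < w.length, φ.Holds w S (update e v i)

/-- The bound variables. -/
def bound : Fm R → List Var
  | bit _ => []
  | lt _ _ => []
  | rel _ _ _ _ => []
  | neg φ => φ.bound
  | and φ ψ => φ.bound ++ ψ.bound
  | or φ ψ => φ.bound ++ ψ.bound
  | ex v φ => v :: φ.bound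

/-- No variable is bound again in the scope of a quantifier over it, and no variable is compared
with itself. -/
def WF : Fm R → Bool
  | bit _ => true
  | lt v w => v != w
  | rel _ _ _ _ => true
  | neg φ => φ.WF
  | and φ ψ => φ.WF && ψ.WF
  | or φ ψ => φ.WF && ψ.WF
  | ex v φ => !φ.bound.contains v && φ.WF

end Fm

namespace Prog

variable {R : Type} [DecidableEq R]

/-- The effect of a program on the relations. -/
def eval (w : List Bool) : Prog R → (Var → ℕ) → RelStore R → RelStore R
  | assign r φ, e, S =>
    update S r fun i j k => φ.Holds w S (update (update (update e 0 i) 1 j) 2 k)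
  | seq P Q, e, S => Q.eval w e (P.eval w e S)
  | loop v P, e, S => Nat.rec S (fun i S' => P.eval w (update e v i) S') w.length

omit [DecidableEq R] in
/-- The bound variables. -/
def bound : Prog R → List Var
  | assign _ φ => 0 :: 1 :: 2 :: φ.bound
  | seq P Q => P.bound ++ Q.bound
  | loop v P => v :: P.bound

/-- No variable is bound again in the scope of a binder of it. -/
def WF : Prog R → Bool
  | assign _ φ => !φ.bound.contains 0 && !φ.bound.contains 1 && !φ.bound.contains 2 && φ.WF
  | seq P Q => P.WF && Q.WF
  | loop v P => !P.bound.contains v && P.WF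

end Prog

/-! #### Compilation to stack programs -/

/-- The stacks of a compiled first-order program: the input, the stack of truth values, scratch
stacks, unary counters for the values of the variables and for the length of the input, and the
tables of the relations. -/
inductive Stack (R : Type)
  | inp | res | buf | aux | acc
  | lo (v : Var) | hi (v : Var)
  | cnt (b : Bool) | cnt' (b : Bool)
  | arr (r : R)
  deriving DecidableEq, Fintype

namespace Stack

variable {R : Type}

/-- Pushes onto `res` whether the bit below the elements that `skip` moves from `a` to `buf` is
`true`. -/
def readCmd (a : Stack R) (skip : Cmd (Stack R)) : Cmd (Stack R) :=
  seq skip (seq (ifTop a (push res true) (push res false)) (whileNonempty buf (move buf a)))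

/-- Replaces the two topmost truth values by their image under `f`. -/
def binCmd (f : Bool → Bool → Bool) : Cmd (Stack R) :=
  ifTop res
    (seq (pop res) (ifTop res (seq (pop res) (push res (f true true)))
      (seq (pop res) (push res (f false true)))))
    (seq (pop res) (ifTop res (seq (pop res) (push res (f true false)))
      (seq (pop res) (push res (f false false)))))

/-- Replaces the topmost truth value by its negation. -/
def negCmd : Cmd (Stack R) :=
  ifTop res (seq (pop res) (push res false)) (seq (pop res) (push res true))

/-- Moves as many elements from `a` to `buf` as the position of a triple in a table. -/
def skipCmd (a : Stack R) (u v v' : Var) : Cmd (Stack R) :=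
  seq (iter (lo u) aux (iter (cnt false) (cnt' false) (iter (cnt true) (cnt' true) (move a buf))))
    (seq (iter (lo v) aux (iter (cnt false) (cnt' false) (move a buf)))
      (iter (lo v') aux (move a buf)))

end Stack

open Stack

/-- The stack program that pushes the truth value of a formula onto `res`. -/
def Fm.compile {R : Type} : Fm R → Cmd (Stack R)
  | .bit v => readCmd inp (iter (lo v) aux (move inp buf))
  | .lt v w => readCmd (lo w) (iter (lo v) aux (move (lo w) buf))
  | .rel r u v w => readCmd (arr r) (skipCmd (arr r) u v w)
  | .neg φ => .seq φ.compile negCmd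
  | .and φ ψ => .seq φ.compile (.seq ψ.compile (binCmd Bool.and))
  | .or φ ψ => .seq φ.compile (.seq ψ.compile (binCmd Bool.or))
  | .ex v φ => .seq (push res false) (iter (hi v) (lo v) (.seq φ.compile (binCmd Bool.or)))

/-- The stack program that executes a first-order program. -/
def Prog.compile {R : Type} : Prog R → Cmd (Stack R)
  | .assign r φ => .seq
      (iter (hi 0) (lo 0) (iter (hi 1) (lo 1) (iter (hi 2) (lo 2) (.seq φ.compile (move res acc)))))
      -- The new table is replaced only now, since the formula may refer to the old one. It lies
      -- reversed on `acc`, and moving it reverses it again.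
      (.seq (whileNonempty (arr r) (pop (arr r))) (whileNonempty acc (move acc (arr r))))
  | .seq P Q => .seq P.compile Q.compile
  | .loop v P => iter (hi v) (lo v) P.compile

/-- The stacks `s` hold the input `w`, the values `e` of the variables and the relations `S`. -/
structure Represents {R : Type} (w : List Bool) (e : Var → ℕ) (S : RelStore R)
    (s : Stack R → List Bool) : Prop where
  inp : s inp = w
  buf : s buf = []
  aux : s aux = []
  lo : ∀ v, s (lo v) = List.replicate (e v) true
  hi : ∀ v, s (hi v) = List.replicate (w.length - e v) true
  cnt : ∀ b, s (cnt b) = List.replicate w.length true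
  cnt' : ∀ b, s (cnt' b) = []
  -- Only an upper bound: tables are empty at the start, and a missing entry reads as false.
  length_le : ∀ r, (s (arr r)).length ≤ w.length ^ 3
  arr : ∀ r i j k, i < w.length → j < w.length → k < w.length →
    ((s (arr r))[(i * w.length + j) * w.length + k]? = some true ↔ S r i j k)

/-! ### Correctness and running time of the compiled formulas and programs. -/

section Spec

variable {R : Type} [DecidableEq R] {w : List Bool} {e : Var → ℕ} {S : RelStore R}
  {s : Stack R → List Bool}

theorem Represents.update_res (h : Represents w e S s) (l : List Bool) :
    Represents w e S (update s res l) := by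
  constructor <;> intros <;> simp [h.inp, h.buf, h.aux, h.lo, h.hi, h.cnt, h.cnt', h.length_le]
  exact h.arr _ _ _ _ ‹_› ‹_› ‹_›

theorem Represents.update_acc (h : Represents w e S s) (l : List Bool) :
    Represents w e S (update s acc l) := by
  constructor <;> intros <;> simp [h.inp, h.buf, h.aux, h.lo, h.hi, h.cnt, h.cnt', h.length_le]
  exact h.arr _ _ _ _ ‹_› ‹_› ‹_›

/-- Giving the value `i` to the variable `v`. -/
theorem Represents.update_var (h : Represents w e S s) (v : Var) (i : ℕ) :
    Represents w (update e v i) S (update (update s (Stack.hi v)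
      (List.replicate (w.length - i) true)) (Stack.lo v) (List.replicate i true)) := by
  constructor
  case lo =>
    intro v'
    by_cases hv : v' = v
    · subst hv; simp
    · simp [hv, h.lo]
  case hi =>
    intro v'
    by_cases hv : v' = v
    · subst hv; simp
    · simp [hv, h.hi]
  all_goals intros; simp [h.inp, h.buf, h.aux, h.cnt, h.cnt', h.length_le]
  exact h.arr _ _ _ _ ‹_› ‹_› ‹_›

/-- Truth values are combined on top of the stack `res`. -/
theorem runsIn_binCmd (f : Bool → Bool → Bool) (b b' : Bool) (l : List Bool)
    (hs : s res = b' :: b :: l) : RunsIn (binCmd f) s (update s res (f b b' :: l)) 5 := by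
  have key : ∀ c : Bool, RunsIn (seq (pop res) (push res c)) (update s res (b :: l))
      (update s res (c :: l)) 2 := fun c =>
    ((RunsIn.pop _ _).seq (RunsIn.push _ _ _)).congr (by simp)
  have hpop : RunsIn (pop res) s (update s res (b :: l)) 1 :=
    (RunsIn.pop _ _).congr (by simp [hs])
  unfold binCmd
  cases b' <;> cases b
  · exact (RunsIn.ifFalse (by simp [hs]) (hpop.seq (RunsIn.ifFalse (by simp) (key _)))).mono
      (by omega)
  · exact (RunsIn.ifFalse (by simp [hs]) (hpop.seq (RunsIn.ifTrue (by simp) (key _)))).mono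
      (by omega)
  · exact (RunsIn.ifTrue (by simp [hs]) (hpop.seq (RunsIn.ifFalse (by simp) (key _)))).mono
      (by omega)
  · exact (RunsIn.ifTrue (by simp [hs]) (hpop.seq (RunsIn.ifTrue (by simp) (key _)))).mono
      (by omega)

theorem runsIn_negCmd (b : Bool) (l : List Bool)
    (hs : s res = b :: l) : RunsIn negCmd s (update s res ((!b) :: l)) 3 := by
  have key : ∀ c : Bool, RunsIn (seq (pop res) (push res c)) s (update s res (c :: l)) 2 :=
    fun c => ((RunsIn.pop _ _).seq (RunsIn.push _ _ _)).congr (by simp [hs])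
  unfold negCmd
  cases b
  · exact (RunsIn.ifFalse (by simp [hs]) (key _)).mono (by omega)
  · exact (RunsIn.ifTrue (by simp [hs]) (key _)).mono (by omega)

/-- The stacks after moving `n` elements from `a` to `buf`. -/
def moved (a : Stack R) (n : ℕ) (s : Stack R → List Bool) : Stack R → List Bool :=
  update (update s a ((s a).drop n)) buf (((s a).take n).reverse ++ s buf)

theorem moved_zero (a : Stack R) (s : Stack R → List Bool) : moved a 0 s = s := by
  simp [moved]

theorem moved_add {a : Stack R} (ha : a ≠ buf) (m n : ℕ) (s : Stack R → List Bool) :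
    moved a m (moved a n s) = moved a (n + m) s := by
  funext k
  simp only [moved]
  by_cases hk : k = buf
  · subst hk
    simp [update_of_ne ha, List.take_add]
  · by_cases hk' : k = a
    · subst hk'
      simp [ha, Nat.add_comm]
    · simp [hk, hk']

theorem moved_update {a k : Stack R} (hk : k ≠ a) (hk' : k ≠ buf) (n : ℕ)
    (s : Stack R → List Bool) (l : List Bool) :
    moved a n (update s k l) = update (moved a n s) k l := by
  simp only [moved, update_of_ne hk.symm, update_of_ne hk'.symm]
  rw [update_comm hk, update_comm hk']

theorem moved_apply {a k : Stack R} (hk : k ≠ a) (hk' : k ≠ buf) (n : ℕ)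
    (s : Stack R → List Bool) : moved a n s k = s k := by
  simp [moved, hk, hk']

theorem runsIn_move {a : Stack R} (ha : a ≠ buf) (s : Stack R → List Bool) :
    RunsIn (move a buf) s (moved a 1 s) 1 := by
  cases hs : s a with
  | nil =>
    have h : update s a [] = s := by rw [← hs, update_eq_self]
    exact (RunsIn.moveNil hs).congr (by simp [moved, hs, h])
  | cons x l => exact (RunsIn.moveCons hs ha).congr (by simp [moved, hs])

/-- `P` records what the body needs from the store, such as its own counters being full; it has to
survive changes of the counters `x`, `y` and the moves from `a`. Nesting this rule multiplies the
numbers of moved elements. -/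
theorem runsIn_iter_moved {a x y : Stack R} {c : Cmd (Stack R)} {m k t : ℕ} (hxy : x ≠ y)
    (hxa : x ≠ a) (hxb : x ≠ buf) (hya : y ≠ a) (hyb : y ≠ buf) (ha : a ≠ buf)
    (P : (Stack R → List Bool) → Prop) (hP : ∀ s l l', P s → P (update (update s x l) y l'))
    (hP' : ∀ s n, P s → P (moved a n s)) (hc : ∀ s, P s → RunsIn c s (moved a k s) t)
    (hs : P s) (hx : s x = List.replicate m true) (hy : s y = []) :
    RunsIn (iter x y c) s (moved a (m * k) s) (m * (t + 4) + 2) := by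
  have h := RunsIn.iter_exact (m := m) (t := t) (c := c) hxy (fun i => moved a (i * k) s)
    (fun i _ l l' _ _ => (hc _ (hP _ l l' (hP' _ _ hs))).congr (by
      rw [moved_update hya hyb, moved_update hxa hxb, moved_add ha, Nat.succ_mul]))
    (fun i _ => by rw [moved_apply hxa hxb, hx]) (fun i _ => by rw [moved_apply hya hyb, hy])
  simpa only [Nat.zero_mul, moved_zero] using h

/-- After skipping `n` elements the top of `a` is its entry number `n`. If the stack is too short
the top is missing and `false` is pushed, in accordance with `getElem?`. Moving `buf` back restores
`a`. -/
theorem runsIn_readCmd {a : Stack R} (ha : a ≠ buf) (ha' : a ≠ res) {skip : Cmd (Stack R)}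
    {n t m : ℕ} (h : RunsIn skip s (moved a n s) t) (hb : s buf = []) (hm : n ≤ m) :
    RunsIn (readCmd a skip) s (update s res (((s a)[n]? == some true) :: s res))
      (t + 2 * m + 3) := by
  have h₁ : RunsIn (ifTop a (push res true) (push res false)) (moved a n s)
      (update (moved a n s) res (((s a)[n]? == some true) :: s res)) 2 := by
    have hh : (moved a n s a).head? = (s a)[n]? := by
      simp [moved, update_of_ne ha]
    by_cases hx : (s a)[n]? = some true
    · refine ((RunsIn.ifTrue (hh.trans hx) (RunsIn.push _ _ _)).congr ?_).mono le_rfl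
      rw [moved_apply ha'.symm (by simp)]; simp [hx]
    · refine ((RunsIn.ifFalse (by rwa [hh]) (RunsIn.push _ _ _)).congr ?_).mono le_rfl
      rw [moved_apply ha'.symm (by simp), beq_eq_false_iff_ne.2 hx]
  have h₂ := RunsIn.moveAll (s := update (moved a n s) res (((s a)[n]? == some true) :: s res))
    ha.symm
  have hbuf : moved a n s buf = ((s a).take n).reverse := by simp [moved, hb]
  have haa : moved a n s a = (s a).drop n := by simp [moved, ha]
  refine ((h.seq (h₁.seq h₂)).congr ?_).mono ?_
  · funext k
    by_cases hk : k = a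
    · subst hk; simp [hbuf, haa, ha']
    · by_cases hk' : k = buf
      · subst hk'; simp [hk, hb]
      · by_cases hk'' : k = res
        · subst hk''; simp [hk]
        · simp [hk, hk', hk'', moved_apply hk hk']
  · rw [update_of_ne (by simp), hbuf]
    simp only [List.length_reverse, List.length_take]
    have := min_le_left n (s a).length
    omega

/-- The three loops move the digits of the position in base `w.length`: a digit is the unary value
of a variable, and each inner counter contributes one factor `w.length`. -/
theorem Represents.runsIn_skipCmd (h : Represents w e S s) (he : ∀ v, e v < w.length) (r : R)
    (u v v' : Var) :
    RunsIn (skipCmd (Stack.arr r) u v v') s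
      (moved (Stack.arr r) ((e u * w.length + e v) * w.length + e v') s)
      (w.length * (w.length * (w.length * 5 + 6) + 6) + 2 +
        (w.length * (w.length * 5 + 6) + 2 + (w.length * 5 + 2))) := by
  have hmv := fun s : Stack R → List Bool => runsIn_move (a := Stack.arr r) (by simp) s
  have hin : ∀ b, ∀ s : Stack R → List Bool,
      s (Stack.cnt b) = List.replicate w.length true ∧ s (Stack.cnt' b) = [] →
      RunsIn (iter (Stack.cnt b) (Stack.cnt' b) (move (Stack.arr r) Stack.buf)) s
        (moved (Stack.arr r) (w.length * 1) s) (w.length * (1 + 4) + 2) := fun b s hs =>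
    runsIn_iter_moved (by simp) (by simp) (by simp) (by simp) (by simp) (by simp)
      (fun _ => True) (by simp) (by simp) (fun s _ => hmv s) trivial hs.1 hs.2
  have hin2 : ∀ s : Stack R → List Bool,
      (∀ b, s (Stack.cnt b) = List.replicate w.length true ∧ s (Stack.cnt' b) = []) →
      RunsIn (iter (Stack.cnt false) (Stack.cnt' false) (iter (Stack.cnt true) (Stack.cnt' true)
        (move (Stack.arr r) Stack.buf))) s
        (moved (Stack.arr r) (w.length * (w.length * 1)) s)
        (w.length * (w.length * (1 + 4) + 2 + 4) + 2) := fun s hs =>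
    runsIn_iter_moved (by simp) (by simp) (by simp) (by simp) (by simp) (by simp)
      (fun s => s (Stack.cnt true) = List.replicate w.length true ∧ s (Stack.cnt' true) = [])
      (by simp) (by simp [moved]) (hin true) (hs true) (hs false).1 (hs false).2
  have hcnt : ∀ b, s (Stack.cnt b) = List.replicate w.length true ∧ s (Stack.cnt' b) = [] :=
    fun b => ⟨h.cnt b, h.cnt' b⟩
  have h₁ := runsIn_iter_moved (s := s) (x := Stack.lo u) (y := Stack.aux) (by simp) (by simp)
    (by simp) (by simp) (by simp) (by simp)
    (fun s => ∀ b, s (Stack.cnt b) = List.replicate w.length true ∧ s (Stack.cnt' b) = [])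
    (by simp) (by simp [moved]) hin2 hcnt (h.lo u) h.aux
  have h₂ := runsIn_iter_moved (s := moved (Stack.arr r) (e u * (w.length * (w.length * 1))) s)
    (x := Stack.lo v) (y := Stack.aux) (by simp) (by simp) (by simp) (by simp) (by simp) (by simp)
    (fun s => s (Stack.cnt false) = List.replicate w.length true ∧ s (Stack.cnt' false) = [])
    (by simp) (by simp [moved]) (hin false) (by simpa [moved] using hcnt false)
    (by simpa [moved] using h.lo v) (by simpa [moved] using h.aux)
  rw [moved_add (by simp)] at h₂
  have h₃ := runsIn_iter_moved
    (s := moved (Stack.arr r) (e u * (w.length * (w.length * 1)) + e v * (w.length * 1)) s)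
    (x := Stack.lo v') (y := Stack.aux) (by simp) (by simp) (by simp) (by simp) (by simp) (by simp)
    (fun _ => True) (by simp) (by simp) (fun s _ => hmv s) trivial
    (by simpa [moved] using h.lo v') (by simpa [moved] using h.aux)
  rw [moved_add (by simp)] at h₃
  refine ((h₁.seq (h₂.seq h₃)).congr ?_).mono ?_
  · congr 1; ring
  · have hu := he u
    have hv := he v
    have hv' := he v'
    gcongr ?_ * ?_ + 2 + (?_ * ?_ + 2 + ?_)
    all_goals first | omega | (ring_nf; nlinarith)

end Spec

section Spec

variable {R : Type} [DecidableEq R]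

/-- The truth value of a proposition. -/
noncomputable def truth (p : Prop) : Bool := @decide p (Classical.propDecidable p)

@[simp]
theorem truth_eq_true {p : Prop} : truth p = true ↔ p := by simp [truth]

@[simp]
theorem truth_eq_false {p : Prop} : truth p = false ↔ ¬ p := by simp [truth]

theorem update_res_congr {s : Stack R → List Bool} {b c : Bool} (l : List Bool)
    (h : b = true ↔ c = true) : update s res (b :: l) = update s res (c :: l) := by
  rw [Bool.eq_iff_iff.2 h]

open Polynomial in
/-- The compiled formula pushes its truth value onto `res`, in polynomial time. -/
theorem Fm.runsIn_compile (φ : Fm R) (hφ : φ.WF = true) :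
    ∃ T : ℕ[X], ∀ (w : List Bool) (e : Var → ℕ) (S : RelStore R) (s : Stack R → List Bool),
      Represents w e S s → (∀ v, e v < w.length) → (∀ v ∈ φ.bound, e v = 0) →
      RunsIn φ.compile s (update s res (truth (φ.Holds w S e) :: s res)) (T.eval w.length) := by
  induction φ with
  | bit v =>
    refine ⟨7 * X + 5, fun w e S s h he _ => ?_⟩
    have h₁ := runsIn_iter_moved (s := s) (a := Stack.inp) (x := Stack.lo v) (y := Stack.aux)
      (by simp) (by simp) (by simp) (by simp) (by simp) (by simp) (fun _ => True) (by simp)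
      (by simp) (fun s _ => runsIn_move (by simp) s) trivial (h.lo v) h.aux
    rw [Nat.mul_one] at h₁
    refine ((runsIn_readCmd (by simp) (by simp) h₁ h.buf (he v).le).congr ?_).mono ?_
    · exact update_res_congr _ (by simp [h.inp, Fm.Holds])
    · simp; have := he v; omega
  | lt v v' =>
    refine ⟨7 * X + 5, fun w e S s h he _ => ?_⟩
    -- The stack `lo v'` is consumed while `lo v` counts the iterations, so the two must differ.
    have hne : v ≠ v' := by simpa [Fm.WF] using hφ
    have h₁ := runsIn_iter_moved (s := s) (a := Stack.lo v') (x := Stack.lo v) (y := Stack.aux)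
      (by simp) (by simpa using hne) (by simp) (by simp) (by simp) (by simp) (fun _ => True)
      (by simp) (by simp) (fun s _ => runsIn_move (by simp) s) trivial (h.lo v) h.aux
    rw [Nat.mul_one] at h₁
    refine ((runsIn_readCmd (by simp) (by simp) h₁ h.buf (he v).le).congr ?_).mono ?_
    · exact update_res_congr _ (by simp [h.lo, List.getElem?_replicate, Fm.Holds])
    · simp; have := he v; omega
  | rel r u v v' =>
    refine ⟨X * (X * (X * 5 + 6) + 6) + 2 + (X * (X * 5 + 6) + 2 + (X * 5 + 2)) + 2 * X ^ 3 + 3,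
      fun w e S s h he _ => ?_⟩
    have hle : (e u * w.length + e v) * w.length + e v' ≤ w.length ^ 3 := by
      have hu := he u
      have hv := he v
      have hv' := he v'
      generalize w.length = n at *
      have h₁ : e u * n + e v + 1 ≤ n * n := by nlinarith
      nlinarith
    refine ((runsIn_readCmd (by simp) (by simp) (h.runsIn_skipCmd he r u v v') h.buf
      hle).congr ?_).mono ?_
    · exact update_res_congr _ (by simp [Fm.Holds, h.arr r _ _ _ (he u) (he v) (he v')])
    · simp
  | neg φ ih =>
    obtain ⟨T, hT⟩ := ih hφ
    refine ⟨T + 3, fun w e S s h he hb => ?_⟩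
    refine (((hT w e S s h he hb).seq (runsIn_negCmd (truth (φ.Holds w S e)) (s res)
      (by simp))).congr ?_).mono (by simp)
    simpa using update_res_congr _ (by simp [Fm.Holds])
  | and φ ψ ih₁ ih₂ =>
    simp only [Fm.WF, Bool.and_eq_true] at hφ
    obtain ⟨T₁, hT₁⟩ := ih₁ hφ.1
    obtain ⟨T₂, hT₂⟩ := ih₂ hφ.2
    refine ⟨T₁ + (T₂ + 5), fun w e S s h he hb => ?_⟩
    simp only [Fm.bound, List.mem_append] at hb
    refine (((hT₁ w e S s h he fun v hv => hb v (Or.inl hv)).seq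
      ((hT₂ w e S _ (h.update_res _) he fun v hv => hb v (Or.inr hv)).seq
      (runsIn_binCmd _ (truth (φ.Holds w S e)) (truth (ψ.Holds w S e)) (s res)
        (by simp)))).congr ?_).mono (by simp)
    simpa using update_res_congr _ (by simp [Fm.Holds])
  | or φ ψ ih₁ ih₂ =>
    simp only [Fm.WF, Bool.and_eq_true] at hφ
    obtain ⟨T₁, hT₁⟩ := ih₁ hφ.1
    obtain ⟨T₂, hT₂⟩ := ih₂ hφ.2
    refine ⟨T₁ + (T₂ + 5), fun w e S s h he hb => ?_⟩
    simp only [Fm.bound, List.mem_append] at hb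
    refine (((hT₁ w e S s h he fun v hv => hb v (Or.inl hv)).seq
      ((hT₂ w e S _ (h.update_res _) he fun v hv => hb v (Or.inr hv)).seq
      (runsIn_binCmd _ (truth (φ.Holds w S e)) (truth (ψ.Holds w S e)) (s res)
        (by simp)))).congr ?_).mono (by simp)
    simpa using update_res_congr _ (by simp [Fm.Holds])
  | ex v φ ih =>
    simp only [Fm.WF, Bool.and_eq_true, Bool.not_eq_true', List.contains_eq_mem,
      decide_eq_false_iff_not] at hφ
    obtain ⟨T, hT⟩ := ih hφ.2
    refine ⟨1 + (X * (T + 5 + 4) + 2), fun w e S s h he hb => ?_⟩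
    have hev : e v = 0 := hb v (by simp [Fm.bound])
    have h₁ := RunsIn.push (K := Stack R) res false s
    have h₂ := RunsIn.iter_exact (m := w.length) (t := T.eval w.length + 5) (a := Stack.hi v)
      (b := Stack.lo v) (c := .seq φ.compile (binCmd Bool.or)) (by simp)
      -- The top of `res` accumulates the disjunction over the values tried so far, starting from
      -- `false`.
      (fun i => update s res (truth (∃ j < i, φ.Holds w S (update e v j)) :: s res))
      (fun i hi x y hx hy => by
        subst hx hy
        have hr := ((h.update_res (truth (∃ j < i, φ.Holds w S (update e v j)) :: s res)).update_var
          v i)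
        have hle : ∀ v', update e v i v' < w.length := by
          intro v'
          by_cases hv : v' = v
          · subst hv; simpa using hi
          · simpa [hv] using he v'
        have hbd : ∀ v' ∈ φ.bound, update e v i v' = 0 := by
          intro v' hv'
          have hv : v' ≠ v := fun e => hφ.1 (e ▸ hv')
          simpa [hv] using hb v' (by simp [Fm.bound, hv'])
        refine ((hT w _ S _ hr hle hbd).seq (runsIn_binCmd _
          (truth (∃ j < i, φ.Holds w S (update e v j)))
          (truth (φ.Holds w S (update e v i))) (s res) (by simp))).congr ?_
        have hex : (∃ j < i + 1, φ.Holds w S (update e v j)) ↔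
            (∃ j < i, φ.Holds w S (update e v j)) ∨ φ.Holds w S (update e v i) := by
          constructor
          · rintro ⟨j, hj, h⟩
            rcases Nat.lt_succ_iff_lt_or_eq.1 hj with hj | rfl
            exacts [Or.inl ⟨j, hj, h⟩, Or.inr h]
          · rintro (⟨j, hj, h⟩ | h)
            exacts [⟨j, by omega, h⟩, ⟨i, by omega, h⟩]
        funext k
        by_cases hk : k = res
        · subst hk
          simp only [update_self]
          congr 1
          rw [Bool.eq_iff_iff, truth_eq_true, hex]
          simp
        · simp only [update_apply, hk, if_false])
      (fun i _ => by simp [h.hi, hev]) (fun i _ => by simp [h.lo, hev])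
    have h0 : truth (∃ j < 0, φ.Holds w S (update e v j)) = false := by simp
    simp only [h0] at h₂
    exact (h₁.seq h₂).mono (by simp)

/-- Collecting blocks of bits on the stack `acc` while `v` runs through all positions. -/
theorem runsIn_collect {w : List Bool} {e : Var → ℕ} {S : RelStore R} {s : Stack R → List Bool}
    {c : Cmd (Stack R)} {t : ℕ} (v : Var) (hev : e v = 0) (B : ℕ → List Bool)
    (hc : ∀ i < w.length, ∀ s, Represents w (update e v i) S s →
      RunsIn c s (update s acc ((B i).reverse ++ s acc)) t) (h : Represents w e S s) :
    RunsIn (iter (Stack.hi v) (Stack.lo v) c) s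
      (update s acc (((List.range w.length).flatMap B).reverse ++ s acc))
      (w.length * (t + 4) + 2) := by
  have h₂ := RunsIn.iter_exact (m := w.length) (t := t) (a := Stack.hi v) (b := Stack.lo v) (c := c)
    (by simp) (fun i => update s acc (((List.range i).flatMap B).reverse ++ s acc))
    (fun i hi x y hx hy => by
      subst hx hy
      refine (hc i hi _ ((h.update_acc (((List.range i).flatMap B).reverse ++ s acc)).update_var
        v i)).congr ?_
      funext k
      by_cases hk : k = acc
      · subst hk
        simp [List.range_succ]
      · simp only [update_apply, hk, if_false])
    (fun i _ => by simp [h.hi, hev]) (fun i _ => by simp [h.lo, hev])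
  simpa using h₂

theorem getElem?_flatMap_range {α : Type*} {c n : ℕ} (B : ℕ → List α) (hB : ∀ i, (B i).length = c)
    {i j : ℕ} (hi : i < n) (hj : j < c) :
    ((List.range n).flatMap B)[i * c + j]? = (B i)[j]? := by
  induction n with
  | zero => omega
  | succ n ih =>
    have hlen : ((List.range n).flatMap B).length = n * c := by
      simp [List.length_flatMap, hB]
    rw [List.range_succ, List.flatMap_append, List.flatMap_singleton]
    rcases Nat.lt_succ_iff_lt_or_eq.1 hi with hi | rfl
    · have : i * c + c ≤ n * c := by rw [← Nat.succ_mul]; exact Nat.mul_le_mul_right _ hi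
      rw [List.getElem?_append_left (by omega), ih hi]
    · rw [List.getElem?_append_right (by omega), hlen]
      congr 1; omega

theorem runsIn_clear {k : Stack R} (s : Stack R → List Bool) :
    RunsIn (whileNonempty k (pop k)) s (update s k []) (2 * (s k).length + 1) := by
  generalize hl : s k = l
  induction l generalizing s with
  | nil => exact (RunsIn.whileNil hl).congr (by rw [← hl, update_eq_self])
  | cons x l ih =>
    have h := ih (update s k l) (by simp)
    refine ((RunsIn.whileCons (by simp [hl]) ((RunsIn.pop k s).congr (by rw [hl]; rfl))
      h).congr (by simp)).mono (by simp; omega)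

open Polynomial in
-- The tables stay untouched while the new values gather on `acc`, so every instance of the formula
-- is evaluated in the old relations. The triples are enumerated lexicographically, the order in
-- which `Represents` addresses a table.
theorem Prog.runsIn_assign (r : R) (φ : Fm R) (hP : (Prog.assign r φ).WF = true) :
    ∃ T : ℕ[X], ∀ (w : List Bool) (e : Var → ℕ) (S : RelStore R) (s : Stack R → List Bool),
      Represents w e S s → s acc = [] → (∀ v, e v < w.length) →
      (∀ v ∈ (Prog.assign r φ).bound, e v = 0) →
      ∃ s', RunsIn (Prog.assign r φ).compile s s' (T.eval w.length) ∧
        Represents w e ((Prog.assign r φ).eval w e S) s' ∧ s' acc = [] ∧ s' res = s res := by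
  simp only [Prog.WF, Bool.and_eq_true, Bool.not_eq_true', List.contains_eq_mem,
    decide_eq_false_iff_not] at hP
  obtain ⟨T, hT⟩ := φ.runsIn_compile hP.2
  refine ⟨X * (X * (X * (T + 1 + 4) + 2 + 4) + 2 + 4) + 2 + ((2 * X ^ 3 + 1) + (2 * X ^ 3 + 1)),
    fun w e S s h hacc he hb => ?_⟩
  simp only [Prog.bound, List.mem_cons] at hb
  let val : ℕ → ℕ → ℕ → Bool := fun i j k =>
    truth (φ.Holds w S (update (update (update e 0 i) 1 j) 2 k))
  let L : List Bool := (List.range w.length).flatMap fun i =>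
    (List.range w.length).flatMap fun j => (List.range w.length).flatMap fun k => [val i j k]
  have hlen₁ : ∀ i j, ((List.range w.length).flatMap fun k => [val i j k]).length = w.length :=
    fun i j => by simp [List.length_flatMap]
  have hlen₂ : ∀ i, ((List.range w.length).flatMap fun j =>
      (List.range w.length).flatMap fun k => [val i j k]).length = w.length * w.length :=
    fun i => by simp [List.length_flatMap]
  have hlen : L.length = w.length ^ 3 := by
    simp [L, List.length_flatMap]; ring
  have hL : ∀ i j k, i < w.length → j < w.length → k < w.length →
      L[(i * w.length + j) * w.length + k]? = some (val i j k) := by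
    intro i j k hi hj hk
    have hjk : j * w.length + k < w.length * w.length := by nlinarith
    rw [show (i * w.length + j) * w.length + k =
      i * (w.length * w.length) + (j * w.length + k) by ring,
      getElem?_flatMap_range _ hlen₂ hi hjk, getElem?_flatMap_range _ (hlen₁ i) hj hk]
    have := getElem?_flatMap_range (c := 1) (j := 0) (fun k => [val i j k]) (fun _ => rfl) hk
      one_pos
    simpa using this
  have h₁ : RunsIn (iter (Stack.hi 0) (Stack.lo 0) (iter (Stack.hi 1) (Stack.lo 1)
      (iter (Stack.hi 2) (Stack.lo 2) (.seq φ.compile (move res acc))))) s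
      (update s acc (L.reverse ++ s acc)) _ :=
    runsIn_collect (t := w.length * (w.length * (T.eval w.length + 1 + 4) + 2 + 4) + 2) 0
      (hb _ (by simp)) _ (fun i hi s h =>
    runsIn_collect (t := w.length * (T.eval w.length + 1 + 4) + 2) 1
      (by simpa using hb 1 (by simp)) _ (fun j hj s h =>
    runsIn_collect (t := T.eval w.length + 1) 2
      (by simpa using hb 2 (by simp)) (fun k => [val i j k]) (fun k hk s h => by
        refine ((hT w _ S s h (fun v => ?_) fun v hv => ?_).seq (RunsIn.moveCons
          (x := val i j k) (l := s res) (by simp [val]) (by simp))).congr ?_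
        · simp only [update_apply]
          split_ifs <;> first | assumption | exact he v
        · have h0 : v ≠ 0 := fun e => hP.1.1.1 (e ▸ hv)
          have h1 : v ≠ 1 := fun e => hP.1.1.2 (e ▸ hv)
          have h2 : v ≠ 2 := fun e => hP.1.2 (e ▸ hv)
          simpa [h0, h1, h2] using hb v (by simp [hv])
        · funext x
          by_cases hx : x = acc
          · subst hx; simp [val]
          · by_cases hx' : x = res
            · subst hx'; simp
            · simp [hx]) h) h) h
  have h₂ := runsIn_clear (k := Stack.arr r) (update s acc (L.reverse ++ s acc))
  have h₃ := RunsIn.moveAll (a := acc) (b := Stack.arr r)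
    (s := update (update s acc (L.reverse ++ s acc)) (Stack.arr r) []) (by simp)
  refine ⟨_, (h₁.seq (h₂.seq h₃)).mono ?_, ?_, ?_, ?_⟩
  · have := h.length_le r
    simp [hacc, hlen]
    omega
  · constructor <;> intros
    case length_le r' =>
      by_cases hr : r' = r
      · subst hr; simp [hacc, hlen]
      · simp [hr, h.length_le]
    case arr r' i j k hi hj hk =>
      by_cases hr : r' = r
      · subst hr; simp [hacc, hL i j k hi hj hk, Prog.eval, val]
      · simp [hr, Prog.eval, h.arr r' i j k hi hj hk]
    all_goals simp [h.inp, h.buf, h.aux, h.lo, h.hi, h.cnt, h.cnt']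
  · simp
  · simp

open Polynomial in
/-- The compiled program computes the new relations, in polynomial time. -/
theorem Prog.runsIn_compile (P : Prog R) (hP : P.WF = true) :
    ∃ T : ℕ[X], ∀ (w : List Bool) (e : Var → ℕ) (S : RelStore R) (s : Stack R → List Bool),
      Represents w e S s → s acc = [] → (∀ v, e v < w.length) → (∀ v ∈ P.bound, e v = 0) →
      ∃ s', RunsIn P.compile s s' (T.eval w.length) ∧ Represents w e (P.eval w e S) s' ∧
        s' acc = [] ∧ s' res = s res := by
  induction P with
  | assign r φ => exact Prog.runsIn_assign r φ hP
  | seq P Q ihP ihQ =>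
    simp only [Prog.WF, Bool.and_eq_true] at hP
    obtain ⟨T₁, hT₁⟩ := ihP hP.1
    obtain ⟨T₂, hT₂⟩ := ihQ hP.2
    refine ⟨T₁ + T₂, fun w e S s h hacc he hb => ?_⟩
    simp only [Prog.bound, List.mem_append] at hb
    obtain ⟨s', hr, hs', hacc', hres⟩ := hT₁ w e S s h hacc he fun v hv => hb v (Or.inl hv)
    obtain ⟨s'', hr', hs'', hacc'', hres'⟩ :=
      hT₂ w e _ s' hs' hacc' he fun v hv => hb v (Or.inr hv)
    exact ⟨s'', (hr.seq hr').mono (by simp), hs'', hacc'', hres'.trans hres⟩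
  | loop v P ih =>
    simp only [Prog.WF, Bool.and_eq_true, Bool.not_eq_true', List.contains_eq_mem,
      decide_eq_false_iff_not] at hP
    obtain ⟨T, hT⟩ := ih hP.2
    refine ⟨X * (T + 4) + 2, fun w e S s h hacc he hb => ?_⟩
    have hev : e v = 0 := hb v (by simp [Prog.bound])
    let st : ℕ → RelStore R := fun i =>
      Nat.rec S (fun i S' => P.eval w (update e v i) S') i
    -- `nrm` resets the counters of `v` to the value `0`. The invariant thereby ignores the actual
    -- contents of the two stacks that drive the iteration.
    let nrm : (Stack R → List Bool) → (Stack R → List Bool) := fun s =>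
      update (update s (Stack.hi v) (List.replicate (w.length - 0) true)) (Stack.lo v)
        (List.replicate 0 true)
    obtain ⟨s', hr, ⟨hs', hacc', hres'⟩, hhi, hlo⟩ := RunsIn.iter (m := w.length)
      (t := T.eval w.length) (c := P.compile) (a := Stack.hi v) (b := Stack.lo v) (by simp)
      (fun i s' => Represents w e (st i) (nrm s') ∧ s' acc = [] ∧ s' res = s res)
      (fun i s x y ⟨h, h', h''⟩ => ⟨by simpa only [nrm, update_pair_idem] using h,
        by simpa using h', by simpa using h''⟩)
      (fun i hi s₁ ⟨h₁, h₂, h₃⟩ hhi hlo => by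
        have hrep := h₁.update_var v i
        simp only [nrm, update_pair_idem] at hrep
        rw [← hhi, ← hlo, update_eq_self, update_eq_self] at hrep
        obtain ⟨s', hr, hs', hacc', hres'⟩ := hT w _ _ s₁ hrep h₂
          (fun v' => by
            by_cases hv : v' = v
            · subst hv; simpa using hi
            · simpa [hv] using he v')
          (fun v' hv' => by
            have hv : v' ≠ v := fun e => hP.1 (e ▸ hv')
            simpa [hv] using hb v' (by simp [Prog.bound, hv']))
        refine ⟨s', hr, ⟨?_, hacc', hres'.trans h₃⟩, ?_, ?_⟩
        · have := hs'.update_var v 0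
          rwa [update_idem, ← hev, update_eq_self, hev] at this
        · rw [hs'.hi, hhi]; simp
        · rw [hs'.lo, hlo]; simp)
      (s := s) ⟨by
        have := h.update_var v 0
        rwa [← hev, update_eq_self, hev] at this, hacc, rfl⟩
      (by simp [h.hi, hev]) (by simp [h.lo, hev])
    refine ⟨s', hr.mono (by simp), ?_, hacc', hres'⟩
    have hn : nrm s' = s' := by
      simp only [nrm, Nat.sub_zero, List.replicate_zero]
      rw [← hhi, ← hlo, update_eq_self, update_eq_self]
    exact hn ▸ hs'

end Spec

/-! ### Initialization and clean-up of the stacks, and the resulting Turing machine. -/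

namespace Stack

variable {R : Type}

/-- Pushes `true` onto all stacks of a list. -/
def pushAll (l : List (Stack R)) (c : Cmd (Stack R)) : Cmd (Stack R) :=
  l.foldr (fun k c => seq (push k true) c) c

/-- Empties all stacks of a list. -/
def clearAll (l : List (Stack R)) (c : Cmd (Stack R)) : Cmd (Stack R) :=
  l.foldr (fun k c => seq (whileNonempty k (pop k)) c) c

/-- The stacks that hold a number as large as the length of the input at the beginning. -/
def fullStacks : List (Stack R) :=
  cnt false :: cnt true :: (List.finRange 16).map hi

/-- Initializes the counters. -/
def setupCmd : Cmd (Stack R) :=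
  seq (whileNonempty inp (pushAll fullStacks (move inp buf))) (whileNonempty buf (move buf inp))

variable [DecidableEq R]

theorem runsIn_pushAll {c : Cmd (Stack R)} {t : ℕ} (l : List (Stack R)) (hl : l.Nodup)
    {s s' : Stack R → List Bool}
    (hc : RunsIn c (fun k => if k ∈ l then true :: s k else s k) s' t) :
    RunsIn (pushAll l c) s s' (l.length + t) := by
  induction l generalizing s with
  | nil => simpa [pushAll] using hc
  | cons a l ih =>
    rw [List.nodup_cons] at hl
    refine ((RunsIn.push a true s).seq (ih hl.2 ?_)).mono (by simp; omega)
    convert hc using 1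
    funext k
    by_cases hk : k = a
    · subst hk; simp [hl.1]
    · simp [hk]

theorem runsIn_clearAll {c : Cmd (Stack R)} {t B : ℕ} (l : List (Stack R))
    {s s' : Stack R → List Bool} (hB : ∀ k, (s k).length ≤ B)
    (hc : RunsIn c (fun k => if k ∈ l then [] else s k) s' t) :
    RunsIn (clearAll l c) s s' (l.length * (2 * B + 1) + t) := by
  induction l generalizing s with
  | nil => simpa [clearAll] using hc
  | cons a l ih =>
    refine ((runsIn_clear (k := a) s).seq (ih (s := update s a []) ?_ ?_)).mono ?_
    · intro k
      by_cases hk : k = a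
      · subst hk; simp
      · simpa [hk] using hB k
    · convert hc using 1
      funext k
      by_cases hk : k = a
      · subst hk; simp
      · simp [hk]
    · have := hB a
      simp only [List.length_cons]
      ring_nf; omega

/-- The stacks after the initialization. -/
def initial (w : List Bool) : Stack R → List Bool := fun k =>
  if k = inp then w else if k ∈ fullStacks then List.replicate w.length true else []

omit [DecidableEq R] in
theorem nodup_fullStacks : (fullStacks : List (Stack R)).Nodup := by
  simp only [fullStacks, List.nodup_cons]
  refine ⟨by simp, by simp, (List.nodup_finRange 16).map ?_⟩
  intro a b h
  simpa using h

/-- Each input bit costs one test, 18 pushes (two `cnt` and sixteen `hi` stacks) and one move, and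
two more steps on the way back to `inp`. -/
theorem runsIn_setupCmd (w : List Bool) :
    RunsIn setupCmd (update (fun _ => []) inp w) (initial (R := R) w) (22 * w.length + 2) := by
  have hinp : (inp : Stack R) ∉ fullStacks := by simp [fullStacks]
  have hbuf : (buf : Stack R) ∉ fullStacks := by simp [fullStacks]
  have main : ∀ (l u : List Bool) (s : Stack R → List Bool), s inp = l →
      s = (fun k => if k = inp then l else if k = buf then u else
        if k ∈ fullStacks then List.replicate u.length true else []) →
      RunsIn (whileNonempty inp (pushAll fullStacks (move inp buf))) s (fun k =>
        if k = buf then l.reverse ++ u else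
          if k ∈ fullStacks then List.replicate (l.length + u.length) true else [])
        (20 * l.length + 1) := by
    intro l
    induction l with
    | nil =>
      intro u s hs hs'
      refine (RunsIn.whileNil hs).congr ?_
      rw [hs']
      funext k
      by_cases hk : k = inp
      · subst hk; simp [hinp]
      · simp [hk]
    | cons x l ih =>
      intro u s hs hs'
      have hm := RunsIn.moveCons (a := inp) (b := buf) (x := x) (l := l)
        (s := fun k => if k ∈ fullStacks then true :: s k else s k) (by simp [hinp, hs]) (by simp)
      refine ((RunsIn.whileCons (by simp [hs]) (runsIn_pushAll fullStacks nodup_fullStacks hm)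
        (ih (x :: u) _ (by simp) ?_)).congr ?_).mono ?_
      · rw [hs']
        funext k
        by_cases hk : k = inp
        · subst hk; simp
        · by_cases hk' : k = buf
          · subst hk'; simp [hbuf]
          · by_cases hk'' : k ∈ fullStacks
            · simp [hk, hk', hk'', List.replicate_succ]
            · simp [hk, hk', hk'']
      · funext k
        simp only [List.reverse_cons, List.append_assoc, List.singleton_append, List.length_cons]
        congr 3
        omega
      · simp [fullStacks]; omega
  have h₁ := main w [] (update (fun _ => []) inp w) (update_self _ _ _) (by
    funext k
    by_cases hk : k = inp
    · subst hk; simp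
    · simp [hk])
  refine ((h₁.seq (RunsIn.moveAll (by simp))).congr ?_).mono ?_
  · funext k
    by_cases hk : k = inp
    · subst hk; simp [initial, hinp]
    · by_cases hk' : k = buf
      · subst hk'; simp [initial, hbuf]
      · simp [hk, hk', initial]
  · simp; omega

theorem represents_initial (w : List Bool) :
    Represents w (fun _ => 0) (fun _ _ _ _ => False) (initial (R := R) w) := by
  constructor <;> simp [initial, fullStacks]

end Stack

open Polynomial Turing Computability in
/-- A decision problem that is described by a first-order program and a closed formula is decided
by a Turing machine in polynomial time. -/
theorem Prog.nonempty_computableInPolyTime {R : Type} [DecidableEq R] [Fintype R] (P : Prog R)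
    (φ : Fm R) (hP : P.WF = true) (hφ : φ.WF = true) {ι : Type} (enc : ι → List Bool)
    (henc : ∀ x, enc x ≠ []) (ans : ι → Bool)
    (h : ∀ x, ans x = true ↔
      φ.Holds (enc x) (P.eval (enc x) (fun _ => 0) fun _ _ _ _ => False) fun _ => 0) :
    Nonempty (TM2ComputableInPolyTime enc encodeBool ans) := by
  classical
  obtain ⟨T₁, hT₁⟩ := P.runsIn_compile hP
  obtain ⟨T₂, hT₂⟩ := φ.runsIn_compile hφ
  -- The final configuration has to be empty apart from the output stack, so all other stacks are
  -- cleared. The concluding `move` acts on empty stacks and only ends the command sequence.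
  let rest : List (Stack R) := (Finset.univ.erase Stack.res).toList
  let c : Cmd (Stack R) := setupCmd.seq (P.compile.seq (φ.compile.seq
    (clearAll rest (move Stack.inp Stack.buf))))
  let T : ℕ[X] := 22 * X + 2 + (T₁ + (T₂ + (C rest.length * (2 * (X ^ 3 + X + 1) + 1) + 1)))
  have key : ∀ x, RunsIn c (update (fun _ => []) Stack.inp (enc x))
      (update (fun _ => []) Stack.res (encodeBool (ans x))) (T.eval (enc x).length) := by
    intro x
    -- Variables range over positions, so even the initial value `0` requires a nonempty input.
    have hlen : 0 < (enc x).length := List.length_pos_of_ne_nil (henc x)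
    obtain ⟨s', hr, hs', hacc, hres⟩ := hT₁ (enc x) _ _ _ (represents_initial (enc x))
      (by simp [initial, fullStacks]) (fun _ => hlen) (fun _ _ => rfl)
    have hφ' := hT₂ (enc x) _ _ s' hs' (fun _ => hlen) (fun _ _ => rfl)
    have hans : truth (φ.Holds (enc x) (P.eval (enc x) (fun _ => 0) fun _ _ _ _ => False)
        fun _ => 0) = ans x := by
      rw [Bool.eq_iff_iff, truth_eq_true, h]
    have hres' : s' Stack.res = [] := hres.trans (by simp [initial, fullStacks])
    rw [hans, hres'] at hφ'
    have hrest : ∀ k, k ∈ rest ↔ k ≠ Stack.res := by simp [rest]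
    have hclear := runsIn_clearAll (c := move Stack.inp Stack.buf) (t := 1)
      (B := (enc x).length ^ 3 + (enc x).length + 1) rest
      (s := update s' Stack.res [ans x]) (s' := update (fun _ => []) Stack.res [ans x])
      (by
        intro k
        cases k with
        | inp => simp [hs'.inp]; omega
        | res => simp
        | buf => simp [hs'.buf]
        | aux => simp [hs'.aux]
        | acc => simp [hacc]
        | lo v => simp [hs'.lo]
        | hi v => simp [hs'.hi]; omega
        | cnt b => simp [hs'.cnt]; omega
        | cnt' b => simp [hs'.cnt']
        | arr r => have := hs'.length_le r; simp; omega)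
      ((RunsIn.moveNil (by simp [hrest])).congr (by
        funext k
        by_cases hk : k = Stack.res
        · subst hk; simp [hrest]
        · simp [hrest, hk]))
    refine ((runsIn_setupCmd (enc x)).seq (hr.seq (hφ'.seq hclear))).mono ?_
    simp [T]
  have hmap : ∀ l : List Bool, List.map (Equiv.refl Bool).invFun l = l := List.map_id
  have hfin : ∀ x, Nonempty (TM2OutputsInTime (c.toTM Stack.inp Stack.res)
      (List.map (Equiv.refl Bool).invFun (enc x))
      (some (List.map (Equiv.refl Bool).invFun (encodeBool (ans x))))
      ((T + 1).eval (enc x).length)) := fun x => by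
    have hcongr : ∀ l l' m m' : List Bool, l = l' → m = m' → ∀ t,
        Nonempty (TM2OutputsInTime (c.toTM Stack.inp Stack.res) l (some m) t) →
        Nonempty (TM2OutputsInTime (c.toTM Stack.inp Stack.res) l' (some m') t) := by
      rintro l _ m _ rfl rfl t h
      exact h
    refine hcongr _ _ _ _ (hmap _).symm (hmap _).symm _ ?_
    have := (key x).outputsInTime
    simpa using this
  exact ⟨{
    tm := c.toTM Stack.inp Stack.res
    inputAlphabet := Equiv.refl Bool
    outputAlphabet := Equiv.refl Bool
    time := T + 1
    outputsFun := fun x => (hfin x).some }⟩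

/-! ### Iterated closures -/

section Stage

variable {α : Type*}

/-- The elements that can be reached from `a` in at most `t` steps. -/
def stage (step : α → α → Prop) (a : α) : ℕ → Set α
  | 0 => {a}
  | t + 1 => stage step a t ∪ {b | ∃ c ∈ stage step a t, step c b}

theorem reflTransGen_of_mem_stage {step : α → α → Prop} {a b : α} {t : ℕ}
    (h : b ∈ stage step a t) : Relation.ReflTransGen step a b := by
  induction t generalizing b with
  | zero => obtain rfl := h; exact .refl
  | succ t ih =>
    rcases h with h | ⟨c, hc, h⟩
    exacts [ih h, (ih hc).tail h]

/-- The stages increase inside `U` and, as long as they grow, gain an element each time; they are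
therefore stationary after at most `N` steps. -/
theorem mem_stage_iff {step : α → α → Prop} {a : α} (U : Finset α) (ha : a ∈ U)
    (hU : ∀ c ∈ U, ∀ b, step c b → b ∈ U) {N : ℕ} (hN : U.card ≤ N) (b : α) :
    b ∈ stage step a N ↔ Relation.ReflTransGen step a b := by
  classical
  refine ⟨reflTransGen_of_mem_stage, fun h => ?_⟩
  have hsub : ∀ t, stage step a t ⊆ U := by
    intro t
    induction t with
    | zero => rintro _ rfl; exact ha
    | succ t ih => rintro b (h | ⟨c, hc, h⟩); exacts [ih h, hU c (ih hc) b h]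
  have hmono : Monotone (stage step a) := monotone_nat_of_le_succ fun t => Set.subset_union_left
  have hfin : ∀ t, (stage step a t).Finite := fun t => U.finite_toSet.subset (hsub t)
  have hst : ∃ t ≤ N, stage step a (t + 1) ⊆ stage step a t := by
    by_contra! hne
    have hcard : ∀ t ≤ N + 1, t < (stage step a t).ncard := by
      intro t
      induction t with
      | zero => intro _; simp [stage]
      | succ t ih =>
        intro ht
        have h₁ := ih (by omega)
        have h₂ : (stage step a t).ncard < (stage step a (t + 1)).ncard :=
          Set.ncard_lt_ncard ⟨hmono (by omega), hne t (by omega)⟩ (hfin _)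
        omega
    have h₁ := hcard (N + 1) le_rfl
    have h₂ := Set.ncard_le_ncard (hsub (N + 1)) U.finite_toSet
    rw [Set.ncard_coe_finset] at h₂
    omega
  obtain ⟨t, ht, hst⟩ := hst
  refine hmono ht ?_
  clear hN
  induction h with
  | refl => exact hmono (Nat.zero_le t) rfl
  | tail _ h ih => exact hst (Or.inr ⟨_, ih, h⟩)

/-- Iterating a shrinking operator on a set of at most `N` elements reaches a fixed point after `N`
steps. -/
theorem iterate_fixed_of_shrinking {f : Set α → Set α} (hf : ∀ C, f C ⊆ C) (U : Finset α) {N : ℕ}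
    (hN : U.card ≤ N) {C : Set α} (hC : C ⊆ U) : f (f^[N] C) = f^[N] C := by
  have hanti : Antitone fun t => f^[t] C := antitone_nat_of_succ_le fun t => by
    simp only [iterate_succ_apply']
    exact hf _
  have hfin : ∀ t, (f^[t] C).Finite := fun t =>
    U.finite_toSet.subset ((hanti (Nat.zero_le t)).trans hC)
  have hst : ∃ t ≤ N, f (f^[t] C) = f^[t] C := by
    by_contra! hne
    have hcard : ∀ t ≤ N + 1, (f^[t] C).ncard + t ≤ U.card := by
      intro t
      induction t with
      | zero =>
        intro _
        have := Set.ncard_le_ncard hC U.finite_toSet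
        rw [Set.ncard_coe_finset] at this
        simpa using this
      | succ t ih =>
        intro ht
        have h₁ := ih (by omega)
        have h₂ : (f^[t + 1] C).ncard < (f^[t] C).ncard := by
          rw [iterate_succ_apply']
          exact Set.ncard_lt_ncard ((hf _).ssubset_of_ne (hne t (by omega))) (hfin _)
        omega
    have := hcard (N + 1) le_rfl
    omega
  obtain ⟨t, ht, hst⟩ := hst
  obtain ⟨d, rfl⟩ := Nat.exists_eq_add_of_le' ht
  have : ∀ d, f^[d] (f^[t] C) = f^[t] C := by
    intro d
    induction d with
    | zero => rfl
    | succ d ih => rw [iterate_succ_apply', ih, hst]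
  rw [iterate_add_apply, this, hst]

end Stage

/-! ### Patterns under renaming of states and letters -/

section Rename

variable {Q Q' α β P P' : Type*}

/-- The image of a transition relation under a renaming of the states and the letters. -/
def mapRel (f : Q → P) (h : α → β) (D : Q → α → Q → Prop) (x : P) (b : β) (y : P) : Prop :=
  ∃ p a q, D p a q ∧ f p = x ∧ h a = b ∧ f q = y

variable {f : Q → P} {g : Q' → P'} {h : α → β} {D : Q → α → Q → Prop} {D' : Q' → α → Q' → Prop}

/-- The tables of the algorithm contain numbers instead of elements of `Fin`, so patterns are
transported along the embedding. A renamed relation has transitions only between renamed states; a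
path from `f p` therefore stays in the range of `f` and lifts by injectivity. -/
theorem within_mapRel (hf : Injective f) {C : Set β} {p : Q} {x : P} :
    Within (mapRel f h D) C (f p) x ↔ ∃ q, x = f q ∧ Within D (h ⁻¹' C) p q := by
  constructor
  · intro hw
    induction hw with
    | refl => exact ⟨p, rfl, .refl⟩
    | tail _ hs ih =>
      obtain ⟨q, rfl, hq⟩ := ih
      obtain ⟨b, hb, q₀, a, q', hD, he, rfl, rfl⟩ := hs
      obtain rfl := hf he
      exact ⟨q', rfl, hq.tail ⟨a, hb, hD⟩⟩
  · rintro ⟨q, rfl, hq⟩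
    induction hq with
    | refl => exact .refl
    | tail _ hs ih =>
      obtain ⟨a, ha, hD⟩ := hs
      exact ih.tail ⟨h a, ha, _, a, _, hD, rfl, rfl, rfl⟩

theorem within_mapRel' (hf : Injective f) {C : Set β} {p q : Q} :
    Within (mapRel f h D) C (f p) (f q) ↔ Within D (h ⁻¹' C) p q := by
  rw [within_mapRel hf]
  exact ⟨fun ⟨r, hr, hw⟩ => hf hr ▸ hw, fun hw => ⟨q, rfl, hw⟩⟩

theorem Saturated.of_mapRel (hf : Injective f) (hh : Injective h) {C : Set β} {r : Q}
    (hs : Saturated (mapRel f h D) C (f r)) : Saturated D (h ⁻¹' C) r := by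
  intro a ha
  obtain ⟨_, _, h₁, ⟨s, a', t, hD, rfl, he, rfl⟩, h₂⟩ := hs (h a) ha
  obtain rfl := hh he
  exact ⟨s, t, (within_mapRel' hf).1 h₁, hD, (within_mapRel' hf).1 h₂⟩

theorem Saturated.mapRel (hf : Injective f) (hh : Injective h) {C : Set α} {r : Q}
    (hs : Saturated D C r) : Saturated (mapRel f h D) (h '' C) (f r) := by
  rintro _ ⟨a, ha, rfl⟩
  obtain ⟨s, t, h₁, hD, h₂⟩ := hs a ha
  refine ⟨f s, f t, (within_mapRel' hf).2 ?_, ⟨s, a, t, hD, rfl, rfl, rfl⟩,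
    (within_mapRel' hf).2 ?_⟩ <;> rwa [Set.preimage_image_eq _ hh]

theorem patternStep_mapRel (hf : Injective f) (hg : Injective g) (hh : Injective h) {p : Q}
    {p' : Q'} {z : P × P'} :
    PatternStep (mapRel f h D) (mapRel g h D') (f p, g p') z ↔
      ∃ q q', z = (f q, g q') ∧ PatternStep D D' (p, p') (q, q') := by
  constructor
  · generalize hx : (f p, g p') = x
    intro hs
    cases hs with
    | letter b h₁ h₂ =>
      obtain ⟨p₁, a, q, hD, he, rfl, rfl⟩ := h₁
      obtain ⟨p₂, a', q', hD', he', ha, rfl⟩ := h₂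
      simp only [Prod.mk.injEq] at hx
      obtain rfl := hf (hx.1.trans he.symm)
      obtain rfl := hg (hx.2.trans he'.symm)
      obtain rfl := hh ha
      exact ⟨q, q', rfl, .letter _ hD hD'⟩
    | block C r r' h₁ h₂ h₃ h₄ h₅ h₆ =>
      simp only [Prod.mk.injEq] at hx
      obtain ⟨rfl, rfl⟩ := hx
      obtain ⟨r, rfl, k₃⟩ := (within_mapRel hf).1 h₃
      obtain ⟨q, rfl, k₄⟩ := (within_mapRel hf).1 h₄
      obtain ⟨r', rfl, k₅⟩ := (within_mapRel hg).1 h₅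
      obtain ⟨q', rfl, k₆⟩ := (within_mapRel hg).1 h₆
      exact ⟨q, q', rfl, .block _ r r' (h₁.of_mapRel hf hh) (h₂.of_mapRel hg hh) k₃ k₄ k₅ k₆⟩
  · rintro ⟨q, q', rfl, hs⟩
    cases hs with
    | letter a h₁ h₂ => exact .letter (h a) ⟨_, a, _, h₁, rfl, rfl, rfl⟩ ⟨_, a, _, h₂, rfl, rfl, rfl⟩
    | block C r r' h₁ h₂ h₃ h₄ h₅ h₆ =>
      refine .block (h '' C) (f r) (g r') (h₁.mapRel hf hh) (h₂.mapRel hg hh)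
        ((within_mapRel' hf).2 ?_) ((within_mapRel' hf).2 ?_) ((within_mapRel' hg).2 ?_)
        ((within_mapRel' hg).2 ?_) <;> rwa [Set.preimage_image_eq _ hh]

theorem reflTransGen_patternStep_mapRel (hf : Injective f) (hg : Injective g) (hh : Injective h)
    {p : Q} {p' : Q'} {z : P × P'} :
    Relation.ReflTransGen (PatternStep (mapRel f h D) (mapRel g h D')) (f p, g p') z ↔
      ∃ q q', z = (f q, g q') ∧ Relation.ReflTransGen (PatternStep D D') (p, p') (q, q') := by
  constructor
  · intro hr
    induction hr with
    | refl => exact ⟨p, p', rfl, .refl⟩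
    | tail _ hs ih =>
      obtain ⟨q, q', rfl, hr⟩ := ih
      obtain ⟨r, r', rfl, hs'⟩ := (patternStep_mapRel hf hg hh).1 hs
      exact ⟨r, r', rfl, hr.tail hs'⟩
  · rintro ⟨q, q', rfl, hr⟩
    generalize hx : (p, p') = x at hr
    generalize hy : (q, q') = y at hr
    induction hr generalizing q q' with
    | refl =>
      obtain ⟨rfl, rfl⟩ := Prod.mk.inj (hx.trans hy.symm)
      exact .refl
    | @tail y _ _ hs ih =>
      subst hy
      exact (ih y.1 y.2 rfl).tail ((patternStep_mapRel hf hg hh).2 ⟨q, q', rfl, hs⟩)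

end Rename

/-! ### Reading the code of an automaton -/

section Parse

/-- At position `i` of `w` starts the number `m` in self-delimiting unary; the code ends before
position `j`. -/
def Block (w : List Bool) (i m j : ℕ) : Prop :=
  j = i + m + 1 ∧ w[i + m]? = some false ∧ ∀ u, i ≤ u → u < i + m → w[u]? = some true

/-- The number is determined by the first `false` from the starting position on. -/
theorem block_iff {w pre post : List Bool} {m : ℕ} (hw : w = pre ++ (unaryCode m ++ post))
    (m' j : ℕ) : Block w pre.length m' j ↔ m' = m ∧ j = pre.length + (unaryCode m).length := by
  have hget : ∀ u, u < m → w[pre.length + u]? = some true := by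
    intro u hu
    rw [hw, List.getElem?_append_right (by omega)]
    simp [unaryCode, List.getElem?_append, hu]
  have hend : w[pre.length + m]? = some false := by
    rw [hw, List.getElem?_append_right (by omega)]
    simp [unaryCode]
  have hlen : (unaryCode m).length = m + 1 := by simp [unaryCode]
  rw [hlen]
  constructor
  · rintro ⟨rfl, h₁, h₂⟩
    rcases lt_trichotomy m' m with hlt | rfl | hlt
    · rw [hget m' hlt] at h₁; simp at h₁
    · exact ⟨rfl, by omega⟩
    · rw [h₂ _ (by omega) (by omega)] at hend; simp at hend
  · rintro ⟨rfl, rfl⟩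
    refine ⟨by omega, hend, fun u h₁ h₂ => ?_⟩
    obtain ⟨u, rfl⟩ := Nat.exists_eq_add_of_le h₁
    exact hget u (by omega)

/-- One step from an item of a list to the next one. -/
def ItemStep {ι : Type*} (w : List Bool) (dec : ℕ → ι → ℕ → Prop) (i j : ℕ) : Prop :=
  w[i]? = some true ∧ ∃ x, dec (i + 1) x j

/-- Decodability is assumed only for items followed by a nonempty remainder, which the closing `0`
guarantees; decoders may then insist that the end of an item is a position of `w`. The second
conclusion locates that closing bit: it is the only reachable position that announces no item. -/
theorem items_iff {ι : Type*} {w : List Bool} {dec : ℕ → ι → ℕ → Prop} {enc : ι → List Bool}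
    {post : List Bool} (xs : List ι)
    (hdec : ∀ x ∈ xs, ∀ pre post : List Bool, post ≠ [] → w = pre ++ (enc x ++ post) →
      ∀ y j, dec pre.length y j ↔ y = x ∧ j = pre.length + (enc x).length) :
    ∀ pre : List Bool, w = pre ++ (xs.flatMap (fun x => true :: enc x) ++ false :: post) →
    (∀ y, (∃ i, Relation.ReflTransGen (ItemStep w dec) pre.length i ∧ w[i]? = some true ∧
      ∃ j, dec (i + 1) y j) ↔ y ∈ xs) ∧
    ∀ i, (Relation.ReflTransGen (ItemStep w dec) pre.length i ∧ w[i]? ≠ some true) ↔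
      i = pre.length + (xs.flatMap fun x => true :: enc x).length := by
  induction xs with
  | nil =>
    intro pre hw
    have hbit : w[pre.length]? = some false := by simp [hw]
    have hr : ∀ i, Relation.ReflTransGen (ItemStep w dec) pre.length i ↔ i = pre.length := by
      intro i
      rw [Relation.ReflTransGen.cases_head_iff]
      refine ⟨?_, fun h => Or.inl h.symm⟩
      rintro (h | ⟨j, ⟨h, _⟩, _⟩)
      · exact h.symm
      · rw [hbit] at h; simp at h
    constructor
    · intro y
      simp only [hr, exists_eq_left, hbit, List.not_mem_nil, iff_false]
      simp
    · intro i
      simp only [hr, List.flatMap_nil, List.length_nil, Nat.add_zero, and_iff_left_iff_imp]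
      rintro rfl
      simp [hbit]
  | cons x xs ih =>
    intro pre hw
    have hw' : w = (pre ++ (true :: enc x)) ++
        (xs.flatMap (fun x => true :: enc x) ++ false :: post) := by
      simp [hw]
    obtain ⟨ih₁, ih₂⟩ := ih (fun x hx => hdec x (by simp [hx])) _ hw'
    have hbit : w[pre.length]? = some true := by simp [hw]
    have hx := hdec x (by simp) (pre ++ [true])
      (xs.flatMap (fun x => true :: enc x) ++ false :: post) (by simp) (by simp [hw])
    have hlen : (pre ++ (true :: enc x)).length = pre.length + 1 + (enc x).length := by
      simp; omega
    rw [hlen] at ih₁ ih₂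
    simp only [List.length_append, List.length_singleton] at hx
    have hr : ∀ i, Relation.ReflTransGen (ItemStep w dec) pre.length i ↔ i = pre.length ∨
        Relation.ReflTransGen (ItemStep w dec) (pre.length + 1 + (enc x).length) i := by
      intro i
      rw [Relation.ReflTransGen.cases_head_iff]
      constructor
      · rintro (h | ⟨j, ⟨_, y, hy⟩, hr⟩)
        · exact Or.inl h.symm
        · obtain ⟨_, rfl⟩ := (hx y j).1 hy
          exact Or.inr hr
      · rintro (h | h)
        · exact Or.inl h.symm
        · exact Or.inr ⟨_, ⟨hbit, x, (hx _ _).2 ⟨rfl, rfl⟩⟩, h⟩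
    constructor
    · intro y
      rw [List.mem_cons, ← ih₁ y]
      constructor
      · rintro ⟨i, hi, hb, j, hj⟩
        rcases (hr i).1 hi with rfl | hi
        · exact Or.inl ((hx y j).1 hj).1
        · exact Or.inr ⟨i, hi, hb, j, hj⟩
      · rintro (rfl | ⟨i, hi, h⟩)
        · exact ⟨pre.length, .refl, hbit, _, (hx _ _).2 ⟨rfl, rfl⟩⟩
        · exact ⟨i, (hr i).2 (Or.inr hi), h⟩
    · intro i
      have := ih₂ i
      simp only [List.flatMap_cons, List.length_append, List.length_cons]
      rw [show pre.length + ((enc x).length + 1 + (xs.flatMap fun x => true :: enc x).length) =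
        pre.length + 1 + (enc x).length + (xs.flatMap fun x => true :: enc x).length by omega,
        ← this, hr]
      constructor
      · rintro ⟨rfl | h, hb⟩
        · exact absurd hbit hb
        · exact ⟨h, hb⟩
      · rintro ⟨h, hb⟩
        exact ⟨Or.inr h, hb⟩

namespace FinNFA

variable {k : ℕ} (A : FinNFA k)

/-- The accepting states, in the order of the code. -/
def finalItems : List ℕ := ((List.finRange A.numStates).filter (· ∈ A.final)).map Fin.val

theorem finalCode_eq :
    A.finalCode = A.finalItems.flatMap (fun q => true :: unaryCode q) ++ [false] := by
  rw [finalCode, finalItems, List.flatMap_map]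
  congr 1
  induction List.finRange A.numStates with
  | nil => rfl
  | cons q l ih =>
    rw [List.flatMap_cons, ih, List.filter_cons]
    by_cases h : q ∈ A.final <;> simp [h]

theorem mem_finalItems {i : ℕ} : i ∈ A.finalItems ↔ ∃ q ∈ A.final, (q : ℕ) = i := by
  simp [finalItems]

/-- The transitions, in the order of the code. -/
def deltaItems : List (ℕ × ℕ × ℕ) :=
  (List.finRange A.numStates).flatMap fun p => (List.finRange k).flatMap fun a =>
    (List.finRange A.numStates).flatMap fun q =>
      if q ∈ A.delta p a then [((p : ℕ), (a : ℕ), (q : ℕ))] else []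

/-- The code of a transition. -/
def tripleCode (x : ℕ × ℕ × ℕ) : List Bool := unaryCode x.1 ++ unaryCode x.2.1 ++ unaryCode x.2.2

theorem deltaCode_eq :
    A.deltaCode = A.deltaItems.flatMap (fun x => true :: tripleCode x) ++ [false] := by
  rw [deltaCode, deltaItems]
  simp only [List.flatMap_assoc]
  congr! 8 with p a q
  split_ifs <;> simp [tripleCode]

theorem mem_deltaItems {i a j : ℕ} : (i, a, j) ∈ A.deltaItems ↔
    mapRel Fin.val Fin.val (fun p a q => q ∈ A.delta p a) i a j := by
  simp only [deltaItems, List.mem_flatMap, List.mem_finRange, true_and, mapRel]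
  constructor
  · rintro ⟨p, b, q, h⟩
    split_ifs at h with hd
    · simp only [List.mem_singleton, Prod.mk.injEq] at h
      exact ⟨p, b, q, hd, h.1.symm, h.2.1.symm, h.2.2.symm⟩
    · simp at h
  · rintro ⟨p, b, q, hd, rfl, rfl, rfl⟩
    exact ⟨p, b, q, by simp [hd]⟩

end FinNFA

end Parse

/-! ### Reasoning about first-order programs -/

namespace Prog

variable {R : Type} [DecidableEq R]

omit [DecidableEq R] in
/-- The relations that a program redefines. -/
def writes : Prog R → List R
  | assign r _ => [r]
  | seq P Q => P.writes ++ Q.writes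
  | loop _ P => P.writes

variable {w : List Bool} {e : Var → ℕ} {S : RelStore R}

theorem eval_loop_induction {v : Var} {P : Prog R} (I : ℕ → RelStore R → Prop) (h₀ : I 0 S)
    (hs : ∀ i < w.length, ∀ S, I i S → I (i + 1) (P.eval w (update e v i) S)) :
    I w.length ((loop v P).eval w e S) := by
  have : ∀ t ≤ w.length, I t (Nat.rec S (fun i S' => P.eval w (update e v i) S') t) := by
    intro t
    induction t with
    | zero => exact fun _ => h₀
    | succ t ih => exact fun ht => hs t ht _ (ih (by omega))
  exact this _ le_rfl

theorem eval_of_notMem_writes {P : Prog R} {r : R} (hr : r ∉ P.writes) :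
    P.eval w e S r = S r := by
  induction P generalizing e S with
  | assign r' φ => exact update_of_ne (by simpa [writes] using hr) _ _
  | seq P Q hP hQ =>
    simp only [writes, List.mem_append, not_or] at hr
    rw [eval, hQ hr.2, hP hr.1]
  | loop v P hP =>
    exact eval_loop_induction (fun _ S' => S' r = S r) rfl fun i _ S' h => (hP hr).trans h

theorem eval_seq (P Q : Prog R) : (seq P Q).eval w e S = Q.eval w e (P.eval w e S) := rfl

theorem eval_assign (r : R) (φ : Fm R) (i j k : ℕ) : (assign r φ).eval w e S r i j k ↔
    φ.Holds w S (update (update (update e 0 i) 1 j) 2 k) := by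
  simp [eval]

end Prog

/-! ### The algorithm -/

/-- The relations of the decision procedure. -/
inductive Tbl
  | next | eqv | plus | val | items | cur | letters | main
  | init (b : Bool) | fin (b : Bool) | delta (b : Bool) | within (b : Bool)
  deriving DecidableEq, Fintype

namespace Tbl

/-- Computes successors, equality, and where numbers in unary start and end. -/
def arith : Prog Tbl :=
  .seq (.assign next (.and (.lt 0 1) (.neg (.ex 9 (.and (.lt 0 9) (.lt 9 1))))))
  (.seq (.assign eqv (.and (.neg (.lt 0 1)) (.neg (.lt 1 0))))
  (.seq (.loop 3 (.assign plus (.or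
    (.and (.neg (.ex 9 (.lt 9 1))) (.rel eqv 0 2 2))
    (.ex 9 (.ex 10 (.and (.rel next 9 1 1) (.and (.rel next 10 2 2) (.rel plus 0 9 10))))))))
  (.assign val (.ex 9 (.and (.rel plus 0 1 9) (.and (.neg (.bit 9)) (.and (.rel next 9 2 2)
    (.neg (.ex 10 (.and (.neg (.lt 10 0)) (.and (.lt 10 9) (.neg (.bit 10)))))))))))))

/-- The relations computed by `arith`. -/
structure Arith (w : List Bool) (S : RelStore Tbl) : Prop where
  -- All relation symbols are ternary; binary and unary relations are read on tuples that repeat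
  -- their last coordinate.
  next : ∀ i j, i < w.length → j < w.length → (S next i j j ↔ j = i + 1)
  eqv : ∀ i j, S eqv i j j ↔ i = j
  val : ∀ i m j, i < w.length → m < w.length → j < w.length → (S val i m j ↔ Block w i m j)

theorem Arith.eval {w : List Bool} {e : Var → ℕ} {S : RelStore Tbl} (h : Arith w S) {P : Prog Tbl}
    (h₁ : Tbl.next ∉ P.writes) (h₂ : Tbl.eqv ∉ P.writes) (h₃ : Tbl.val ∉ P.writes) :
    Arith w (P.eval w e S) := by
  constructor
  · rw [Prog.eval_of_notMem_writes h₁]; exact h.next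
  · rw [Prog.eval_of_notMem_writes h₂]; exact h.eqv
  · rw [Prog.eval_of_notMem_writes h₃]; exact h.val

/-- Addition is built by recursion on the second summand: after `t` rounds `plus` is correct for
second summands below `t`, the step using `i + m = z ↔ i + (m - 1) = z - 1`. A unary block is then
recognized from the sum giving the position of its final `false`. -/
theorem arith_spec (w : List Bool) (e : Var → ℕ) (S : RelStore Tbl) :
    Arith w (arith.eval w e S) := by
  simp only [arith, Prog.eval]
  set S₁ : RelStore Tbl := update S next _ with hS₁
  have hnext : ∀ i j k, j < w.length → (S₁ next i j k ↔ j = i + 1) := by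
    intro i j k hj
    simp only [hS₁, update_self, Fm.Holds, update_apply, Fin.isValue, Fin.reduceEq, if_false]
    constructor
    · rintro ⟨h₁, h₂⟩
      by_contra hne
      exact h₂ ⟨i + 1, by omega, by omega, by omega⟩
    · rintro rfl
      exact ⟨by omega, fun ⟨k, _, h₁, h₂⟩ => by omega⟩
  set S₂ : RelStore Tbl := update S₁ eqv _ with hS₂
  have heqv : ∀ i j k, S₂ eqv i j k ↔ i = j := by
    intro i j k
    simp only [hS₂, update_self, Fm.Holds, update_apply, Fin.isValue, Fin.reduceEq, if_false]
    omega
  have hnext₂ : S₂ next = S₁ next := by simp [hS₂]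
  clear_value S₁ S₂
  set S₃ : RelStore Tbl := Nat.rec S₂ _ w.length with hS₃
  have hplus : S₃ next = S₁ next ∧ S₃ eqv = S₂ eqv ∧ ∀ i m z, i < w.length → m < w.length →
      z < w.length → (S₃ plus i m z ↔ i + m = z) := by
    have key := Prog.eval_loop_induction (w := w) (e := e) (v := 3) (S := S₂) (P := .assign plus (.or
        (.and (.neg (.ex 9 (.lt 9 1))) (.rel eqv 0 2 2))
        (.ex 9 (.ex 10 (.and (.rel next 9 1 1) (.and (.rel next 10 2 2) (.rel plus 0 9 10)))))))
      (fun t S => S next = S₁ next ∧ S eqv = S₂ eqv ∧ (0 < t → ∀ i m z, i < w.length →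
        m < w.length → z < w.length → m < t → (S plus i m z ↔ i + m = z)))
      ⟨hnext₂, rfl, by simp⟩ (by
        rintro t ht S ⟨h₁, h₂, h₃⟩
        refine ⟨?_, ?_, ?_⟩
        · simpa [Prog.eval] using h₁
        · simpa [Prog.eval] using h₂
        intro _ i m z hi hm hz hmt
        rw [Prog.eval_assign]
        simp only [Fm.Holds, update_apply, Fin.isValue, Fin.reduceEq, if_true, if_false]
        rw [h₂, heqv, h₁]
        constructor
        · rintro (⟨h, rfl⟩ | ⟨a, ha, b, hb, h₄, h₅, h₆⟩)
          · have : m = 0 := by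
              by_contra hne
              exact h ⟨0, by omega, by omega⟩
            omega
          · rw [hnext _ _ _ hm] at h₄
            rw [hnext _ _ _ hz] at h₅
            rw [h₃ (by omega) _ _ _ hi ha hb (by omega)] at h₆
            omega
        · intro h
          rcases Nat.eq_zero_or_pos m with rfl | hm'
          · exact Or.inl ⟨by simp, by omega⟩
          · refine Or.inr ⟨m - 1, by omega, z - 1, by omega, ?_, ?_, ?_⟩
            · rw [hnext _ _ _ hm]; omega
            · rw [hnext _ _ _ hz]; omega
            · rw [h₃ (by omega) _ _ _ hi (by omega) (by omega) (by omega)]; omega)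
    exact ⟨key.1, key.2.1, fun i m z hi hm hz => key.2.2 (by omega) i m z hi hm hz hm⟩
  clear_value S₃
  obtain ⟨h₁, h₂, h₃⟩ := hplus
  constructor
  · intro i j _ hj
    simpa [h₁] using hnext i j j hj
  · intro i j
    simpa [h₂] using heqv i j j
  · intro i m j hi hm hj
    simp only [update_self, Fm.Holds, update_apply, Fin.isValue, Fin.reduceEq, if_false]
    rw [h₁]
    have hbit : ∀ u < w.length, w[u]? ≠ some true ↔ w[u]? = some false := by
      intro u hu
      rw [List.getElem?_eq_getElem hu]
      cases w[u] <;> simp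
    constructor
    · rintro ⟨z, hz, h₄, h₅, h₆, h₇⟩
      rw [h₃ _ _ _ hi hm hz] at h₄
      rw [hnext _ _ _ hj] at h₆
      subst h₄
      refine ⟨h₆, (hbit _ hz).1 h₅, fun u hu hu' => ?_⟩
      by_contra hne
      exact h₇ ⟨u, by omega, by omega, hu', hne⟩
    · rintro ⟨rfl, h₄, h₅⟩
      refine ⟨i + m, by omega, (h₃ _ _ _ hi hm (by omega)).2 rfl, by simp [h₄],
        (hnext _ _ _ hj).2 rfl, ?_⟩
      rintro ⟨u, _, h₆, h₇, h₈⟩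
      exact h₈ (h₅ u (by omega) h₇)

end Tbl

/-! ### Parsing the code of an automaton by a first-order program. -/

namespace Tbl

/-- Collects the starting positions of the items of a list that starts at the position `cur`; the
formula `φ` says that an item, without its announcing bit, goes from position `10` to position
`0`. -/
def closeItems (φ : Fm Tbl) : Prog Tbl :=
  .seq (.assign items (.rel cur 0 0 0))
  (.loop 3 (.assign items (.or (.rel items 0 0 0) (.ex 9 (.and (.rel items 9 9 9)
    (.and (.bit 9) (.ex 10 (.and (.rel next 9 10 10) φ))))))))

/-- One round adds one `ItemStep`. Items end inside `w`, so only `w.length` positions are reachable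
and as many rounds suffice. `hφ` ranges over all stores satisfying `Arith`, since `items` changes
from round to round. -/
theorem closeItems_spec {ι : Type*} {w : List Bool} {e : Var → ℕ} {S : RelStore Tbl} {φ : Fm Tbl}
    {dec : ℕ → ι → ℕ → Prop} {c : ℕ} (hA : Arith w S) (hc : c < w.length)
    (hcur : ∀ i < w.length, S cur i i i ↔ i = c) (hdec : ∀ i x j, dec i x j → i < j ∧ j < w.length)
    (hφ : ∀ e S, Arith w S → e 10 < w.length → e 0 < w.length →
      (φ.Holds w S e ↔ ∃ x, dec (e 10) x (e 0))) (i : ℕ) (hi : i < w.length) :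
    (closeItems φ).eval w e S items i i i ↔ Relation.ReflTransGen (ItemStep w dec) c i := by
  rw [closeItems, Prog.eval]
  have hA' := hA.eval (e := e) (P := .assign items (.rel cur 0 0 0)) (by simp [Prog.writes])
    (by simp [Prog.writes]) (by simp [Prog.writes])
  set S' := (Prog.assign items (Fm.rel cur 0 0 0)).eval w e S with hS'
  have h₀ : ∀ i < w.length, S' items i i i ↔ i ∈ stage (ItemStep w dec) c 0 := by
    intro i hi
    rw [hS', Prog.eval_assign]
    simp [Fm.Holds, hcur i hi, stage]
  clear_value S'
  have key := Prog.eval_loop_induction (w := w) (e := e) (v := 3) (S := S')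
    (P := .assign items (.or (.rel items 0 0 0) (.ex 9 (.and (.rel items 9 9 9)
    (.and (.bit 9) (.ex 10 (.and (.rel next 9 10 10) φ)))))))
    (fun t S => Arith w S ∧ ∀ i < w.length, S items i i i ↔ i ∈ stage (ItemStep w dec) c t)
    ⟨hA', h₀⟩ (by
      rintro t ht S ⟨hA, hS⟩
      refine ⟨hA.eval (by simp [Prog.writes]) (by simp [Prog.writes]) (by simp [Prog.writes]), ?_⟩
      intro i hi
      rw [Prog.eval_assign]
      simp only [Fm.Holds, update_apply, Fin.isValue, Fin.reduceEq, if_true, if_false]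
      rw [hS i hi, stage]
      refine or_congr Iff.rfl ⟨?_, ?_⟩
      · rintro ⟨a, ha, h₁, h₂, b, hb, h₃, h₄⟩
        rw [hA.next _ _ ha hb] at h₃
        rw [hφ _ _ hA (by simpa [update_apply] using hb) (by simpa [update_apply] using hi)] at h₄
        simp only [update_apply, Fin.isValue, Fin.reduceEq, if_true, if_false] at h₄
        subst h₃
        exact ⟨a, (hS a ha).1 h₁, h₂, h₄⟩
      · rintro ⟨a, h₁, h₂, x, h₃⟩
        have hlt := hdec _ _ _ h₃
        refine ⟨a, by omega, (hS a (by omega)).2 h₁, h₂, a + 1, by omega,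
          (hA.next _ _ (by omega) (by omega)).2 rfl, ?_⟩
        rw [hφ _ _ hA (by simpa [update_apply] using (by omega)) (by simpa [update_apply] using hi)]
        exact ⟨x, by simpa [update_apply] using h₃⟩)
  rw [key.2 i hi, mem_stage_iff (Finset.range w.length) (by simpa using hc) _ (by simp)]
  rintro i - j ⟨_, x, hx⟩
  simpa using (hdec _ _ _ hx).2

/-- After the items of a list have been collected, moves `cur` to the end of the list. -/
def skipItems : Prog Tbl :=
  .assign cur (.ex 9 (.and (.rel items 9 9 9) (.and (.neg (.bit 9)) (.rel next 9 0 0))))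

theorem skipItems_spec {w : List Bool} {e : Var → ℕ} {S : RelStore Tbl} {I : ℕ → Prop} {c : ℕ}
    (hA : Arith w S) (hS : ∀ i < w.length, S items i i i ↔ I i)
    (hI : ∀ i, I i ∧ w[i]? ≠ some true ↔ i = c) (i : ℕ) (hi : i < w.length) : skipItems.eval w e S cur i i i ↔ i = c + 1 := by
  rw [skipItems, Prog.eval_assign]
  simp only [Fm.Holds, update_apply, Fin.isValue, Fin.reduceEq, if_true, if_false]
  constructor
  · rintro ⟨a, ha, h₁, h₂, h₃⟩
    rw [hA.next _ _ ha hi] at h₃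
    rw [h₃, (hI a).1 ⟨(hS a ha).1 h₁, h₂⟩]
  · rintro rfl
    have := (hI c).2 rfl
    exact ⟨c, by omega, (hS c (by omega)).2 this.1, this.2, (hA.next _ _ (by omega) hi).2 rfl⟩

/-- Reads an automaton whose code starts at the position `cur`, and moves `cur` to the end of the
code. -/
def parse (b : Bool) : Prog Tbl :=
  .seq (.assign (init b) (.ex 9 (.ex 10 (.ex 11 (.ex 12 (.and (.rel cur 9 9 9)
    (.and (.rel val 9 10 11) (.rel val 11 0 12))))))))
  (.seq (.assign cur (.ex 9 (.ex 10 (.ex 11 (.ex 12 (.and (.rel cur 9 9 9)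
    (.and (.rel val 9 10 11) (.rel val 11 12 0))))))))
  (.seq (closeItems (.ex 11 (.rel val 10 11 0)))
  (.seq (.assign (fin b) (.ex 9 (.and (.rel items 9 9 9) (.and (.bit 9)
    (.ex 10 (.and (.rel next 9 10 10) (.ex 11 (.rel val 10 0 11))))))))
  (.seq skipItems
  (.seq (closeItems (.ex 11 (.ex 12 (.and (.rel val 10 11 12) (.ex 13 (.ex 14
    (.and (.rel val 12 13 14) (.ex 15 (.rel val 14 15 0)))))))))
  (.seq (.assign (delta b) (.ex 9 (.and (.rel items 9 9 9) (.and (.bit 9)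
    (.ex 10 (.and (.rel next 9 10 10) (.ex 11 (.and (.rel val 10 0 11) (.ex 12
    (.and (.rel val 11 1 12) (.ex 13 (.rel val 12 2 13))))))))))))
  skipItems))))))

theorem _root_.Block.lt {w : List Bool} {i m j : ℕ} (h : Block w i m j) : i < j ∧ m < j := by
  have := h.1
  omega

/-- The number `x` in unary, followed by something. -/
def UnaryItem (w : List Bool) (i x j : ℕ) : Prop := Block w i x j ∧ j < w.length

/-- Three numbers in unary, followed by something. -/
def TripleItem (w : List Bool) (i : ℕ) (x : ℕ × ℕ × ℕ) (j : ℕ) : Prop :=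
  ∃ i₁ i₂, Block w i x.1 i₁ ∧ Block w i₁ x.2.1 i₂ ∧ Block w i₂ x.2.2 j ∧ j < w.length

theorem unaryItem_iff {w : List Bool} (x : ℕ) (pre post : List Bool) (hp : post ≠ [])
    (hw : w = pre ++ (unaryCode x ++ post)) (y j : ℕ) :
    UnaryItem w pre.length y j ↔ y = x ∧ j = pre.length + (unaryCode x).length := by
  rw [UnaryItem, block_iff hw, and_iff_left_iff_imp]
  rintro ⟨rfl, rfl⟩
  have := List.length_pos_iff.2 hp
  simp only [hw, List.length_append]
  omega

theorem tripleItem_iff {w : List Bool} (x : ℕ × ℕ × ℕ) (pre post : List Bool) (hp : post ≠ [])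
    (hw : w = pre ++ (FinNFA.tripleCode x ++ post)) (y : ℕ × ℕ × ℕ) (j : ℕ) :
    TripleItem w pre.length y j ↔ y = x ∧ j = pre.length + (FinNFA.tripleCode x).length := by
  obtain ⟨x₁, x₂, x₃⟩ := x
  obtain ⟨y₁, y₂, y₃⟩ := y
  simp only [FinNFA.tripleCode] at hw ⊢
  have h₁ := block_iff (w := w) (pre := pre) (m := x₁) (post := unaryCode x₂ ++ unaryCode x₃ ++ post)
    (by simp [hw])
  have h₂ := block_iff (w := w) (pre := pre ++ unaryCode x₁) (m := x₂)
    (post := unaryCode x₃ ++ post) (by simp [hw])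
  have h₃ := block_iff (w := w) (pre := pre ++ unaryCode x₁ ++ unaryCode x₂) (m := x₃)
    (post := post) (by simp [hw])
  have hlen : w.length = pre.length + (unaryCode x₁).length + (unaryCode x₂).length +
    (unaryCode x₃).length + post.length := by simp [hw]; omega
  have := List.length_pos_iff.2 hp
  simp only [List.length_append] at h₁ h₂ h₃ ⊢
  simp only [TripleItem, Prod.mk.injEq]
  constructor
  · rintro ⟨i₁, i₂, h₄, h₅, h₆, h₇⟩
    obtain ⟨rfl, rfl⟩ := (h₁ _ _).1 h₄
    obtain ⟨rfl, rfl⟩ := (h₂ _ _).1 h₅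
    obtain ⟨rfl, rfl⟩ := (h₃ _ _).1 h₆
    exact ⟨⟨rfl, rfl, rfl⟩, by omega⟩
  · rintro ⟨⟨rfl, rfl, rfl⟩, rfl⟩
    exact ⟨_, _, (h₁ _ _).2 ⟨rfl, rfl⟩, (h₂ _ _).2 ⟨rfl, rfl⟩, (h₃ _ _).2 ⟨rfl, by omega⟩, by omega⟩

/-- The proof follows the eight programs of `parse`. For each of them, facts `f` record the
unchanged tables and facts `A` the survival of the arithmetic; `c` locates the cursor, `t` describes
the collected items, and `i` the tables read off. The number of states is skipped and not stored:
the pattern search needs only the initial and accepting states and the transitions. -/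
theorem parse_spec {k : ℕ} {A : FinNFA k} {w pre post : List Bool} {b : Bool} {e : Var → ℕ}
    {S : RelStore Tbl} (hw : w = pre ++ (A.code ++ post)) (hA : Arith w S)
    (hcur : ∀ i < w.length, S cur i i i ↔ i = pre.length) :
    (∀ i < w.length, (parse b).eval w e S (init b) i i i ↔ i = A.init) ∧
    (∀ i < w.length, (parse b).eval w e S (fin b) i i i ↔ ∃ q ∈ A.final, (q : ℕ) = i) ∧
    (∀ i < w.length, ∀ a < w.length, ∀ j < w.length, (parse b).eval w e S (delta b) i a j ↔
      mapRel Fin.val Fin.val (fun p a q => q ∈ A.delta p a) i a j) ∧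
    ∀ i < w.length, (parse b).eval w e S cur i i i ↔ i = pre.length + A.code.length := by
  have hw₀ : w = pre ++ (unaryCode A.numStates ++ (unaryCode A.init ++ A.finalCode ++ A.deltaCode
    ++ post)) := by simp [hw, FinNFA.code]
  have hw₁ : w = (pre ++ unaryCode A.numStates) ++ (unaryCode A.init ++ (A.finalCode ++ A.deltaCode
    ++ post)) := by simp [hw, FinNFA.code]
  have hw₂ : w = (pre ++ unaryCode A.numStates ++ unaryCode A.init) ++
      (A.finalItems.flatMap (fun q => true :: unaryCode q) ++ false :: (A.deltaCode ++ post)) := by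
    simp [hw, FinNFA.code, FinNFA.finalCode_eq]
  have hw₃ : w = (pre ++ unaryCode A.numStates ++ unaryCode A.init ++ A.finalCode) ++
      (A.deltaItems.flatMap (fun x => true :: FinNFA.tripleCode x) ++ false :: post) := by
    simp [hw, FinNFA.code, FinNFA.deltaCode_eq]
  have h₀ := block_iff hw₀
  have h₁ := block_iff hw₁
  obtain ⟨h₂, h₂'⟩ := items_iff (dec := UnaryItem w) A.finalItems
    (fun x _ pre post hp hw => unaryItem_iff x pre post hp hw) _ hw₂
  obtain ⟨h₃, h₃'⟩ := items_iff (dec := TripleItem w) A.deltaItems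
    (fun x _ pre post hp hw => tripleItem_iff x pre post hp hw) _ hw₃
  -- Both lists contain at least their closing bit, so the positions just after the preceding
  -- numbers lie inside `w`.
  have hl₁ : 0 < A.finalCode.length := by simp [FinNFA.finalCode_eq]
  have hl₂ : 0 < A.deltaCode.length := by simp [FinNFA.deltaCode_eq]
  have hl₀ : A.code.length = (unaryCode A.numStates).length + (unaryCode A.init).length +
    A.finalCode.length + A.deltaCode.length := by simp [FinNFA.code]; omega
  have hl : w.length = pre.length + (unaryCode A.numStates).length + (unaryCode A.init).length +
    A.finalCode.length + A.deltaCode.length + post.length := by simp [hw, FinNFA.code]; omega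
  have hq : (unaryCode A.numStates).length = A.numStates + 1 := by simp [unaryCode]
  have hq' : (unaryCode A.init).length = A.init + 1 := by simp [unaryCode]
  simp only [parse, Prog.eval_seq]
  set S₁ := (Prog.assign (init b) _).eval w e S with hS₁
  have f₁ : ∀ r, r ≠ init b → S₁ r = S r := fun r hr =>
    Prog.eval_of_notMem_writes (by simpa [Prog.writes] using hr)
  have A₁ : Arith w S₁ := hA.eval (by simp [Prog.writes]) (by simp [Prog.writes])
    (by simp [Prog.writes])
  have i₁ : ∀ i < w.length, S₁ (init b) i i i ↔ i = A.init := by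
    intro i hi
    rw [hS₁, Prog.eval_assign]
    simp only [Fm.Holds, update_apply, Fin.isValue, Fin.reduceEq, if_true, if_false]
    constructor
    · rintro ⟨x, hx, y, hy, z, hz, u, hu, h₄, h₅, h₆⟩
      obtain rfl := (hcur x hx).1 h₄
      obtain ⟨-, rfl⟩ := (h₀ _ _).1 ((hA.val _ _ _ hx hy hz).1 h₅)
      rw [← List.length_append] at hz h₆
      exact ((h₁ _ _).1 ((hA.val _ _ _ hz hi hu).1 h₆)).1
    · rintro rfl
      refine ⟨pre.length, by omega, A.numStates, by omega, (pre ++ unaryCode A.numStates).length, ?_,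
        (pre ++ unaryCode A.numStates ++ unaryCode A.init).length, ?_, (hcur _ (by omega)).2 rfl,
        (hA.val _ _ _ (by omega) (by omega) ?_).2 ((h₀ _ _).2 ⟨rfl, by simp⟩),
        (hA.val _ _ _ ?_ (by omega) ?_).2 ((h₁ _ _).2 ⟨rfl, by simp only [List.length_append]⟩)⟩ <;>
      · simp only [List.length_append]
        omega
  clear_value S₁
  set S₂ := (Prog.assign cur _).eval w e S₁ with hS₂
  have f₂ : ∀ r, r ≠ cur → S₂ r = S₁ r := fun r hr =>
    Prog.eval_of_notMem_writes (by simpa [Prog.writes] using hr)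
  have A₂ : Arith w S₂ := A₁.eval (by simp [Prog.writes]) (by simp [Prog.writes])
    (by simp [Prog.writes])
  have c₂ : ∀ i < w.length, S₂ cur i i i ↔
      i = (pre ++ unaryCode A.numStates ++ unaryCode A.init).length := by
    intro i hi
    rw [hS₂, Prog.eval_assign]
    simp only [Fm.Holds, update_apply, Fin.isValue, Fin.reduceEq, if_true, if_false]
    rw [f₁ cur (by simp)]
    constructor
    · rintro ⟨x, hx, y, hy, z, hz, u, hu, h₄, h₅, h₆⟩
      obtain rfl := (hcur x hx).1 h₄
      obtain ⟨-, rfl⟩ := (h₀ _ _).1 ((A₁.val _ _ _ hx hy hz).1 h₅)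
      rw [← List.length_append] at hz h₆
      rw [((h₁ _ _).1 ((A₁.val _ _ _ hz hu hi).1 h₆)).2]
      simp only [List.length_append]
    · rintro rfl
      refine ⟨pre.length, by omega, A.numStates, by omega, (pre ++ unaryCode A.numStates).length, ?_,
        A.init, by omega, (hcur _ (by omega)).2 rfl,
        (A₁.val _ _ _ (by omega) (by omega) ?_).2 ((h₀ _ _).2 ⟨rfl, by simp⟩),
        (A₁.val _ _ _ ?_ (by omega) hi).2 ((h₁ _ _).2 ⟨rfl, by simp only [List.length_append]⟩)⟩ <;>
      · simp only [List.length_append]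
        omega
  clear_value S₂
  set S₃ := (closeItems _).eval w e S₂ with hS₃
  have f₃ : ∀ r, r ≠ items → S₃ r = S₂ r := fun r hr =>
    Prog.eval_of_notMem_writes (by simpa [Prog.writes, closeItems] using hr)
  have A₃ : Arith w S₃ := A₂.eval (by simp [Prog.writes, closeItems])
    (by simp [Prog.writes, closeItems]) (by simp [Prog.writes, closeItems])
  have t₃ := closeItems_spec (e := e) (φ := .ex 11 (.rel val 10 11 0)) (dec := UnaryItem w) A₂
    (by simp only [List.length_append]; omega) c₂ (fun i x j h => ⟨h.1.lt.1, h.2⟩)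
    (by
      intro e S hA h₁₀ h₀
      simp only [Fm.Holds, update_apply, Fin.isValue, Fin.reduceEq, if_true, if_false]
      constructor
      · rintro ⟨x, hx, h⟩
        exact ⟨x, (hA.val _ _ _ h₁₀ hx h₀).1 h, h₀⟩
      · rintro ⟨x, h, -⟩
        have hx : x < w.length := h.lt.2.trans h₀
        exact ⟨x, hx, (hA.val _ _ _ h₁₀ hx h₀).2 h⟩)
  rw [← hS₃] at t₃
  clear_value S₃
  set S₄ := (Prog.assign (fin b) _).eval w e S₃ with hS₄
  have f₄ : ∀ r, r ≠ fin b → S₄ r = S₃ r := fun r hr =>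
    Prog.eval_of_notMem_writes (by simpa [Prog.writes] using hr)
  have A₄ : Arith w S₄ := A₃.eval (by simp [Prog.writes]) (by simp [Prog.writes])
    (by simp [Prog.writes])
  have i₄ : ∀ i < w.length, S₄ (fin b) i i i ↔ ∃ q ∈ A.final, (q : ℕ) = i := by
    intro i hi
    rw [hS₄, Prog.eval_assign, ← A.mem_finalItems, ← h₂]
    simp only [Fm.Holds, update_apply, Fin.isValue, Fin.reduceEq, if_true, if_false]
    constructor
    · rintro ⟨x, hx, h₄, h₅, y, hy, h₆, z, hz, h₇⟩
      obtain rfl := (A₃.next _ _ hx hy).1 h₆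
      exact ⟨x, (t₃ x hx).1 h₄, h₅, z, (A₃.val _ _ _ hy hi hz).1 h₇, hz⟩
    · rintro ⟨x, h₄, h₅, z, h₆, hz⟩
      have := h₆.lt
      exact ⟨x, by omega, (t₃ x (by omega)).2 h₄, h₅, x + 1, by omega,
        (A₃.next _ _ (by omega) (by omega)).2 rfl, z, hz,
        (A₃.val _ _ _ (by omega) (by omega) hz).2 h₆⟩
  clear_value S₄
  set S₅ := skipItems.eval w e S₄ with hS₅
  have f₅ : ∀ r, r ≠ cur → S₅ r = S₄ r := fun r hr =>
    Prog.eval_of_notMem_writes (by simpa [Prog.writes, skipItems] using hr)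
  have A₅ : Arith w S₅ := A₄.eval (by simp [Prog.writes, skipItems])
    (by simp [Prog.writes, skipItems]) (by simp [Prog.writes, skipItems])
  have c₅ : ∀ i < w.length, S₅ cur i i i ↔
      i = (pre ++ unaryCode A.numStates ++ unaryCode A.init ++ A.finalCode).length := by
    intro i hi
    rw [hS₅, skipItems_spec A₄ (by rwa [f₄ _ (by simp)]) h₂' i hi]
    simp only [List.length_append, FinNFA.finalCode_eq, List.length_singleton]
    omega
  clear_value S₅
  set S₆ := (closeItems _).eval w e S₅ with hS₆
  have f₆ : ∀ r, r ≠ items → S₆ r = S₅ r := fun r hr =>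
    Prog.eval_of_notMem_writes (by simpa [Prog.writes, closeItems] using hr)
  have A₆ : Arith w S₆ := A₅.eval (by simp [Prog.writes, closeItems])
    (by simp [Prog.writes, closeItems]) (by simp [Prog.writes, closeItems])
  have t₆ := closeItems_spec (e := e) (φ := .ex 11 (.ex 12 (.and (.rel val 10 11 12) (.ex 13 (.ex 14
    (.and (.rel val 12 13 14) (.ex 15 (.rel val 14 15 0)))))))) (dec := TripleItem w) A₅
    (by simp only [List.length_append]; omega) c₅
    (fun i x j ⟨i₁, i₂, h₁, h₂, h₃, h₄⟩ => ⟨h₁.lt.1.trans (h₂.lt.1.trans h₃.lt.1), h₄⟩)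
    (by
      intro e S hA h₁₀ h₀
      simp only [Fm.Holds, update_apply, Fin.isValue, Fin.reduceEq, if_true, if_false]
      constructor
      · rintro ⟨x, hx, i₁, hi₁, h₁, y, hy, i₂, hi₂, h₂, z, hz, h₃⟩
        exact ⟨(x, y, z), i₁, i₂, (hA.val _ _ _ h₁₀ hx hi₁).1 h₁, (hA.val _ _ _ hi₁ hy hi₂).1 h₂,
          (hA.val _ _ _ hi₂ hz h₀).1 h₃, h₀⟩
      · rintro ⟨⟨x, y, z⟩, i₁, i₂, h₁, h₂, h₃, -⟩
        have l₁ := h₁.lt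
        have l₂ := h₂.lt
        have l₃ := h₃.lt
        dsimp only at l₁ l₂ l₃
        exact ⟨x, by omega, i₁, by omega, (hA.val _ _ _ h₁₀ (by omega) (by omega)).2 h₁, y,
          by omega, i₂, by omega, (hA.val _ _ _ (by omega) (by omega) (by omega)).2 h₂, z, by omega,
          (hA.val _ _ _ (by omega) (by omega) h₀).2 h₃⟩)
  rw [← hS₆] at t₆
  clear_value S₆
  set S₇ := (Prog.assign (delta b) _).eval w e S₆ with hS₇
  have f₇ : ∀ r, r ≠ delta b → S₇ r = S₆ r := fun r hr =>
    Prog.eval_of_notMem_writes (by simpa [Prog.writes] using hr)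
  have A₇ : Arith w S₇ := A₆.eval (by simp [Prog.writes]) (by simp [Prog.writes])
    (by simp [Prog.writes])
  have i₇ : ∀ i < w.length, ∀ a < w.length, ∀ j < w.length, S₇ (delta b) i a j ↔
      mapRel Fin.val Fin.val (fun p a q => q ∈ A.delta p a) i a j := by
    intro i hi a ha j hj
    rw [hS₇, Prog.eval_assign, ← A.mem_deltaItems, ← h₃]
    simp only [Fm.Holds, update_apply, Fin.isValue, Fin.reduceEq, if_true, if_false]
    constructor
    · rintro ⟨x, hx, h₄, h₅, y, hy, h₆, i₁, hi₁, h₇, i₂, hi₂, h₈, i₃, hi₃, h₉⟩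
      obtain rfl := (A₆.next _ _ hx hy).1 h₆
      exact ⟨x, (t₆ x hx).1 h₄, h₅, i₃, i₁, i₂, (A₆.val _ _ _ hy hi hi₁).1 h₇,
        (A₆.val _ _ _ hi₁ ha hi₂).1 h₈, (A₆.val _ _ _ hi₂ hj hi₃).1 h₉, hi₃⟩
    · rintro ⟨x, h₄, h₅, i₃, i₁, i₂, h₆, h₇, h₈, hi₃⟩
      have l₁ := h₆.lt
      have l₂ := h₇.lt
      have l₃ := h₈.lt
      exact ⟨x, by omega, (t₆ x (by omega)).2 h₄, h₅, x + 1, by omega,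
        (A₆.next _ _ (by omega) (by omega)).2 rfl, i₁, by omega,
        (A₆.val _ _ _ (by omega) hi (by omega)).2 h₆, i₂, by omega,
        (A₆.val _ _ _ (by omega) ha (by omega)).2 h₇, i₃, hi₃,
        (A₆.val _ _ _ (by omega) hj hi₃).2 h₈⟩
  clear_value S₇
  set S₈ := skipItems.eval w e S₇ with hS₈
  have f₈ : ∀ r, r ≠ cur → S₈ r = S₇ r := fun r hr =>
    Prog.eval_of_notMem_writes (by simpa [Prog.writes, skipItems] using hr)
  refine ⟨?_, ?_, ?_, ?_⟩
  · rwa [f₈ _ (by simp), f₇ _ (by simp), f₆ _ (by simp), f₅ _ (by simp), f₄ _ (by simp),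
      f₃ _ (by simp), f₂ _ (by simp)]
  · rwa [f₈ _ (by simp), f₇ _ (by simp), f₆ _ (by simp), f₅ _ (by simp)]
  · rwa [f₈ _ (by simp)]
  · intro i hi
    rw [hS₈, skipItems_spec A₇ (by rwa [f₇ _ (by simp)]) h₃' i hi, hl₀]
    simp only [List.length_append, FinNFA.deltaCode_eq, List.length_singleton]
    omega

end Tbl

theorem exists_mem_stage_of_mem_stage_add {α : Type*} {step : α → α → Prop} {a b : α} {s t : ℕ}
    (h : b ∈ stage step a (s + t)) : ∃ c ∈ stage step a s, b ∈ stage step c t := by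
  induction t generalizing b with
  | zero => exact ⟨b, h, rfl⟩
  | succ t ih =>
    rcases h with h | ⟨c, hc, h⟩
    · obtain ⟨d, hd, h⟩ := ih h
      exact ⟨d, hd, Or.inl h⟩
    · obtain ⟨d, hd, hc⟩ := ih hc
      exact ⟨d, hd, Or.inr ⟨c, hc, h⟩⟩

theorem Within.mono {Q α : Type*} {D : Q → α → Q → Prop} {C C' : Set α} (hC : C ⊆ C') {p q : Q}
    (h : Within D C p q) : Within D C' p q :=
  Relation.ReflTransGen.mono (fun _ _ ⟨a, ha, hD⟩ => ⟨a, hC ha, hD⟩) _ _ h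

/-! ### Reachability, largest saturated sets of letters, and the search for patterns. -/

namespace Tbl

/-- The transition tables in `S` describe the transition relations `D`. -/
structure Model (w : List Bool) (D : Bool → ℕ → ℕ → ℕ → Prop) (S : RelStore Tbl) : Prop where
  eqv : ∀ i j, S eqv i j j ↔ i = j
  delta : ∀ b, ∀ p < w.length, ∀ a < w.length, ∀ q < w.length, S (delta b) p a q ↔ D b p a q
  lt : ∀ b p a q, D b p a q → p < w.length ∧ a < w.length ∧ q < w.length

variable {w : List Bool} {D : Bool → ℕ → ℕ → ℕ → Prop} {e : Var → ℕ} {S : RelStore Tbl}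

theorem Model.eval (h : Model w D S) {P : Prog Tbl} (h₁ : Tbl.eqv ∉ P.writes)
    (h₂ : ∀ b, Tbl.delta b ∉ P.writes) : Model w D (P.eval w e S) := by
  constructor
  · rw [Prog.eval_of_notMem_writes h₁]; exact h.eqv
  · intro b; rw [Prog.eval_of_notMem_writes (h₂ b)]; exact h.delta b
  · exact h.lt

theorem Model.within_lt (h : Model w D S) {b : Bool} {C : Set ℕ} {p q : ℕ} (hp : p < w.length)
    (hw : Within (D b) C p q) : q < w.length := by
  induction hw with
  | refl => exact hp
  | tail _ h' _ =>
    obtain ⟨a, _, ha⟩ := h'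
    exact (h.lt _ _ _ _ ha).2.2

/-- Computes reachability by paths with labels in `letters`. -/
def closeWithin (b : Bool) : Prog Tbl :=
  .seq (.assign (within b) (.rel eqv 0 1 1))
  (.loop 8 (.assign (within b) (.or (.rel (within b) 0 1 1) (.ex 9 (.ex 10
    (.and (.rel (within b) 0 9 9) (.and (.rel letters 10 10 10) (.rel (delta b) 9 10 1))))))))

theorem closeWithin_spec (hM : Model w D S) (b : Bool) {C : Set ℕ}
    (hC : ∀ a < w.length, S letters a a a ↔ a ∈ C) (i : ℕ) (hi : i < w.length) (j : ℕ)
    (hj : j < w.length) : (closeWithin b).eval w e S (within b) i j j ↔ Within (D b) C i j := by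
  rw [closeWithin, Prog.eval_seq]
  have key := Prog.eval_loop_induction (w := w) (e := e) (v := 8)
    (S := (Prog.assign (within b) (Fm.rel eqv 0 1 1)).eval w e S)
    (P := .assign (within b) (.or (.rel (within b) 0 1 1) (.ex 9 (.ex 10
      (.and (.rel (within b) 0 9 9) (.and (.rel letters 10 10 10) (.rel (delta b) 9 10 1)))))))
    (fun t S' => S' letters = S letters ∧ S' (delta b) = S (delta b) ∧
      ∀ i < w.length, ∀ j < w.length, S' (within b) i j j ↔
        j ∈ stage (fun s t => ∃ a ∈ C, D b s a t) i t)
    ⟨Prog.eval_of_notMem_writes (by simp [Prog.writes]),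
      Prog.eval_of_notMem_writes (by simp [Prog.writes]), fun i _ j _ => by
        rw [Prog.eval_assign]
        simp [Fm.Holds, hM.eqv, stage, eq_comm]⟩ (by
      rintro t ht S' ⟨h₁, h₂, h₃⟩
      refine ⟨h₁ ▸ Prog.eval_of_notMem_writes (by simp [Prog.writes]),
        h₂ ▸ Prog.eval_of_notMem_writes (by simp [Prog.writes]), fun i hi j hj => ?_⟩
      rw [Prog.eval_assign]
      simp only [Fm.Holds, update_apply, Fin.isValue, Fin.reduceEq, if_true, if_false]
      rw [h₁, h₂, h₃ i hi j hj, stage]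
      refine or_congr Iff.rfl ⟨?_, ?_⟩
      · rintro ⟨q, hq, a, ha, h₄, h₅, h₆⟩
        exact ⟨q, (h₃ i hi q hq).1 h₄, a, (hC a ha).1 h₅, (hM.delta b q hq a ha j hj).1 h₆⟩
      · rintro ⟨q, h₄, a, h₅, h₆⟩
        obtain ⟨hq, ha, -⟩ := hM.lt _ _ _ _ h₆
        exact ⟨q, hq, a, ha, (h₃ i hi q hq).2 h₄, (hC a ha).2 h₅,
          (hM.delta b q hq a ha j hj).2 h₆⟩)
  rw [key.2.2 i hi j hj, mem_stage_iff (Finset.range w.length) (by simpa using hi) _ (by simp)]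
  · rfl
  · rintro i - j ⟨a, _, h⟩
    simpa using (hM.lt _ _ _ _ h).2.2

/-- Computes reachability in both automata by paths with labels in `letters`. -/
def closures : Prog Tbl := .seq (closeWithin false) (closeWithin true)

theorem closures_spec (hM : Model w D S) {C : Set ℕ}
    (hC : ∀ a < w.length, S letters a a a ↔ a ∈ C) :
    Model w D (closures.eval w e S) ∧ closures.eval w e S letters = S letters ∧
    closures.eval w e S Tbl.main = S Tbl.main ∧
    ∀ b, ∀ i < w.length, ∀ j < w.length, closures.eval w e S (within b) i j j ↔
      Within (D b) C i j := by
  have hM' : Model w D ((closeWithin false).eval w e S) :=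
    hM.eval (by simp [Prog.writes, closeWithin]) (by simp [Prog.writes, closeWithin])
  have hl : (closeWithin false).eval w e S letters = S letters :=
    Prog.eval_of_notMem_writes (by simp [Prog.writes, closeWithin])
  refine ⟨hM.eval (by simp [Prog.writes, closures, closeWithin])
    (by simp [Prog.writes, closures, closeWithin]),
    Prog.eval_of_notMem_writes (by simp [Prog.writes, closures, closeWithin]),
    Prog.eval_of_notMem_writes (by simp [Prog.writes, closures, closeWithin]), ?_⟩
  rintro (_ | _) i hi j hj
  · rw [closures, Prog.eval_seq, Prog.eval_of_notMem_writes (by simp [Prog.writes, closeWithin])]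
    exact closeWithin_spec hM false hC i hi j hj
  · exact closeWithin_spec hM' true (by rwa [hl]) i hi j hj

/-- The letters of `C` that occur in both automata on a closed path with labels in `C` at the given
states. -/
def shrink (D : Bool → ℕ → ℕ → ℕ → Prop) (r : Bool → ℕ) (C : Set ℕ) : Set ℕ :=
  {a | a ∈ C ∧ ∀ b, ∃ s t, Within (D b) C (r b) s ∧ D b s a t ∧ Within (D b) C t (r b)}

/-- The largest set of letters that is saturated in both automata at the given states. -/
def largest (w : List Bool) (D : Bool → ℕ → ℕ → ℕ → Prop) (r : Bool → ℕ) : Set ℕ :=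
  (shrink D r)^[w.length] {a | a < w.length}

/-- The iteration has become stationary after `w.length` rounds, and being a fixed point of `shrink`
is saturation in both automata. -/
theorem saturated_largest (r : Bool → ℕ) (b : Bool) : Saturated (D b) (largest w D r) (r b) := by
  intro a ha
  have h := iterate_fixed_of_shrinking (f := shrink D r) (fun _ _ h => h.1)
    (Finset.range w.length) (N := w.length) (by simp) (C := {a | a < w.length})
    (by intro a ha; simpa using ha)
  rw [largest, ← h] at ha
  exact ha.2 b

/-- A jointly saturated set never loses a letter: its closed paths remain available as long as the
current set contains it. -/
theorem Model.subset_largest (hM : Model w D S) {r : Bool → ℕ} {C : Set ℕ}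
    (hC : ∀ b, Saturated (D b) C (r b)) : C ⊆ largest w D r := by
  have : ∀ t, C ⊆ (shrink D r)^[t] {a | a < w.length} := by
    intro t
    induction t with
    | zero =>
      intro a ha
      obtain ⟨s, t, _, h, _⟩ := hC false a ha
      exact (hM.lt _ _ _ _ h).2.1
    | succ t ih =>
      rw [iterate_succ_apply']
      intro a ha
      refine ⟨ih ha, fun b => ?_⟩
      obtain ⟨s, t, h₁, h₂, h₃⟩ := hC b a ha
      exact ⟨s, t, h₁.mono ih, h₂, h₃.mono ih⟩
  exact this _

/-- The variable `0` is a letter on a closed path with labels in `letters` at the state `v`. -/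
def onLoop (b : Bool) (v : Var) : Fm Tbl :=
  .ex 9 (.ex 10 (.and (.rel (within b) v 9 9) (.and (.rel (delta b) 9 0 10)
    (.rel (within b) 10 v v))))

/-- The bounds on `v` keep it apart from the tuple variables `0`, `1`, `2` and from the bound
variables `9`, `10`. -/
theorem onLoop_iff (hM : Model w D S) {b : Bool} {v : Var} (hv : 3 ≤ v) (hv' : v < 9) {C : Set ℕ}
    (hC : ∀ i < w.length, ∀ j < w.length, S (within b) i j j ↔ Within (D b) C i j) {a i j : ℕ}
    (ha : a < w.length) (he : e v < w.length) :
    (onLoop b v).Holds w S (update (update (update e 0 a) 1 i) 2 j) ↔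
      ∃ s t, Within (D b) C (e v) s ∧ D b s a t ∧ Within (D b) C t (e v) := by
  have h₀ : v ≠ 0 := by rintro rfl; exact absurd hv (by decide)
  have h₁ : v ≠ 1 := by rintro rfl; exact absurd hv (by decide)
  have h₂ : v ≠ 2 := by rintro rfl; exact absurd hv (by decide)
  have h₉ : v ≠ 9 := by rintro rfl; exact absurd hv' (by decide)
  have h₁₀ : v ≠ 10 := by rintro rfl; exact absurd hv' (by decide)
  simp only [onLoop, Fm.Holds, update_apply, Fin.isValue, Fin.reduceEq, if_true, if_false, h₀, h₁,
    h₂, h₉, h₁₀]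
  constructor
  · rintro ⟨s, hs, t, ht, h₃, h₄, h₅⟩
    exact ⟨s, t, (hC _ he _ hs).1 h₃, (hM.delta _ _ hs _ ha _ ht).1 h₄, (hC _ ht _ he).1 h₅⟩
  · rintro ⟨s, t, h₃, h₄, h₅⟩
    obtain ⟨hs, -, ht⟩ := hM.lt _ _ _ _ h₄
    exact ⟨s, hs, t, ht, (hC _ he _ hs).2 h₃, (hM.delta _ _ hs _ ha _ ht).2 h₄,
      (hC _ ht _ he).2 h₅⟩

/-- Computes the largest set of letters that is saturated in both automata at the states `5` and
`6`, and reachability by paths with labels in this set. -/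
def saturate : Prog Tbl :=
  .seq (.assign letters (.rel eqv 0 0 0))
  (.seq (.loop 7 (.seq closures
    (.assign letters (.and (.rel letters 0 0 0) (.and (onLoop false 5) (onLoop true 6))))))
  closures)

/-- Reachability depends on the current letters, so it is recomputed before each shrinking and once
more for the final set. -/
theorem saturate_spec (hM : Model w D S) {r : Bool → ℕ} (h₅ : e 5 = r false) (h₆ : e 6 = r true)
    (hr : ∀ b, r b < w.length) :
    Model w D (saturate.eval w e S) ∧ saturate.eval w e S main = S main ∧
    ∀ b, ∀ i < w.length, ∀ j < w.length, saturate.eval w e S (within b) i j j ↔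
      Within (D b) (largest w D r) i j := by
  rw [saturate, Prog.eval_seq, Prog.eval_seq]
  have key := Prog.eval_loop_induction (w := w) (e := e) (v := 7)
    (S := (Prog.assign letters (Fm.rel eqv 0 0 0)).eval w e S) (P := .seq closures
      (.assign letters (.and (.rel letters 0 0 0) (.and (onLoop false 5) (onLoop true 6)))))
    (fun t S' => Model w D S' ∧ S' main = S main ∧
      ∀ a < w.length, S' letters a a a ↔ a ∈ (shrink D r)^[t] {a | a < w.length})
    ⟨hM.eval (by simp [Prog.writes]) (by simp [Prog.writes]),
      Prog.eval_of_notMem_writes (by simp [Prog.writes]), fun a ha => by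
        rw [Prog.eval_assign]
        simp [Fm.Holds, hM.eqv, ha]⟩ (by
      rintro t ht S' ⟨hM', hm, hl⟩
      obtain ⟨k₁, k₂, k₃, k₄⟩ := closures_spec (e := update e 7 t) hM' hl
      rw [Prog.eval_seq]
      refine ⟨k₁.eval (by simp [Prog.writes]) (by simp [Prog.writes]),
        (Prog.eval_of_notMem_writes (by simp [Prog.writes])).trans (k₃.trans hm), fun a ha => ?_⟩
      rw [Prog.eval_assign, iterate_succ_apply', shrink]
      rw [Fm.Holds, Fm.Holds, Fm.Holds, onLoop_iff k₁ (by decide) (by decide) (k₄ false) ha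
        (by simpa [update_apply, h₅] using hr false), onLoop_iff k₁ (by decide) (by decide)
        (k₄ true) ha (by simpa [update_apply, h₆] using hr true)]
      simp only [update_apply, Fin.isValue, Fin.reduceEq, if_true, if_false, k₂, hl a ha, h₅, h₆,
        Set.mem_ofPred_eq, Bool.forall_bool])
  obtain ⟨k₁, k₂, k₃, k₄⟩ := closures_spec (e := e) key.1 key.2.2
  exact ⟨k₁, k₃.trans key.2.1, k₄⟩

/-- The pairs of states in the table `main`. -/
def pairs (w : List Bool) (S : RelStore Tbl) : Set (ℕ × ℕ) :=
  {x | x.1 < w.length ∧ x.2 < w.length ∧ S main x.1 x.2 x.2}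

/-- The program `P` adds to the table `main` all pairs related by `T` to a pair in the table, and
adds only pairs that are reachable by pattern steps. -/
def Extends (w : List Bool) (D : Bool → ℕ → ℕ → ℕ → Prop) (P : Prog Tbl) (e : Var → ℕ)
    (T : ℕ × ℕ → ℕ × ℕ → Prop) : Prop :=
  ∀ S, Model w D S → Model w D (P.eval w e S) ∧
    (∀ x ∈ pairs w S, ∀ y, T x y → y ∈ pairs w (P.eval w e S)) ∧
    ∀ y ∈ pairs w (P.eval w e S), ∃ x ∈ pairs w S,
      Relation.ReflTransGen (PatternStep (D false) (D true)) x y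

theorem Extends.mono {P : Prog Tbl} {T T' : ℕ × ℕ → ℕ × ℕ → Prop} (h : Extends w D P e T)
    (hT : ∀ x y, x.1 < w.length → x.2 < w.length → T' x y → T x y) : Extends w D P e T' :=
  fun S hM => ⟨(h S hM).1, fun x hx y hy => (h S hM).2.1 x hx y (hT x y hx.1 hx.2.1 hy),
    (h S hM).2.2⟩

theorem Extends.seq {P P' : Prog Tbl} {T T' : ℕ × ℕ → ℕ × ℕ → Prop} (h : Extends w D P e T)
    (h' : Extends w D P' e T') : Extends w D (.seq P P') e fun x y => ∃ z, T x z ∧ T' z y := by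
  intro S hM
  obtain ⟨h₁, h₂, h₃⟩ := h S hM
  obtain ⟨h₄, h₅, h₆⟩ := h' _ h₁
  refine ⟨h₄, fun x hx y ⟨z, hz, hy⟩ => h₅ z (h₂ x hx z hz) y hy, fun y hy => ?_⟩
  obtain ⟨z, hz, hzy⟩ := h₆ y hy
  obtain ⟨x, hx, hxz⟩ := h₃ z hz
  exact ⟨x, hx, hxz.trans hzy⟩

/-- `main` is enlarged in place, so a loop may add pairs that need several pattern steps. `Extends`
therefore bounds the additions from below by `T` and from above by reachability only, and these
bounds compose. -/
theorem Extends.loop {P : Prog Tbl} {v : Var} (T : ℕ → ℕ × ℕ → ℕ × ℕ → Prop)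
    (R : ℕ → ℕ × ℕ → ℕ × ℕ → Prop) (h : ∀ i < w.length, Extends w D P (update e v i) (R i))
    (h₀ : ∀ x y, T 0 x y → x = y) (hT : ∀ i x y, T (i + 1) x y → ∃ z, T i x z ∧ R i z y) :
    Extends w D (.loop v P) e (T w.length) := by
  intro S hM
  refine Prog.eval_loop_induction (fun t S' => Model w D S' ∧
    (∀ x ∈ pairs w S, ∀ y, T t x y → y ∈ pairs w S') ∧ ∀ y ∈ pairs w S', ∃ x ∈ pairs w S,
      Relation.ReflTransGen (PatternStep (D false) (D true)) x y)
    ⟨hM, fun x hx y hy => h₀ x y hy ▸ hx, fun y hy => ⟨y, hy, .refl⟩⟩ ?_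
  rintro i hi S' ⟨h₁, h₂, h₃⟩
  obtain ⟨h₄, h₅, h₆⟩ := h i hi S' h₁
  refine ⟨h₄, fun x hx y hy => ?_, fun y hy => ?_⟩
  · obtain ⟨z, hz, hy⟩ := hT i x y hy
    exact h₅ z (h₂ x hx z hz) y hy
  · obtain ⟨z, hz, hzy⟩ := h₆ y hy
    obtain ⟨x, hx, hxz⟩ := h₃ z hz
    exact ⟨x, hx, hxz.trans hzy⟩

/-- Adds the pairs that are reachable by reading a letter. -/
def letterStep : Prog Tbl :=
  .assign main (.or (.rel main 0 1 1) (.ex 9 (.ex 10 (.and (.rel main 9 10 10)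
    (.ex 11 (.and (.rel (delta false) 9 11 0) (.rel (delta true) 10 11 1)))))))

theorem extends_letterStep : Extends w D letterStep e fun x y =>
    x = y ∨ ∃ a, D false x.1 a y.1 ∧ D true x.2 a y.2 := by
  intro S hM
  have key : ∀ i < w.length, ∀ j < w.length, letterStep.eval w e S main i j j ↔ S main i j j ∨
      ∃ p q, (p, q) ∈ pairs w S ∧ ∃ a, D false p a i ∧ D true q a j := by
    intro i hi j hj
    rw [letterStep, Prog.eval_assign]
    simp only [Fm.Holds, update_apply, Fin.isValue, Fin.reduceEq, if_true, if_false]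
    refine or_congr Iff.rfl ⟨?_, ?_⟩
    · rintro ⟨p, hp, q, hq, h₁, a, ha, h₂, h₃⟩
      exact ⟨p, q, ⟨hp, hq, h₁⟩, a, (hM.delta _ _ hp _ ha _ hi).1 h₂,
        (hM.delta _ _ hq _ ha _ hj).1 h₃⟩
    · rintro ⟨p, q, ⟨hp, hq, h₁⟩, a, h₂, h₃⟩
      have ha := (hM.lt _ _ _ _ h₂).2.1
      exact ⟨p, hp, q, hq, h₁, a, ha, (hM.delta _ _ hp _ ha _ hi).2 h₂,
        (hM.delta _ _ hq _ ha _ hj).2 h₃⟩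
  refine ⟨hM.eval (by simp [Prog.writes, letterStep]) (by simp [Prog.writes, letterStep]), ?_, ?_⟩
  · rintro ⟨p, q⟩ hx ⟨i, j⟩ (h | ⟨a, h₁, h₂⟩)
    · obtain ⟨rfl, rfl⟩ := Prod.mk.inj h
      exact ⟨hx.1, hx.2.1, (key _ hx.1 _ hx.2.1).2 (Or.inl hx.2.2)⟩
    · have hi := (hM.lt _ _ _ _ h₁).2.2
      have hj := (hM.lt _ _ _ _ h₂).2.2
      exact ⟨hi, hj, (key _ hi _ hj).2 (Or.inr ⟨p, q, hx, a, h₁, h₂⟩)⟩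
  · rintro ⟨i, j⟩ ⟨hi, hj, hy⟩
    rcases (key _ hi _ hj).1 hy with h | ⟨p, q, hx, a, h₁, h₂⟩
    · exact ⟨(i, j), ⟨hi, hj, h⟩, .refl⟩
    · exact ⟨(p, q), hx, .single (.letter a h₁ h₂)⟩

/-- Adds the pairs that are reachable by a synchronized closed path at the states `5` and `6`. -/
def blockStep : Prog Tbl :=
  .seq saturate (.assign main (.or (.rel main 0 1 1) (.ex 9 (.ex 10 (.and (.rel main 9 10 10)
    (.and (.rel (within false) 9 5 5) (.and (.rel (within false) 5 0 0)
    (.and (.rel (within true) 10 6 6) (.rel (within true) 6 1 1)))))))))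

/-- Both automata run through a closed path at the states `r` and `r'` with the same labels. -/
def BlockAt (D : Bool → ℕ → ℕ → ℕ → Prop) (r r' : ℕ) (x y : ℕ × ℕ) : Prop :=
  ∃ C, Saturated (D false) C r ∧ Saturated (D true) C r' ∧ Within (D false) C x.1 r ∧
    Within (D false) C r y.1 ∧ Within (D true) C x.2 r' ∧ Within (D true) C r' y.2

/-- The largest jointly saturated set is itself an admissible label set, which gives soundness;
every other admissible set is contained in it and `Within` is monotone in the letters, which gives
completeness. -/
theorem extends_blockStep (h₅ : e 5 < w.length) (h₆ : e 6 < w.length) :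
    Extends w D blockStep e fun x y => x = y ∨ BlockAt D (e 5) (e 6) x y := by
  intro S hM
  obtain ⟨k₁, k₂, k₃⟩ := saturate_spec (r := fun b => bif b then e 6 else e 5) hM rfl rfl
    (by simpa [Bool.forall_bool] using ⟨h₅, h₆⟩)
  set r : Bool → ℕ := fun b => bif b then e 6 else e 5 with hr
  have key : ∀ i < w.length, ∀ j < w.length, blockStep.eval w e S main i j j ↔ S main i j j ∨
      ∃ p q, (p, q) ∈ pairs w S ∧ Within (D false) (largest w D r) p (e 5) ∧
        Within (D false) (largest w D r) (e 5) i ∧ Within (D true) (largest w D r) q (e 6) ∧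
        Within (D true) (largest w D r) (e 6) j := by
    intro i hi j hj
    rw [blockStep, Prog.eval_seq, Prog.eval_assign]
    simp only [Fm.Holds, update_apply, Fin.isValue, Fin.reduceEq, if_true, if_false]
    rw [k₂]
    refine or_congr Iff.rfl ⟨?_, ?_⟩
    · rintro ⟨p, hp, q, hq, h₁, h₂, h₃, h₄, h₅'⟩
      exact ⟨p, q, ⟨hp, hq, h₁⟩, (k₃ _ _ hp _ h₅).1 h₂, (k₃ _ _ h₅ _ hi).1 h₃,
        (k₃ _ _ hq _ h₆).1 h₄, (k₃ _ _ h₆ _ hj).1 h₅'⟩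
    · rintro ⟨p, q, ⟨hp, hq, h₁⟩, h₂, h₃, h₄, h₅'⟩
      exact ⟨p, hp, q, hq, h₁, (k₃ _ _ hp _ h₅).2 h₂, (k₃ _ _ h₅ _ hi).2 h₃,
        (k₃ _ _ hq _ h₆).2 h₄, (k₃ _ _ h₆ _ hj).2 h₅'⟩
  have hwr : ∀ r ∈ blockStep.writes, r = main ∨ r = letters ∨ ∃ b, r = within b := by
    simp [blockStep, saturate, closures, closeWithin, Prog.writes]
  refine ⟨hM.eval (fun h => by simpa using hwr _ h) (fun b h => by simpa using hwr _ h), ?_, ?_⟩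
  · rintro ⟨p, q⟩ hx ⟨i, j⟩ (h | ⟨C, h₁, h₂, h₃, h₄, h₅', h₆'⟩)
    · obtain ⟨rfl, rfl⟩ := Prod.mk.inj h
      exact ⟨hx.1, hx.2.1, (key _ hx.1 _ hx.2.1).2 (Or.inl hx.2.2)⟩
    · have hi := hM.within_lt h₅ h₄
      have hj := hM.within_lt h₆ h₆'
      have hC : C ⊆ largest w D r := hM.subset_largest (by
        rintro (_ | _)
        exacts [h₁, h₂])
      exact ⟨hi, hj, (key _ hi _ hj).2 (Or.inr ⟨p, q, hx, h₃.mono hC, h₄.mono hC, h₅'.mono hC,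
        h₆'.mono hC⟩)⟩
  · rintro ⟨i, j⟩ ⟨hi, hj, hy⟩
    rcases (key _ hi _ hj).1 hy with h | ⟨p, q, hx, h₁, h₂, h₃, h₄⟩
    · exact ⟨(i, j), ⟨hi, hj, h⟩, .refl⟩
    · exact ⟨(p, q), hx, .single (.block _ (e 5) (e 6) (saturated_largest (w := w) (D := D) r false)
        (saturated_largest (w := w) (D := D) r true) h₁ h₂ h₃ h₄)⟩

/-- Adds the pairs that are reachable by one pattern step. -/
def patternStep : Prog Tbl := .seq letterStep (.loop 5 (.loop 6 blockStep))

theorem extends_blockSteps : Extends w D (.loop 5 (.loop 6 blockStep)) e fun x y =>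
    x = y ∨ ∃ r < w.length, ∃ r' < w.length, BlockAt D r r' x y := by
  refine Extends.loop (fun t x y => x = y ∨ ∃ r < t, ∃ r' < w.length, BlockAt D r r' x y)
    (fun r x y => x = y ∨ ∃ r' < w.length, BlockAt D r r' x y) (fun r hr => ?_) (by simp) ?_
  · refine Extends.loop (fun t x y => x = y ∨ ∃ r' < t, BlockAt D r r' x y)
      (fun r' x y => x = y ∨ BlockAt D r r' x y) (fun r' hr' => ?_) (by simp) ?_
    · exact (extends_blockStep (by simpa using hr) (by simpa using hr')).mono (by simp)
    · rintro i x y (rfl | ⟨r', hr', h⟩)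
      · exact ⟨x, Or.inl rfl, Or.inl rfl⟩
      · rcases Nat.lt_succ_iff_lt_or_eq.1 hr' with hr' | rfl
        · exact ⟨y, Or.inr ⟨r', hr', h⟩, Or.inl rfl⟩
        · exact ⟨x, Or.inl rfl, Or.inr h⟩
  · rintro i x y (rfl | ⟨r, hr, r', hr', h⟩)
    · exact ⟨x, Or.inl rfl, Or.inl rfl⟩
    · rcases Nat.lt_succ_iff_lt_or_eq.1 hr with hr | rfl
      · exact ⟨y, Or.inr ⟨r, hr, r', hr', h⟩, Or.inl rfl⟩
      · exact ⟨x, Or.inl rfl, Or.inr ⟨r', hr', h⟩⟩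

theorem extends_patternStep : Extends w D patternStep e fun x y =>
    x = y ∨ PatternStep (D false) (D true) x y := by
  intro S hM
  refine (extends_letterStep.seq extends_blockSteps).mono ?_ S hM
  rintro x y h₁ h₂ (rfl | h)
  · exact ⟨x, Or.inl rfl, Or.inl rfl⟩
  · cases h with
    | letter a h₃ h₄ => exact ⟨_, Or.inr ⟨a, h₃, h₄⟩, Or.inl rfl⟩
    | block C r r' h₃ h₄ h₅ h₆ h₇ h₈ =>
      exact ⟨_, Or.inl rfl, Or.inr ⟨r, hM.within_lt h₁ h₅, r', hM.within_lt h₂ h₇, C, h₃, h₄, h₅, h₆,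
        h₇, h₈⟩⟩

theorem Model.patternStep_lt (hM : Model w D S) {x y : ℕ × ℕ} (h₁ : x.1 < w.length)
    (h₂ : x.2 < w.length) (h : PatternStep (D false) (D true) x y) :
    y.1 < w.length ∧ y.2 < w.length := by
  cases h with
  | letter a h₃ h₄ => exact ⟨(hM.lt _ _ _ _ h₃).2.2, (hM.lt _ _ _ _ h₄).2.2⟩
  | block C r r' h₃ h₄ h₅ h₆ h₇ h₈ =>
    exact ⟨hM.within_lt (hM.within_lt h₁ h₅) h₆, hM.within_lt (hM.within_lt h₂ h₇) h₈⟩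

/-- Computes the pairs of states that are reachable from the initial pair by pattern steps. -/
def search : Prog Tbl :=
  .seq (.assign main (.and (.rel (init false) 0 0 0) (.rel (init true) 1 1 1)))
  (.loop 3 (.loop 4 patternStep))

/-- There are at most `w.length * w.length` pairs of states, and the two nested loops provide that
many pattern steps. -/
theorem search_spec (hM : Model w D S) {p : Bool → ℕ} (hp : ∀ b, p b < w.length)
    (hi : ∀ b, ∀ i < w.length, S (init b) i i i ↔ i = p b) (i : ℕ) (hi' : i < w.length) (j : ℕ)
    (hj : j < w.length) : search.eval w e S main i j j ↔
      Relation.ReflTransGen (PatternStep (D false) (D true)) (p false, p true) (i, j) := by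
  rw [search, Prog.eval_seq]
  set S₁ := (Prog.assign main _).eval w e S with hS₁
  have hM₁ : Model w D S₁ := hM.eval (by simp [Prog.writes]) (by simp [Prog.writes])
  have hx : ∀ x, x ∈ pairs w S₁ ↔ x = (p false, p true) := by
    rintro ⟨i, j⟩
    have h : ∀ i j, S₁ main i j j ↔ S (init false) i i i ∧ S (init true) j j j := by
      intro i j
      rw [hS₁, Prog.eval_assign]
      simp [Fm.Holds]
    simp only [pairs, Set.mem_ofPred_eq, h, Prod.mk.injEq]
    constructor
    · rintro ⟨h₁, h₂, h₃, h₄⟩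
      exact ⟨(hi _ _ h₁).1 h₃, (hi _ _ h₂).1 h₄⟩
    · rintro ⟨rfl, rfl⟩
      exact ⟨hp _, hp _, (hi _ _ (hp _)).2 rfl, (hi _ _ (hp _)).2 rfl⟩
  have hinner : ∀ e, Extends w D (.loop 4 patternStep) e fun x y =>
      y ∈ stage (PatternStep (D false) (D true)) x w.length := fun e =>
    Extends.loop (fun t x y => y ∈ stage (PatternStep (D false) (D true)) x t)
      (fun _ x y => x = y ∨ PatternStep (D false) (D true) x y) (fun _ _ => extends_patternStep)
      (fun x y h => h.symm) fun t x y h => by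
        rcases h with h | ⟨z, hz, h⟩
        exacts [⟨y, h, Or.inl rfl⟩, ⟨z, hz, Or.inr h⟩]
  have houter : Extends w D (.loop 3 (.loop 4 patternStep)) e fun x y =>
      y ∈ stage (PatternStep (D false) (D true)) x (w.length * w.length) :=
    Extends.loop (fun t x y => y ∈ stage (PatternStep (D false) (D true)) x (t * w.length))
      (fun _ x y => y ∈ stage (PatternStep (D false) (D true)) x w.length) (fun _ _ => hinner _)
      (fun x y h => by rw [Nat.zero_mul] at h; exact h.symm) fun t x y h => by
        rw [Nat.succ_mul] at h
        exact exists_mem_stage_of_mem_stage_add h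
  obtain ⟨-, h₁, h₂⟩ := houter S₁ hM₁
  constructor
  · intro h
    obtain ⟨x, hx', h⟩ := h₂ (i, j) ⟨hi', hj, h⟩
    rwa [(hx x).1 hx'] at h
  · intro h
    refine (h₁ _ ((hx _).2 rfl) (i, j) ((mem_stage_iff (N := w.length * w.length)
      (Finset.range w.length ×ˢ Finset.range w.length) (by simp [hp]) ?_ (by simp) _).2 h)).2.2
    intro x hx y hxy
    simp only [Finset.mem_product, Finset.mem_range] at hx ⊢
    exact hM.patternStep_lt hx.1 hx.2 hxy

end Tbl

/-! ### The complete decision procedure. -/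

namespace Tbl

/-- Reads an instance of the separability problem and searches for a synchronized pattern. -/
def separate : Prog Tbl :=
  .seq arith
  (.seq (.assign cur (.ex 9 (.ex 10 (.and (.neg (.ex 11 (.lt 11 9))) (.rel val 9 10 0)))))
  (.seq (parse false) (.seq (parse true) search)))

/-- No pair of accepting states has been reached. -/
def noPattern : Fm Tbl :=
  .neg (.ex 9 (.ex 10 (.and (.rel (fin false) 9 9 9) (.and (.rel (fin true) 10 10 10)
    (.rel main 9 10 10)))))

theorem separate_WF : separate.WF = true := by decide

theorem noPattern_WF : noPattern.WF = true := by decide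

theorem separate_spec (I : SepInstance) (e e' : Var → ℕ) (S : RelStore Tbl) :
    noPattern.Holds I.code (separate.eval I.code e S) e' ↔
      PTSeparable I.A.language I.B.language := by
  obtain ⟨k, A, B⟩ := I
  set w := SepInstance.code ⟨k, A, B⟩ with hw
  have hw₀ : w = [] ++ (unaryCode k ++ (A.code ++ B.code)) := by simp [hw, SepInstance.code]
  have hw₁ : w = unaryCode k ++ (A.code ++ B.code) := by simp [hw, SepInstance.code]
  have hw₂ : w = (unaryCode k ++ A.code) ++ (B.code ++ []) := by simp [hw, SepInstance.code]
  have hk : (unaryCode k).length = k + 1 := by simp [unaryCode]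
  have hA : A.numStates < A.code.length := by simp [FinNFA.code, unaryCode]
  have hB : B.numStates < B.code.length := by simp [FinNFA.code, unaryCode]
  have hl : w.length = k + 1 + A.code.length + B.code.length := by
    rw [hw₁]; simp only [List.length_append]; omega
  simp only [separate, Prog.eval_seq]
  have A₁ := arith_spec w e S
  set S₁ := arith.eval w e S
  clear_value S₁
  set S₂ := (Prog.assign cur _).eval w e S₁ with hS₂
  have A₂ : Arith w S₂ := A₁.eval (by simp [Prog.writes]) (by simp [Prog.writes])
    (by simp [Prog.writes])
  have c₂ : ∀ i < w.length, S₂ cur i i i ↔ i = (unaryCode k).length := by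
    intro i hi
    have h₀ := block_iff hw₀
    rw [List.length_nil, Nat.zero_add] at h₀
    rw [hS₂, Prog.eval_assign]
    simp only [Fm.Holds, update_apply, Fin.isValue, Fin.reduceEq, if_true, if_false]
    constructor
    · rintro ⟨x, hx, m, hm, h₁, h₂⟩
      obtain rfl : x = 0 := by
        by_contra hne
        exact h₁ ⟨0, by omega, by omega⟩
      exact ((h₀ _ _).1 ((A₁.val _ _ _ hx hm hi).1 h₂)).2
    · rintro rfl
      exact ⟨0, by omega, k, by omega, by simp,
        (A₁.val _ _ _ (by omega) (by omega) hi).2 ((h₀ _ _).2 ⟨rfl, rfl⟩)⟩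
  clear_value S₂
  obtain ⟨i₃, f₃, d₃, c₃⟩ := parse_spec (b := false) (e := e) hw₁ A₂ c₂
  set S₃ := (parse false).eval w e S₂ with hS₃
  have A₃ : Arith w S₃ := A₂.eval (by simp [Prog.writes, parse, closeItems, skipItems])
    (by simp [Prog.writes, parse, closeItems, skipItems])
    (by simp [Prog.writes, parse, closeItems, skipItems])
  clear_value S₃
  rw [← List.length_append] at c₃
  obtain ⟨i₄, f₄, d₄, -⟩ := parse_spec (b := true) (e := e) hw₂ A₃ c₃
  -- Reading the second automaton leaves the tables of the first one intact.
  have frame : ∀ r, r = init false ∨ r = fin false ∨ r = delta false →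
      (parse true).eval w e S₃ r = S₃ r := by
    rintro r (rfl | rfl | rfl) <;>
    exact Prog.eval_of_notMem_writes (by simp [Prog.writes, parse, closeItems, skipItems])
  have A₄ : Arith w ((parse true).eval w e S₃) := A₃.eval
    (by simp [Prog.writes, parse, closeItems, skipItems])
    (by simp [Prog.writes, parse, closeItems, skipItems])
    (by simp [Prog.writes, parse, closeItems, skipItems])
  set S₄ := (parse true).eval w e S₃ with hS₄
  rw [← frame _ (Or.inl rfl)] at i₃
  rw [← frame _ (Or.inr (Or.inl rfl))] at f₃
  rw [← frame _ (Or.inr (Or.inr rfl))] at d₃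
  clear_value S₄
  -- The transition relations moved to `ℕ`: `false` stands for the first automaton, `true` for the
  -- second.
  let D : Bool → ℕ → ℕ → ℕ → Prop := fun b => bif b then
    mapRel Fin.val Fin.val (fun p a q => q ∈ B.delta p a)
    else mapRel Fin.val Fin.val (fun p a q => q ∈ A.delta p a)
  have hM : Model w D S₄ := by
    refine ⟨A₄.eqv, ?_, ?_⟩
    · rintro (_ | _) p hp a ha q hq
      exacts [d₃ p hp a ha q hq, d₄ p hp a ha q hq]
    · rintro (_ | _) _ _ _ ⟨p, a, q, -, rfl, rfl, rfl⟩
      all_goals exact ⟨by omega, by omega, by omega⟩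
  have hs := search_spec (e := e) hM (p := fun b => bif b then B.init else A.init)
    (by rintro (_ | _) <;> simp only [cond_true, cond_false] <;> omega)
    (by rintro (_ | _); exacts [i₃, i₄])
  have hreach : ∀ i < w.length, ∀ j < w.length, search.eval w e S₄ main i j j ↔
      ∃ (q : Fin A.numStates) (q' : Fin B.numStates), (i, j) = ((q : ℕ), (q' : ℕ)) ∧
        Relation.ReflTransGen (PatternStep (fun p a q => q ∈ A.delta p a)
          (fun p a q => q ∈ B.delta p a))
          (A.init, B.init) (q, q') :=
    fun i hi j hj => (hs i hi j hj).trans (reflTransGen_patternStep_mapRel Fin.val_injective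
      Fin.val_injective Fin.val_injective)
  have f₅ : ∀ b, search.eval w e S₄ (fin b) = S₄ (fin b) := fun b =>
    Prog.eval_of_notMem_writes (by simp [Prog.writes, search, patternStep, letterStep, blockStep,
      saturate, closures, closeWithin])
  rw [← not_iff_not, FinNFA.not_ptSeparable_iff_pattern]
  simp only [noPattern, Fm.Holds, update_apply, Fin.isValue, Fin.reduceEq, if_true, if_false,
    not_not]
  constructor
  · rintro ⟨i, hi, j, hj, h₁, h₂, h₃⟩
    rw [f₅, f₃ i hi] at h₁
    rw [f₅, f₄ j hj] at h₂
    obtain ⟨q, hq, rfl⟩ := h₁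
    obtain ⟨q', hq', rfl⟩ := h₂
    obtain ⟨p, p', he, hr⟩ := (hreach _ hi _ hj).1 h₃
    simp only [Prod.mk.injEq, Fin.val_inj] at he
    obtain ⟨rfl, rfl⟩ := he
    exact ⟨_, hq, _, hq', hr⟩
  · rintro ⟨q, hq, q', hq', hr⟩
    have hi : (q : ℕ) < w.length := by omega
    have hj : (q' : ℕ) < w.length := by omega
    refine ⟨q, hi, q', hj, ?_, ?_, (hreach _ hi _ hj).2 ⟨q, q', rfl, hr⟩⟩
    · rw [f₅, f₃ _ hi]; exact ⟨q, hq, rfl⟩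
    · rw [f₅, f₄ _ hj]; exact ⟨q', hq', rfl⟩

end Tbl

/-! ### The length of the code -/

theorem List.length_flatMap_le {α β : Type*} (l : List α) (f : α → List β) {c : ℕ}
    (h : ∀ x ∈ l, (f x).length ≤ c) : (l.flatMap f).length ≤ l.length * c := by
  induction l with
  | nil => simp
  | cons x l ih =>
    have h₁ := h x (by simp)
    have h₂ := ih fun y hy => h y (by simp [hy])
    rw [List.flatMap_cons, List.length_append, List.length_cons, Nat.succ_mul]
    omega

/-- There are at most `s ^ 3` transitions, each with three unary numbers below `s` and an announcing
bit. -/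
theorem FinNFA.length_code_le {k : ℕ} (A : FinNFA k) {s : ℕ} (hk : k ≤ s) (hN : A.numStates ≤ s) :
    A.code.length ≤ 2 * (s + 1) + (s * (s + 1) + 1) + (s * (s * (s * (3 * s + 4))) + 1) := by
  have h₁ : A.finalCode.length ≤ s * (s + 1) + 1 := by
    rw [FinNFA.finalCode, List.length_append, List.length_singleton]
    gcongr
    refine (List.length_flatMap_le _ _ (c := s + 1) fun q _ => ?_).trans
      (by rw [List.length_finRange]; gcongr)
    split_ifs
    · simp [unaryCode]; omega
    · simp
  have h₂ : A.deltaCode.length ≤ s * (s * (s * (3 * s + 4))) + 1 := by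
    rw [FinNFA.deltaCode, List.length_append, List.length_singleton]
    gcongr
    refine (List.length_flatMap_le _ _ (c := s * (s * (3 * s + 4))) fun p _ => ?_).trans
      (by rw [List.length_finRange]; gcongr)
    refine (List.length_flatMap_le _ _ (c := s * (3 * s + 4)) fun a _ => ?_).trans
      (by rw [List.length_finRange]; gcongr)
    refine (List.length_flatMap_le _ _ (c := 3 * s + 4) fun q _ => ?_).trans
      (by rw [List.length_finRange]; gcongr)
    split_ifs
    · simp [unaryCode]; omega
    · simp
  have h₃ : (unaryCode A.numStates).length ≤ s + 1 := by simp [unaryCode]; omega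
  have h₄ : (unaryCode A.init).length ≤ s + 1 := by simp [unaryCode]; omega
  simp only [FinNFA.code, List.length_append]
  omega

open Polynomial in
theorem SepInstance.exists_length_code_le :
    ∃ q : Polynomial ℕ, ∀ I : SepInstance, I.code.length ≤ q.eval I.size := by
  refine ⟨X + 1 + 2 * (2 * (X + 1) + (X * (X + 1) + 1) + (X * (X * (X * (3 * X + 4))) + 1)),
    fun I => ?_⟩
  have h₁ := I.A.length_code_le (s := I.size) (by simp [SepInstance.size])
    (by simp [SepInstance.size]; omega)
  have h₂ := I.B.length_code_le (s := I.size) (by simp [SepInstance.size])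
    (by simp [SepInstance.size]; omega)
  have h₃ : (unaryCode I.alphabetSize).length ≤ I.size + 1 := by simp [unaryCode, SepInstance.size]
  simp only [SepInstance.code, List.length_append, eval_add, eval_mul, eval_X, eval_one,
    eval_ofNat]
  omega

theorem Polynomial.eval_mono_nat (p : Polynomial ℕ) : Monotone fun n => p.eval n := by
  intro m n h
  simp only [Polynomial.eval_eq_sum_range]
  gcongr

/-- The machine runs in polynomial time in the length of the code; since polynomials over `ℕ` are
monotone, composing its time bound with the polynomial bound on that length gives the bound in the
number of states and symbols. -/
theorem mainTheorem4 :
    ∃ (M : Turing.TM2ComputableInPolyTime SepInstance.code Computability.encodeBool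
        SepInstance.answer) (p : Polynomial ℕ),
      ∀ I : SepInstance, M.time.eval I.code.length ≤ p.eval I.size := by
  obtain ⟨M⟩ := Tbl.separate.nonempty_computableInPolyTime Tbl.noPattern Tbl.separate_WF
    Tbl.noPattern_WF SepInstance.code (fun I => by simp [SepInstance.code, unaryCode])
    SepInstance.answer (fun I => by
      rw [Tbl.separate_spec]
      simp [SepInstance.answer])
  obtain ⟨q, hq⟩ := SepInstance.exists_length_code_le
  exact ⟨M, M.time.comp q, fun I => by
    rw [Polynomial.eval_comp]
    exact M.time.eval_mono_nat (hq I)⟩
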